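/- Let $N\ge 3$ be odd, let $u_0\in\dot H^1(\mathbb R^N)$ and $u_1\in L^2(\mathbb R^N)$ be real-valued, where $\dot H^1(\mathbb R^N)$ is the space of functions in $L^{2N/(N-2)}(\mathbb R^N)$ whose distributional gradient is in $L^2(\mathbb R^N)$, with norm $\|\nabla f\|_{L^2}$. Let $u$, with $u\in C(\mathbb R,\dot H^1)$ and $\partial_t u\in C(\mathbb R,L^2)$, be the solution (in the sense of distributions) of $$\partial_t^2u-\Delta u=0,\qquad u_{\restriction t=0}=u_0,\quad \partial_t u_{\restriction t=0}=u_1 .$$ Then the limits $$E^{\rm out}_{\pm\infty}=\lim_{t\to\pm\infty}\frac12\int_{|x|\ge|t|}\left(|\nabla u(t,x)|^2+(\partial_tu(t,x))^2\right)dx$$ exist and $$E^{\rm out}_{+\infty}+E^{\rm out}_{-\infty}=\frac12\int_{\mathbb R^N}|\nabla u_0|^2\,dx+\frac12\int_{\mathbb R^N}u_1^2\,dx .$$ Moreover, at least one of the following holds: $$\forall t\ge0,\quad\int_{|x|\ge t}\left(|\nabla u(t,x)|^2+(\partial_tu(t,x))^2\right)dx\ge\frac12\int_{\mathbb R^N}\left(|\nabla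 u_0(x)|^2+u_1(x)^2\right)dx,$$ or $$\forall t\le0,\quad\int_{|x|\ge-t}\left(|\nabla u(t,x)|^2+(\partial_tu(t,x))^2\right)dx\ge\frac12\int_{\mathbb R^N}\left(|\nabla u_0(x)|^2+u_1(x)^2\right)dx .$$ -/

import Mathlib

open MeasureTheory Filter Topology
open scoped ContDiff

namespace LinearWave

/-- Euclidean space `ℝ^N`. -/
abbrev Space (N : ℕ) : Type := EuclideanSpace ℝ (Fin N)

/-- Real-valued test functions on `ℝ^N`: smooth and compactly supported. -/
structure IsTestFunction {N : ℕ} (φ : Space N → ℝ) : Prop where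
  smooth : ContDiff ℝ ∞ φ
  hasCompactSupport : HasCompactSupport φ

/-- `G` is the gradient of `f` in the sense of distributions: both are locally integrable, and
`∫ f ∂_w φ = - ∫ φ (G · w)` for every test function `φ` and every direction `w`. -/
structure HasWeakGradient {N : ℕ} (f : Space N → ℝ) (G : Space N → Space N) : Prop where
  locallyIntegrable : LocallyIntegrable f volume
  locallyIntegrable_gradient : LocallyIntegrable G volume
  integral_eq : ∀ φ : Space N → ℝ, IsTestFunction φ → ∀ w : Space N,
    ∫ x, f x * fderiv ℝ φ x w = - ∫ x, φ x * inner ℝ (G x) w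

/-- For `N ≥ 3`: `f` belongs to the homogeneous Sobolev space `Ḣ¹(ℝ^N)` (the completion of the
test functions for the norm `‖∇φ‖_{L²}`), with weak gradient `G`. By the Sobolev inequality this
space is the set of all `f ∈ L^{2N/(N-2)}` whose distributional gradient is in `L²`; its norm is
`‖G‖_{L²}`. -/
structure MemHomogeneousSobolev {N : ℕ} (f : Space N → ℝ) (G : Space N → Space N) : Prop where
  memLp : MemLp f (ENNReal.ofReal (2 * (N : ℝ) / ((N : ℝ) - 2))) volume
  hasWeakGradient : HasWeakGradient f G
  memLp_gradient : MemLp G 2 volume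

/-- `u` is the finite energy solution, on the whole time line, of `∂_t² u - Δ u = 0` with data
`u(0) = u₀`, `∂_t u(0) = u₁`, where `Du t` is the spatial gradient of `u t` and `v t` is
`∂_t u` at time `t`: one has `u ∈ C(ℝ, Ḣ¹)`, `∂_t u ∈ C(ℝ, L²)`, and the identities `∂_t u = v`
and `∂_t v = Δ u` hold for all times in the sense of distributions on `ℝ^N`. -/
structure IsSolution {N : ℕ} (u₀ u₁ : Space N → ℝ) (u : ℝ → Space N → ℝ)
    (Du : ℝ → Space N → Space N) (v : ℝ → Space N → ℝ) : Prop where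
  memHomogeneousSobolev : ∀ t, MemHomogeneousSobolev (u t) (Du t)
  memLp : ∀ t, MemLp (v t) 2 volume
  continuous_gradient : ∀ t, Tendsto (fun s => eLpNorm (Du s - Du t) 2 volume) (𝓝 t) (𝓝 0)
  continuous_timeDeriv : ∀ t, Tendsto (fun s => eLpNorm (v s - v t) 2 volume) (𝓝 t) (𝓝 0)
  hasDerivAt : ∀ ψ : Space N → ℝ, IsTestFunction ψ → ∀ t,
    HasDerivAt (fun s => ∫ x, u s x * ψ x) (∫ x, v t x * ψ x) t
  wave_equation : ∀ ψ : Space N → ℝ, IsTestFunction ψ → ∀ t,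
    HasDerivAt (fun s => ∫ x, v s x * ψ x) (- ∫ x, inner ℝ (Du t x) (gradient ψ x)) t
  initial_position : u 0 =ᵐ[volume] u₀
  initial_velocity : v 0 =ᵐ[volume] u₁

/-- The exterior energy `½ ∫_{|x| ≥ |t|} (|∇u(t,x)|² + (∂_t u(t,x))²) dx`. -/
noncomputable def exteriorEnergy {N : ℕ} (Du : ℝ → Space N → Space N) (v : ℝ → Space N → ℝ)
    (t : ℝ) : ℝ :=
  (1 / 2) * ∫ x in {x : Space N | |t| ≤ ‖x‖}, (‖Du t x‖ ^ 2 + v t x ^ 2)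

end LinearWave

/-!
For a free wave in odd dimension `N = 2m + 1` the energies left outside the light cone as
`t → +∞` and `t → -∞` add up to the total energy.

Everything is proved for the first-order system `∂_t D = ∇v`, `∂_t v = div D` satisfied by
`(D, v) = (∇u, ∂_t u)`, in its weak form (`IsFirstOrderSolution`). Mollifying in space and testing
with a smooth weight that decreases along the cone gives the exterior energy inequality
`IsFirstOrderSolution.setIntegral_energy_le`; hence the exterior energy decreases as `|t|` grows,
its limits at `±∞` exist, and the energy is conserved. Since the exterior energy is a quadratic form
bounded by the conserved energy, the identity for the limits passes to limits of data in energy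
norm (`IsFirstOrderSolution.add_eq_of_approx`), so it suffices to prove it on a dense set of data.

The dense set is spanned by the explicit solutions `u = Re (c (|x - p|² - (t - iε)²)⁻ᵐ)` with
`c ∈ ℂ`, `p ∈ ℝ^N` and `ε > 0`; these rational functions are solutions because `N = 2m + 1`. On rays
`x = (t + s)θ` these satisfy `tᵐ (D, v) → (-g(θ, s) θ, g(θ, s))`, and a parity relation gives the
profile at `-∞` as `± g(θ, -s)` (`HasRadiationField`, `hasRadiationField_explicit`). In polar
coordinates the exterior energy at `+∞` is the mass of `g²` on `s > 0`, the exterior energy at `-∞`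
is its mass on `s < 0`, and together they are the total energy
(`HasRadiationField.tendsto_exterior`).

For density (`exists_radiative_approx`): at `t = 0` the explicit solutions give the velocities
`(|x - p|² + ε²)⁻ᵐ⁻¹` and the gradients of `(|x - p|² + ε²)⁻ᵐ`. The former are dilates and
translates of an integrable kernel, so only `0` is orthogonal to all of them. A field in `L²`
orthogonal to all of the latter is divergence free: after mollification and integration by parts its
divergence is orthogonal to `(|x|² + ε²)⁻ᵐ - (|x|² + 4ε²)⁻ᵐ`, which is positive and integrable,
and one lets `ε → 0`. Finally the gradient of a function of `Ḣ¹` is orthogonal to divergence free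
fields, by a cutoff argument that uses `f ∈ L^{2N/(N-2)}`.
-/

namespace LinearWave

open scoped ENNReal NNReal

/-! ### Test functions and mollification -/

section Mollification

variable {N : ℕ} {G : Type*} [NormedAddCommGroup G] [NormedSpace ℝ G]

theorem IsTestFunction.continuous {φ : Space N → ℝ} (hφ : IsTestFunction φ) : Continuous φ :=
  hφ.smooth.continuous

theorem IsTestFunction.differentiable {φ : Space N → ℝ} (hφ : IsTestFunction φ) :
    Differentiable ℝ φ :=
  hφ.smooth.differentiable (by simp)

theorem IsTestFunction.memLp {φ : Space N → ℝ} (hφ : IsTestFunction φ) (p : ℝ≥0∞) :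
    MemLp φ p volume :=
  hφ.continuous.memLp_of_hasCompactSupport hφ.hasCompactSupport

theorem IsTestFunction.integrable {φ : Space N → ℝ} (hφ : IsTestFunction φ) :
    Integrable φ volume :=
  hφ.continuous.integrable_of_hasCompactSupport hφ.hasCompactSupport

theorem IsTestFunction.fderiv_apply {φ : Space N → ℝ} (hφ : IsTestFunction φ) (w : Space N) :
    IsTestFunction (fun x => fderiv ℝ φ x w) where
  smooth := (hφ.smooth.fderiv_right (m := ∞) (by simp)).clm_apply contDiff_const
  hasCompactSupport := hφ.hasCompactSupport.fderiv_apply (𝕜 := ℝ) w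

theorem IsTestFunction.comp_sub_left {φ : Space N → ℝ} (hφ : IsTestFunction φ) (y : Space N) :
    IsTestFunction (fun x => φ (y - x)) where
  smooth := hφ.smooth.comp (contDiff_const.sub contDiff_id)
  hasCompactSupport := hφ.hasCompactSupport.comp_homeomorph (Homeomorph.subLeft y)

theorem fderiv_comp_sub_left_apply {φ : Space N → ℝ} (hφ : Differentiable ℝ φ) (x y w : Space N) :
    fderiv ℝ (fun x => φ (y - x)) x w = - fderiv ℝ φ (y - x) w := by
  have h : HasFDerivAt (fun x => φ (y - x)) ((fderiv ℝ φ (y - x)).comp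
      (-(ContinuousLinearMap.id ℝ (Space N)))) x := by
    refine HasFDerivAt.comp x (hφ (y - x)).hasFDerivAt ?_
    exact (hasFDerivAt_id x).const_sub y
  rw [h.fderiv]; simp

/-- The mollification `ρ * F` of a locally integrable function by a test function. -/
noncomputable def mollify (ρ : Space N → ℝ) (F : Space N → G) (y : Space N) : G :=
  ∫ x, ρ (y - x) • F x

theorem mollify_eq_convolution (ρ : Space N → ℝ) (F : Space N → G) :
    mollify ρ F = convolution ρ F (ContinuousLinearMap.lsmul ℝ ℝ) volume := by
  ext y
  rw [convolution_lsmul_swap, mollify]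

theorem integrable_mollify {ρ : Space N → ℝ} (hρ : IsTestFunction ρ) {F : Space N → G}
    (hF : LocallyIntegrable F volume) (y : Space N) : Integrable (fun x => ρ (y - x) • F x) := by
  have := (hρ.hasCompactSupport.convolutionExists_left (ContinuousLinearMap.lsmul ℝ ℝ)
    hρ.continuous hF y).integrable_swap
  simpa using this

theorem contDiff_mollify [CompleteSpace G] {ρ : Space N → ℝ} (hρ : IsTestFunction ρ)
    {F : Space N → G} (hF : LocallyIntegrable F volume) : ContDiff ℝ ∞ (mollify ρ F) := by
  rw [mollify_eq_convolution]
  exact hρ.hasCompactSupport.contDiff_convolution_left _ hρ.smooth hF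

/-- Derivatives of a mollification fall on the kernel. -/
theorem fderiv_mollify [CompleteSpace G] {ρ : Space N → ℝ} (hρ : IsTestFunction ρ)
    {F : Space N → G} (hF : LocallyIntegrable F volume) (y w : Space N) :
    fderiv ℝ (mollify ρ F) y w = mollify (fun x => fderiv ℝ ρ x w) F y := by
  have h := hρ.hasCompactSupport.hasFDerivAt_convolution_left (ContinuousLinearMap.lsmul ℝ ℝ)
    (hρ.smooth.of_le (by simp)) hF y
  rw [← mollify_eq_convolution] at h
  rw [h.fderiv, convolution_eq_swap, mollify, ContinuousLinearMap.integral_apply]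
  · simp [ContinuousLinearMap.precompL_apply]
  · have hc : ConvolutionExists (fderiv ℝ ρ) F
        ((ContinuousLinearMap.lsmul ℝ ℝ : ℝ →L[ℝ] G →L[ℝ] G).precompL (Space N)) volume :=
      (hρ.hasCompactSupport.fderiv (𝕜 := ℝ)).convolutionExists_left _
        (hρ.smooth.continuous_fderiv (by simp)) hF
    exact (hc y).integrable_swap

theorem inner_mollify {H : Type*} [NormedAddCommGroup H] [InnerProductSpace ℝ H] [CompleteSpace H]
    {ρ : Space N → ℝ} (hρ : IsTestFunction ρ) {F : Space N → H}
    (hF : LocallyIntegrable F volume) (y : Space N) (w : H) :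
    inner ℝ (mollify ρ F y) w = mollify ρ (fun x => inner ℝ (F x) w) y := by
  rw [mollify, mollify, real_inner_comm, ← integral_inner (integrable_mollify hρ hF y)]
  refine integral_congr_ae (ae_of_all _ fun x => ?_)
  simp [real_inner_smul_right, real_inner_comm]

/-- The Cauchy–Schwarz bound for mollifications: `L²` control becomes uniform control. -/
theorem enorm_mollify_le {ρ : Space N → ℝ} (hρ : IsTestFunction ρ) {F : Space N → G}
    (hF : AEStronglyMeasurable F volume) (y : Space N) :
    ‖mollify ρ F y‖ₑ ≤ eLpNorm ρ 2 volume * eLpNorm F 2 volume := by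
  have h1 : eLpNorm (fun x => ρ (y - x)) 2 volume = eLpNorm ρ 2 volume :=
    eLpNorm_comp_measurePreserving (f := fun x => y - x) hρ.continuous.aestronglyMeasurable
      (Measure.measurePreserving_sub_left volume y)
  have h2 := eLpNorm_smul_le_mul_eLpNorm (p := 2) (q := 2) (r := 1) hF
    ((hρ.comp_sub_left y).continuous.aestronglyMeasurable (μ := volume))
  rw [h1] at h2
  refine le_trans (enorm_integral_le_lintegral_enorm _) ?_
  rw [eLpNorm_one_eq_lintegral_enorm] at h2
  exact h2

/-- Translations act continuously on `L²`. -/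
theorem tendsto_eLpNorm_translate_sub {G : Type*} [NormedAddCommGroup G] {F : Space N → G}
    (hF : MemLp F 2 volume) :
    Tendsto (fun h : Space N => eLpNorm (fun y => F (y - h) - F y) 2 volume) (𝓝 0) (𝓝 0) := by
  let g : C(Space N, C(Space N, Space N)) :=
    ContinuousMap.curry ⟨fun a : Space N × Space N => a.2 - a.1, by fun_prop⟩
  have hg : ∀ h, MeasurePreserving (g h) (volume : Measure (Space N)) volume := fun h =>
    measurePreserving_sub_right volume h
  have hc : Continuous (fun h => Lp.compMeasurePreserving (g h) (hg h) (hF.toLp F)) :=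
    Continuous.compMeasurePreservingLp continuous_const g.continuous hg (by simp)
  have h0 := hc.tendsto 0
  rw [tendsto_iff_edist_tendsto_0] at h0
  refine h0.congr fun h => ?_
  rw [Lp.edist_def]
  refine eLpNorm_congr_ae ?_
  have e1 := Lp.coeFn_compMeasurePreserving (hF.toLp F) (hg h)
  have e2 := Lp.coeFn_compMeasurePreserving (hF.toLp F) (hg 0)
  have e3 := (hg h).quasiMeasurePreserving.ae_eq_comp hF.coeFn_toLp
  have e4 := (hg 0).quasiMeasurePreserving.ae_eq_comp hF.coeFn_toLp
  filter_upwards [e1, e2, e3, e4] with y h1 h2 h3 h4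
  simp only [Pi.sub_apply, h1, h2, h3, h4]
  simp [g]

/-- Mollifying kernels: nonnegative test functions of integral `1`. -/
structure IsMollifier (ρ : Space N → ℝ) : Prop extends IsTestFunction ρ where
  nonneg : ∀ x, 0 ≤ ρ x
  integral_eq_one : ∫ x, ρ x = 1

theorem exists_isMollifier (δ : ℝ) (hδ : 0 < δ) :
    ∃ ρ : Space N → ℝ, IsMollifier ρ ∧ ∀ x, ρ x ≠ 0 → ‖x‖ < δ := by
  let φ : ContDiffBump (0 : Space N) := ⟨δ / 2, δ, by positivity, by linarith⟩
  refine ⟨φ.normed volume, ⟨⟨φ.contDiff_normed, φ.hasCompactSupport_normed⟩, φ.nonneg_normed,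
    φ.integral_normed⟩, fun x hx => ?_⟩
  have : x ∈ Function.support (φ.normed volume) := hx
  rw [φ.support_normed_eq] at this
  simpa using this

/-- Minkowski's inequality for `ρ * F - F`: it is controlled by the translations `F(· - h) - F`
with `h` in the support of the kernel `ρ`. -/
theorem eLpNorm_mollify_sub_le [CompleteSpace G] {ρ : Space N → ℝ} (hρ : IsMollifier ρ)
    {F : Space N → G} (hF : MemLp F 2 volume) (C : ℝ≥0∞)
    (hC : ∀ h, ρ h ≠ 0 → eLpNorm (fun y => F (y - h) - F y) 2 volume ≤ C) :
    eLpNorm (mollify ρ F - F) 2 volume ≤ C := by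
  wlog hFm : StronglyMeasurable F generalizing F
  · obtain ⟨F', hF', hFF'⟩ := hF.1
    have hM : mollify ρ F = mollify ρ F' := by
      ext y
      refine integral_congr_ae ?_
      filter_upwards [hFF'] with x hx
      simp [hx]
    have := this ((memLp_congr_ae hFF').1 hF) (fun h hh => ?_) hF'
    · rw [hM]
      rwa [eLpNorm_congr_ae (g := mollify ρ F' - F')]
      filter_upwards [hFF'] with x hx
      simp [hx]
    · convert! hC h hh using 1
      refine eLpNorm_congr_ae ?_
      filter_upwards [hFF', (measurePreserving_sub_right volume h).quasiMeasurePreserving.ae_eq_comp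
        hFF'] with x hx hx'
      simp only [Function.comp] at hx'
      rw [hx, hx']
  have hFl : LocallyIntegrable F volume := hF.locallyIntegrable (by norm_num)
  -- The mollification is an average of translates for the probability measure `ρ dx`.
  let ν : Measure (Space N) := volume.withDensity (fun x => ENNReal.ofReal (ρ x))
  have hρm : Measurable (fun x => ENNReal.ofReal (ρ x)) := hρ.continuous.measurable.ennreal_ofReal
  have hν : IsProbabilityMeasure ν := ⟨by
    simp only [ν]
    rw [withDensity_apply _ MeasurableSet.univ, setLIntegral_univ,
      ← ofReal_integral_eq_lintegral_ofReal hρ.integrable (ae_of_all _ hρ.nonneg),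
      hρ.integral_eq_one, ENNReal.ofReal_one]⟩
  have key : ∀ y, ‖mollify ρ F y - F y‖ₑ ^ 2 ≤ ∫⁻ h, ‖F (y - h) - F y‖ₑ ^ 2 ∂ν := by
    intro y
    have hI := integrable_mollify hρ.toIsTestFunction hFl y
    have e1 : mollify ρ F y - F y = ∫ x, ρ (y - x) • (F x - F y) := by
      simp only [smul_sub]
      rw [integral_sub hI ((hρ.toIsTestFunction.comp_sub_left y).integrable.smul_const _),
        integral_smul_const, integral_sub_left_eq_self (fun x => ρ x) volume y,
        hρ.integral_eq_one, one_smul]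
      rfl
    have e2 : mollify ρ F y - F y = ∫ h, ρ h • (F (y - h) - F y) := by
      rw [e1, ← integral_sub_left_eq_self (fun x => ρ (y - x) • (F x - F y)) volume y]
      simp
    have e3 : ‖mollify ρ F y - F y‖ₑ ≤ ∫⁻ h, ‖F (y - h) - F y‖ₑ ∂ν := by
      rw [e2, lintegral_withDensity_eq_lintegral_mul _ hρm]
      · refine (enorm_integral_le_lintegral_enorm _).trans (lintegral_mono fun h => ?_)
        simp only [Pi.mul_apply, enorm_smul]
        rw [Real.enorm_of_nonneg (hρ.nonneg h)]
      · exact ((hFm.comp_measurable (measurable_const.sub measurable_id)).sub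
          stronglyMeasurable_const).enorm
    have e4 : ∫⁻ h, ‖F (y - h) - F y‖ₑ ∂ν
        ≤ (∫⁻ h, ‖F (y - h) - F y‖ₑ ^ 2 ∂ν) ^ (1 / 2 : ℝ) := by
      have := eLpNorm_le_eLpNorm_of_exponent_le (μ := ν) (p := 1) (q := 2)
        (f := fun h => F (y - h) - F y) (by norm_num)
        ((hFm.comp_measurable (measurable_const.sub measurable_id)).sub
          stronglyMeasurable_const).aestronglyMeasurable
      rw [eLpNorm_one_eq_lintegral_enorm, eLpNorm_eq_lintegral_rpow_enorm_toReal (by norm_num)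
        (by norm_num)] at this
      simpa using this
    calc ‖mollify ρ F y - F y‖ₑ ^ 2
        ≤ ((∫⁻ h, ‖F (y - h) - F y‖ₑ ^ 2 ∂ν) ^ (1 / 2 : ℝ)) ^ 2 := by gcongr; exact e3.trans e4
      _ = _ := by rw [← ENNReal.rpow_natCast, ← ENNReal.rpow_mul]; norm_num
  have hmeas : Measurable (Function.uncurry fun y h => ‖F (y - h) - F y‖ₑ ^ 2) := by
    refine Measurable.pow_const ?_ 2
    exact ((hFm.comp_measurable (measurable_fst.sub measurable_snd)).sub
      (hFm.comp_measurable measurable_fst)).enorm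
  have sq : ∀ H : Space N → G, eLpNorm H 2 volume = (∫⁻ y, ‖H y‖ₑ ^ 2) ^ (1 / 2 : ℝ) := by
    intro H
    rw [eLpNorm_eq_lintegral_rpow_enorm_toReal (by norm_num) (by norm_num)]
    simp
  rw [sq]
  calc (∫⁻ y, ‖(mollify ρ F - F) y‖ₑ ^ 2) ^ (1 / 2 : ℝ)
      ≤ (∫⁻ y, ∫⁻ h, ‖F (y - h) - F y‖ₑ ^ 2 ∂ν) ^ (1 / 2 : ℝ) := by
        gcongr with y; exact key y
    _ = (∫⁻ h, (∫⁻ y, ‖F (y - h) - F y‖ₑ ^ 2) ∂ν) ^ (1 / 2 : ℝ) := by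
        rw [lintegral_lintegral_swap hmeas.aemeasurable]
    _ ≤ (∫⁻ h, C ^ 2 ∂ν) ^ (1 / 2 : ℝ) := by
        refine ENNReal.rpow_le_rpow (lintegral_mono_ae ?_) (by norm_num)
        refine (ae_withDensity_iff hρm).2 (ae_of_all _ fun h hh => ?_)
        have := hC h (fun h0 => hh (by simp [h0]))
        rw [sq] at this
        calc ∫⁻ y, ‖F (y - h) - F y‖ₑ ^ 2
            = ((∫⁻ y, ‖F (y - h) - F y‖ₑ ^ 2) ^ (1 / 2 : ℝ)) ^ 2 := by
              rw [← ENNReal.rpow_natCast, ← ENNReal.rpow_mul]; norm_num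
          _ ≤ C ^ 2 := by gcongr
    _ = C := by
        rw [lintegral_const, measure_univ, mul_one, ← ENNReal.rpow_natCast, ← ENNReal.rpow_mul]
        norm_num

theorem memLp_mollify [CompleteSpace G] {ρ : Space N → ℝ} (hρ : IsMollifier ρ)
    {F : Space N → G} (hF : MemLp F 2 volume) : MemLp (mollify ρ F) 2 volume := by
  have hm : AEStronglyMeasurable (mollify ρ F) volume :=
    (contDiff_mollify hρ.toIsTestFunction (hF.locallyIntegrable
      (by norm_num))).continuous.aestronglyMeasurable
  have h1 : MemLp (mollify ρ F - F) 2 volume := by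
    refine ⟨hm.sub hF.1, lt_of_le_of_lt (eLpNorm_mollify_sub_le hρ hF
      (eLpNorm F 2 volume + eLpNorm F 2 volume) fun h _ => ?_) (by
        simp [ENNReal.add_lt_top, hF.2])⟩
    have hmp := measurePreserving_sub_right (volume : Measure (Space N)) h
    refine (eLpNorm_sub_le (hF.1.comp_measurePreserving hmp) hF.1 (by norm_num)).trans ?_
    rw [← eLpNorm_comp_measurePreserving hF.1 hmp]
  simpa using h1.add hF

/-- A sequence of mollifying kernels whose supports shrink to the origin. -/
theorem exists_mollifier_seq (N : ℕ) : ∃ ρ : ℕ → Space N → ℝ, (∀ n, IsMollifier (ρ n)) ∧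
    ∀ n x, ρ n x ≠ 0 → ‖x‖ < 1 / ((n : ℝ) + 1) := by
  choose ρ h1 h2 using fun n : ℕ => exists_isMollifier (N := N) (1 / ((n : ℝ) + 1)) (by positivity)
  exact ⟨ρ, h1, h2⟩

theorem tendsto_eLpNorm_mollify_sub [CompleteSpace G] {ρ : ℕ → Space N → ℝ}
    (hρ : ∀ n, IsMollifier (ρ n)) (hs : ∀ n x, ρ n x ≠ 0 → ‖x‖ < 1 / ((n : ℝ) + 1))
    {F : Space N → G} (hF : MemLp F 2 volume) :
    Tendsto (fun n => eLpNorm (mollify (ρ n) F - F) 2 volume) atTop (𝓝 0) := by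
  rw [ENNReal.tendsto_nhds_zero]
  intro ε hε
  obtain ⟨δ, hδ, h⟩ := Metric.eventually_nhds_iff.1
    (ENNReal.tendsto_nhds_zero.1 (tendsto_eLpNorm_translate_sub hF) ε hε)
  filter_upwards [(tendsto_one_div_add_atTop_nhds_zero_nat (𝕜 := ℝ)).eventually
    (gt_mem_nhds hδ)] with n hn
  refine eLpNorm_mollify_sub_le (hρ n) hF ε fun x hx => h ?_
  simpa using (hs n x hx).trans hn

end Mollification

/-! ### The weighted energy inequality -/

section Energy

variable {N : ℕ}

/-- The `j`-th vector of the standard basis of `ℝ^N`. -/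
noncomputable abbrev stdVec (j : Fin N) : Space N := EuclideanSpace.single j (1 : ℝ)

theorem sum_smul_stdVec (y : Space N) : ∑ j, y j • (stdVec j : Space N) = y := by
  have := (EuclideanSpace.basisFun (Fin N) ℝ).sum_repr y
  simpa using this

theorem sum_apply_stdVec_mul (L : Space N →L[ℝ] ℝ) (y : Space N) :
    ∑ j, L (stdVec j) * y j = L y := by
  conv_rhs => rw [← sum_smul_stdVec y, map_sum]
  refine Finset.sum_congr rfl fun j _ => ?_
  rw [map_smul, smul_eq_mul, mul_comm]

/-- A smooth solution `(a, b)` of `∂_t a = div b`, `∂_t b = ∇ a` loses energy with respect to any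
compactly supported weight `W` with `∂_t W + |∇W| ≤ 0`. -/
theorem antitone_weighted_energy_of_smooth {a : ℝ → Space N → ℝ} {b : ℝ → Fin N → Space N → ℝ}
    {W : ℝ → Space N → ℝ}
    (ha : ∀ t, ContDiff ℝ 1 (a t)) (hb : ∀ t j, ContDiff ℝ 1 (b t j))
    (hat : ∀ t y, HasDerivAt (fun s => a s y) (∑ j, fderiv ℝ (b t j) y (stdVec j)) t)
    (hbt : ∀ t j y, HasDerivAt (fun s => b s j y) (fderiv ℝ (a t) y (stdVec j)) t)
    (hC : ∀ t, ∃ C : ℝ, ∀ᶠ s in 𝓝 t, ∀ y, |a s y| ≤ C ∧ ∀ j, |b s j y| ≤ C ∧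
      |fderiv ℝ (a s) y (stdVec j)| ≤ C ∧ |fderiv ℝ (b s j) y (stdVec j)| ≤ C)
    (hW : ContDiff ℝ 1 (Function.uncurry W))
    (hWs : ∀ t, ∃ R : ℝ, ∀ᶠ s in 𝓝 t, ∀ y, R < ‖y‖ → W s y = 0)
    (hWt : ∀ t y, deriv (fun s => W s y) t + ‖fderiv ℝ (W t) y‖ ≤ 0) :
    Antitone fun t => ∫ y, W t y * (a t y ^ 2 + ∑ j, b t j y ^ 2) := by
  have hWx : ∀ t, ContDiff ℝ 1 (W t) := fun t => hW.comp (contDiff_prodMk_right t)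
  have hWd : ∀ t y,
      HasDerivAt (fun s => W s y) (fderiv ℝ (Function.uncurry W) (t, y) (1, 0)) t := by
    intro t y
    have h1 := (hW.differentiable one_ne_zero (t, y)).hasFDerivAt
    have h2 : HasDerivAt (fun s : ℝ => (s, y)) ((1 : ℝ), (0 : Space N)) t :=
      (hasDerivAt_id t).prodMk (hasDerivAt_const t y)
    exact h1.comp_hasDerivAt t h2
  set W' : ℝ → Space N → ℝ := fun t y => fderiv ℝ (Function.uncurry W) (t, y) (1, 0) with hW'
  have hW'c : Continuous (Function.uncurry W') :=
    (hW.continuous_fderiv one_ne_zero).clm_apply continuous_const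
  have hcs : ∀ t, HasCompactSupport (W t) := by
    intro t
    obtain ⟨R, hR⟩ := hWs t
    refine HasCompactSupport.intro (isCompact_closedBall (0 : Space N) R) fun y hy => ?_
    exact hR.self_of_nhds y (by simpa using hy)
  let F' : ℝ → Space N → ℝ := fun t y => W' t y * (a t y ^ 2 + ∑ j, b t j y ^ 2)
    + W t y * (2 * a t y * (∑ j, fderiv ℝ (b t j) y (stdVec j))
      + ∑ j, 2 * b t j y * fderiv ℝ (a t) y (stdVec j))
  have hac := fun t => (ha t).continuous
  have hbc := fun t j => (hb t j).continuous
  have hafc : ∀ t j, Continuous fun y => fderiv ℝ (a t) y (stdVec j) := fun t j =>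
    ((ha t).continuous_fderiv one_ne_zero).clm_apply continuous_const
  have hbfc : ∀ t j, Continuous fun y => fderiv ℝ (b t j) y (stdVec j) := fun t j =>
    ((hb t j).continuous_fderiv one_ne_zero).clm_apply continuous_const
  have hWc := fun t => (hWx t).continuous
  have hW'xc : ∀ t, Continuous (W' t) := fun t => hW'c.comp (Continuous.prodMk_right t)
  have hFc : ∀ t, Continuous fun y => W t y * (a t y ^ 2 + ∑ j, b t j y ^ 2) := by
    intro t
    have := hac t; have := hbc t; have := hWc t
    fun_prop
  have hF'c : ∀ t, Continuous (F' t) := by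
    intro t
    have := hac t; have := hbc t; have := hWc t; have := hafc t; have := hbfc t
    have := hW'xc t
    fun_prop
  -- Differentiation under the integral sign: all derivatives are bounded by a constant `B`
  -- supported in the common support of the weights.
  have hmain : ∀ t, HasDerivAt (fun s => ∫ y, W s y * (a s y ^ 2 + ∑ j, b s j y ^ 2))
      (∫ y, F' t y) t := by
    intro t
    obtain ⟨R, hR⟩ := hWs t
    obtain ⟨C, hCt⟩ := hC t
    have hK : IsCompact (Metric.closedBall t 1 ×ˢ Metric.closedBall (0 : Space N) R) :=
      (isCompact_closedBall _ _).prod (isCompact_closedBall _ _)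
    obtain ⟨M, hM⟩ := hK.exists_bound_of_continuousOn hW.continuous.continuousOn
    obtain ⟨M', hM'⟩ := hK.exists_bound_of_continuousOn hW'c.continuousOn
    let B : ℝ := M' * (C ^ 2 + N * C ^ 2) + M * (2 * C * (N * C) + N * (2 * C * C))
    refine (hasDerivAt_integral_of_dominated_loc_of_deriv_le (F' := F')
      (bound := (Metric.closedBall (0 : Space N) R).indicator fun _ => B)
      (s := {s | (∀ᶠ r in 𝓝 s, ∀ y, R < ‖y‖ → W r y = 0) ∧ (∀ y, |a s y| ≤ C ∧ ∀ j, |b s j y| ≤ C ∧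
      |fderiv ℝ (a s) y (stdVec j)| ≤ C ∧ |fderiv ℝ (b s j) y (stdVec j)| ≤ C) ∧
      s ∈ Metric.closedBall t 1}) ?_ ?_ ?_ ?_ ?_ ?_ ?_).2
    · exact (eventually_eventually_nhds.2 hR).and (hCt.and
        (Metric.closedBall_mem_nhds t one_pos))
    · exact Eventually.of_forall fun s => (hFc s).aestronglyMeasurable
    · refine (hFc t).integrable_of_hasCompactSupport ?_
      exact (hcs t).mul_right
    · exact (hF'c t).aestronglyMeasurable
    · refine ae_of_all _ fun y s hs => ?_
      obtain ⟨h0, h1, h2⟩ := hs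
      by_cases hy : y ∈ Metric.closedBall (0 : Space N) R
      · rw [Set.indicator_of_mem hy]
        have hMs : |W s y| ≤ M := hM (s, y) ⟨h2, hy⟩
        have hMs' : |W' s y| ≤ M' := hM' (s, y) ⟨h2, hy⟩
        have hM0 : 0 ≤ M := (abs_nonneg _).trans hMs
        have hM0' : 0 ≤ M' := (abs_nonneg _).trans hMs'
        obtain ⟨h3, h4⟩ := h1 y
        have hC0 : 0 ≤ C := (abs_nonneg _).trans h3
        have e1 : |a s y ^ 2 + ∑ j, b s j y ^ 2| ≤ C ^ 2 + N * C ^ 2 := by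
          refine (abs_add_le _ _).trans (add_le_add ?_ ?_)
          · rw [abs_pow]; gcongr
          · refine (Finset.abs_sum_le_sum_abs _ _).trans ?_
            refine (Finset.sum_le_card_nsmul _ _ (C ^ 2) fun j _ => ?_).trans (by simp)
            rw [abs_pow]; have := (h4 j).1; gcongr
        have e2 : |∑ j, fderiv ℝ (b s j) y (stdVec j)| ≤ N * C := by
          refine (Finset.abs_sum_le_sum_abs _ _).trans ?_
          exact (Finset.sum_le_card_nsmul _ _ C fun j _ => (h4 j).2.2).trans (by simp)
        have e3 : |∑ j, 2 * b s j y * fderiv ℝ (a s) y (stdVec j)| ≤ N * (2 * C * C) := by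
          refine (Finset.abs_sum_le_sum_abs _ _).trans ?_
          refine (Finset.sum_le_card_nsmul _ _ (2 * C * C) fun j _ => ?_).trans (by simp)
          rw [abs_mul, abs_mul, abs_two]
          have := (h4 j).1; have := (h4 j).2.1
          gcongr
        simp only [F', Real.norm_eq_abs]
        refine (abs_add_le _ _).trans (add_le_add ?_ ?_)
        · rw [abs_mul]; gcongr
        · rw [abs_mul]
          gcongr
          refine (abs_add_le _ _).trans (add_le_add ?_ e3)
          rw [abs_mul, abs_mul, abs_two]
          gcongr
      · rw [Set.indicator_of_notMem hy]
        have hy' : R < ‖y‖ := by simpa using hy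
        have hW0 : W s y = 0 := h0.self_of_nhds y hy'
        have hW0' : W' s y = 0 := by
          refine (hWd s y).deriv.symm.trans ?_
          have : (fun r => W r y) =ᶠ[𝓝 s] fun _ => 0 := h0.mono fun r hr => hr y hy'
          rw [this.deriv_eq]; simp
        simp [F', hW0, hW0']
    · exact (integrable_indicator_iff measurableSet_closedBall).2
        (integrableOn_const (by exact measure_closedBall_lt_top.ne))
    · refine ae_of_all _ fun y s _ => ?_
      have h1 := ((hat s y).pow 2).add (HasDerivAt.fun_sum (u := Finset.univ)
        fun j _ => (hbt s j y).pow 2)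
      have h2 := (hWd s y).mul h1
      refine h2.congr_deriv ?_
      simp only [F', hW']
      norm_num
  refine antitone_of_deriv_nonpos (fun t => (hmain t).differentiableAt) fun t => ?_
  rw [(hmain t).deriv]
  -- The derivative falls on `2 W div (a b)`, which is integrated by parts.
  have hWf : ∀ j, Continuous fun y => fderiv ℝ (W t) y (stdVec j) := fun j =>
    ((hWx t).continuous_fderiv one_ne_zero).clm_apply continuous_const
  have hibp : ∀ j, ∫ y, W t y * fderiv ℝ (fun z => a t z * b t j z) y (stdVec j)
      = - ∫ y, fderiv ℝ (W t) y (stdVec j) * (a t y * b t j y) := by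
    intro j
    have hab : ContDiff ℝ 1 (fun z => a t z * b t j z) := (ha t).mul (hb t j)
    refine integral_mul_fderiv_eq_neg_fderiv_mul_of_integrable ?_ ?_ ?_
      (fun y _ => (hWx t).differentiable one_ne_zero y)
      (fun y _ => hab.differentiable one_ne_zero y)
    · exact ((hWf j).mul hab.continuous).integrable_of_hasCompactSupport
        ((hcs t).fderiv_apply (𝕜 := ℝ) (stdVec j)).mul_right
    · exact ((hWc t).mul ((hab.continuous_fderiv one_ne_zero).clm_apply
        continuous_const)).integrable_of_hasCompactSupport (hcs t).mul_right
    · exact ((hWc t).mul hab.continuous).integrable_of_hasCompactSupport (hcs t).mul_right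
  have hI1 : ∀ j, Integrable fun y => W t y * fderiv ℝ (fun z => a t z * b t j z) y (stdVec j) := by
    intro j
    have hab : ContDiff ℝ 1 (fun z => a t z * b t j z) := (ha t).mul (hb t j)
    exact ((hWc t).mul ((hab.continuous_fderiv one_ne_zero).clm_apply
        continuous_const)).integrable_of_hasCompactSupport (hcs t).mul_right
  have hI2 : ∀ j, Integrable fun y => fderiv ℝ (W t) y (stdVec j) * (a t y * b t j y) := fun j =>
    ((hWf j).mul ((hac t).mul (hbc t j))).integrable_of_hasCompactSupport
        ((hcs t).fderiv_apply (𝕜 := ℝ) (stdVec j)).mul_right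
  have hcs' : HasCompactSupport (W' t) := by
    obtain ⟨R, hR⟩ := hWs t
    refine HasCompactSupport.intro (isCompact_closedBall (0 : Space N) R) fun y hy => ?_
    refine (hWd t y).deriv.symm.trans ?_
    have : (fun r => W r y) =ᶠ[𝓝 t] fun _ => 0 := hR.mono fun r hr => hr y (by simpa using hy)
    rw [this.deriv_eq]; simp
  have hI3 : Integrable fun y => W' t y * (a t y ^ 2 + ∑ j, b t j y ^ 2) := by
    refine Continuous.integrable_of_hasCompactSupport ?_ hcs'.mul_right
    have := hac t; have := hbc t; have := hW'xc t
    fun_prop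
  have e1 : ∫ y, F' t y = ∫ y, (W' t y * (a t y ^ 2 + ∑ j, b t j y ^ 2)
      + ∑ j, 2 * (W t y * fderiv ℝ (fun z => a t z * b t j z) y (stdVec j))) := by
    refine integral_congr_ae (ae_of_all _ fun y => ?_)
    simp only [F']
    congr 1
    rw [Finset.mul_sum, ← Finset.sum_add_distrib, Finset.mul_sum]
    refine Finset.sum_congr rfl fun j _ => ?_
    rw [fderiv_fun_mul ((ha t).differentiable one_ne_zero y)
      ((hb t j).differentiable one_ne_zero y)]
    simp
    ring
  rw [e1, integral_add hI3 (integrable_finsetSum _ fun j _ => (hI1 j).const_mul 2),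
    integral_finsetSum _ fun j _ => (hI1 j).const_mul 2]
  simp only [integral_const_mul, hibp]
  rw [show ∑ j, 2 * -∫ y, fderiv ℝ (W t) y (stdVec j) * (a t y * b t j y)
      = - ∫ y, ∑ j, 2 * (fderiv ℝ (W t) y (stdVec j) * (a t y * b t j y)) by
    rw [integral_finsetSum _ fun j _ => (hI2 j).const_mul 2]
    simp [integral_const_mul],
    ← sub_eq_add_neg, ← integral_sub hI3 (integrable_finsetSum _ fun j _ => (hI2 j).const_mul 2)]
  refine integral_nonpos fun y => ?_
  simp only [Pi.zero_apply]
  have hb2 : ∑ j, b t j y ^ 2 = ‖(WithLp.toLp 2 fun j => b t j y : Space N)‖ ^ 2 := by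
    rw [EuclideanSpace.norm_sq_eq]; simp
  set v : Space N := WithLp.toLp 2 fun j => b t j y with hv
  have hsum : ∑ j, 2 * (fderiv ℝ (W t) y (stdVec j) * (a t y * b t j y))
      = 2 * a t y * fderiv ℝ (W t) y v := by
    rw [← sum_apply_stdVec_mul, Finset.mul_sum]
    refine Finset.sum_congr rfl fun j _ => ?_
    simp only [hv]; ring
  rw [hb2, hsum]
  have h1 := hWt t y
  rw [(hWd t y).deriv] at h1
  have h2 : |fderiv ℝ (W t) y v| ≤ ‖fderiv ℝ (W t) y‖ * ‖v‖ :=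
    (fderiv ℝ (W t) y).le_opNorm v
  have h3 : -(2 * a t y * fderiv ℝ (W t) y v) ≤ 2 * |a t y| * (‖fderiv ℝ (W t) y‖ * ‖v‖) := by
    refine (neg_le_abs _).trans ?_
    rw [abs_mul, abs_mul, abs_two]
    gcongr
  have h4 : 2 * |a t y| * ‖v‖ ≤ a t y ^ 2 + ‖v‖ ^ 2 := by
    rw [← sq_abs (a t y)]; nlinarith [sq_nonneg (|a t y| - ‖v‖)]
  have h5 := mul_le_mul_of_nonneg_left h4 (norm_nonneg (fderiv ℝ (W t) y))
  have h6 : 0 ≤ a t y ^ 2 + ‖v‖ ^ 2 := by positivity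
  have h7 := mul_le_mul_of_nonneg_right h1 h6
  -- Pointwise, `∂_t W (a² + |b|²) - 2 a b · ∇W ≤ (∂_t W + |∇W|) (a² + |b|²) ≤ 0`.
  simp only [hW'] at h7 ⊢
  nlinarith

end Energy

/-! ### Weak solutions of the first-order system -/

section FirstOrder

variable {N : ℕ}

/-- `(D, v)` is a weak finite energy solution of the first-order system `∂_t D = ∇ v`,
`∂_t v = div D` satisfied by `D = ∇ u` and `v = ∂_t u`. Only local boundedness in time of the
energy is asked for. -/
structure IsFirstOrderSolution (D : ℝ → Space N → Space N) (v : ℝ → Space N → ℝ) : Prop where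
  memLp_fst : ∀ t, MemLp (D t) 2 volume
  memLp_snd : ∀ t, MemLp (v t) 2 volume
  locallyBounded : ∀ t, ∃ C : ℝ≥0, ∀ᶠ s in 𝓝 t,
    eLpNorm (D s) 2 volume ≤ C ∧ eLpNorm (v s) 2 volume ≤ C
  hasDerivAt_fst : ∀ ψ : Space N → ℝ, IsTestFunction ψ → ∀ w t,
    HasDerivAt (fun s => ∫ x, ψ x * inner ℝ (D s x) w) (-∫ x, v t x * fderiv ℝ ψ x w) t
  hasDerivAt_snd : ∀ ψ : Space N → ℝ, IsTestFunction ψ → ∀ t,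
    HasDerivAt (fun s => ∫ x, v s x * ψ x) (- ∫ x, inner ℝ (D t x) (gradient ψ x)) t

theorem IsTestFunction.memLp_gradient {ψ : Space N → ℝ} (hψ : IsTestFunction ψ) :
    MemLp (gradient ψ) 2 volume := by
  have h : MemLp (fderiv ℝ ψ) 2 volume :=
    (hψ.smooth.continuous_fderiv (by simp)).memLp_of_hasCompactSupport
      (hψ.hasCompactSupport.fderiv (𝕜 := ℝ))
  refine h.of_le ((InnerProductSpace.toDual ℝ (Space N)).symm.continuous.comp_aestronglyMeasurable
    h.1) (ae_of_all _ fun x => ?_)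
  simp [gradient]

theorem integrable_mul_inner {ψ : Space N → ℝ} (hψ : MemLp ψ 2 volume) {D : Space N → Space N}
    (hD : MemLp D 2 volume) (w : Space N) : Integrable fun x => ψ x * inner ℝ (D x) w :=
  hψ.integrable_mul (hD.inner_const w)

theorem integrable_inner {D D' : Space N → Space N} (hD : MemLp D 2 volume)
    (hD' : MemLp D' 2 volume) : Integrable fun x => (inner ℝ (D x) (D' x) : ℝ) :=
  (hD.norm.integrable_mul hD'.norm).mono' (hD.1.inner hD'.1)
    (ae_of_all _ fun _ => norm_inner_le_norm _ _)

@[simp]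
theorem inner_stdVec (x : Space N) (j : Fin N) : inner ℝ x (stdVec j) = x j := by
  simp [stdVec, EuclideanSpace.inner_single_right]

namespace IsFirstOrderSolution

variable {D D' : ℝ → Space N → Space N} {v v' : ℝ → Space N → ℝ}

theorem add (h : IsFirstOrderSolution D v) (h' : IsFirstOrderSolution D' v') :
    IsFirstOrderSolution (fun t x => D t x + D' t x) (fun t x => v t x + v' t x) where
  memLp_fst t := (h.memLp_fst t).add (h'.memLp_fst t)
  memLp_snd t := (h.memLp_snd t).add (h'.memLp_snd t)
  locallyBounded t := by
    obtain ⟨C, hC⟩ := h.locallyBounded t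
    obtain ⟨C', hC'⟩ := h'.locallyBounded t
    refine ⟨C + C', ?_⟩
    filter_upwards [hC, hC'] with s hs hs'
    push_cast
    exact ⟨(eLpNorm_add_le (h.memLp_fst s).1 (h'.memLp_fst s).1 (by norm_num)).trans
        (add_le_add hs.1 hs'.1),
      (eLpNorm_add_le (h.memLp_snd s).1 (h'.memLp_snd s).1 (by norm_num)).trans
        (add_le_add hs.2 hs'.2)⟩
  hasDerivAt_fst ψ hψ w t := by
    convert! (h.hasDerivAt_fst ψ hψ w t).add (h'.hasDerivAt_fst ψ hψ w t) using 1
    · ext s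
      simp only [Pi.add_apply]
      rw [← integral_add (integrable_mul_inner (hψ.memLp 2) (h.memLp_fst s) w)
        (integrable_mul_inner (hψ.memLp 2) (h'.memLp_fst s) w)]
      simp [inner_add_left, mul_add]
    · have h1 : Integrable fun x => v t x * fderiv ℝ ψ x w :=
        (h.memLp_snd t).integrable_mul ((hψ.fderiv_apply w).memLp 2)
      have h2 : Integrable fun x => v' t x * fderiv ℝ ψ x w :=
        (h'.memLp_snd t).integrable_mul ((hψ.fderiv_apply w).memLp 2)
      rw [← neg_add, ← integral_add h1 h2]
      simp [add_mul]
  hasDerivAt_snd ψ hψ t := by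
    convert! (h.hasDerivAt_snd ψ hψ t).add (h'.hasDerivAt_snd ψ hψ t) using 1
    · ext s
      simp only [Pi.add_apply]
      have h1 : Integrable fun x => v s x * ψ x := (h.memLp_snd s).integrable_mul (hψ.memLp 2)
      have h2 : Integrable fun x => v' s x * ψ x := (h'.memLp_snd s).integrable_mul (hψ.memLp 2)
      rw [← integral_add h1 h2]
      simp [add_mul]
    · rw [← neg_add, ← integral_add (integrable_inner (h.memLp_fst t) hψ.memLp_gradient)
        (integrable_inner (h'.memLp_fst t) hψ.memLp_gradient)]
      simp

theorem const_smul (h : IsFirstOrderSolution D v) (c : ℝ) :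
    IsFirstOrderSolution (fun t x => c • D t x) (fun t x => c * v t x) where
  memLp_fst t := (h.memLp_fst t).const_smul c
  memLp_snd t := (h.memLp_snd t).const_mul c
  locallyBounded t := by
    obtain ⟨C, hC⟩ := h.locallyBounded t
    refine ⟨‖c‖₊ * C, ?_⟩
    filter_upwards [hC] with s hs
    push_cast
    refine ⟨(eLpNorm_const_smul c (D s) 2 volume).le.trans ?_,
      (eLpNorm_const_smul c (v s) 2 volume).le.trans ?_⟩
    · exact mul_le_mul_right hs.1 _
    · exact mul_le_mul_right hs.2 _
  hasDerivAt_fst ψ hψ w t := by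
    convert! (h.hasDerivAt_fst ψ hψ w t).const_mul c using 1
    · ext s
      rw [← integral_const_mul]
      simp [real_inner_smul_left, mul_left_comm]
    · rw [mul_neg, ← integral_const_mul]
      simp [mul_assoc]
  hasDerivAt_snd ψ hψ t := by
    convert! (h.hasDerivAt_snd ψ hψ t).const_mul c using 1
    · ext s
      rw [← integral_const_mul]
      simp [mul_assoc]
    · rw [mul_neg, ← integral_const_mul]
      simp

theorem sub (h : IsFirstOrderSolution D v) (h' : IsFirstOrderSolution D' v') :
    IsFirstOrderSolution (fun t x => D t x - D' t x) (fun t x => v t x - v' t x) := by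
  simpa [sub_eq_add_neg] using h.add (h'.const_smul (-1))

theorem zero : IsFirstOrderSolution (fun _ _ => 0 : ℝ → Space N → Space N) (fun _ _ => 0) where
  memLp_fst t := MemLp.zero'
  memLp_snd t := MemLp.zero'
  locallyBounded t := ⟨0, by simp⟩
  hasDerivAt_fst ψ hψ w t := by simpa using hasDerivAt_const t (0 : ℝ)
  hasDerivAt_snd ψ hψ t := by simpa using hasDerivAt_const t (0 : ℝ)

/-- The wave equation is invariant under reversal of time. -/
theorem timeReversal (h : IsFirstOrderSolution D v) :
    IsFirstOrderSolution (fun t x => D (-t) x) (fun t x => - v (-t) x) where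
  memLp_fst t := h.memLp_fst (-t)
  memLp_snd t := (h.memLp_snd (-t)).neg
  locallyBounded t := by
    obtain ⟨C, hC⟩ := h.locallyBounded (-t)
    refine ⟨C, ?_⟩
    filter_upwards [(continuous_neg.tendsto t).eventually hC] with s hs
    refine ⟨hs.1, (eLpNorm_neg (v (-s)) 2 volume).le.trans hs.2⟩
  hasDerivAt_fst ψ hψ w t := by
    have := (h.hasDerivAt_fst ψ hψ w (-t)).scomp t (hasDerivAt_neg t)
    convert! this using 1
    simp [integral_neg]
  hasDerivAt_snd ψ hψ t := by
    have := ((h.hasDerivAt_snd ψ hψ (-t)).scomp t (hasDerivAt_neg t)).neg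
    convert! this using 1
    · ext s; simp [integral_neg]
    · simp

end IsFirstOrderSolution

/-- A finite energy solution of the wave equation gives a solution of the first-order system. -/
theorem IsSolution.isFirstOrderSolution {u₀ u₁ : Space N → ℝ} {u : ℝ → Space N → ℝ}
    {Du : ℝ → Space N → Space N} {v : ℝ → Space N → ℝ} (h : IsSolution u₀ u₁ u Du v) :
    IsFirstOrderSolution Du v where
  memLp_fst t := (h.memHomogeneousSobolev t).memLp_gradient
  memLp_snd t := h.memLp t
  locallyBounded t := by
    have hD := (h.memHomogeneousSobolev t).memLp_gradient
    have hv := h.memLp t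
    refine ⟨(1 + eLpNorm (Du t) 2 volume + eLpNorm (v t) 2 volume).toNNReal, ?_⟩
    rw [ENNReal.coe_toNNReal (by simp [ENNReal.add_eq_top, hD.2.ne, hv.2.ne])]
    filter_upwards [ENNReal.tendsto_nhds_zero.1 (h.continuous_gradient t) 1 one_pos,
      ENNReal.tendsto_nhds_zero.1 (h.continuous_timeDeriv t) 1 one_pos] with s h1 h2
    have hDs := (h.memHomogeneousSobolev s).memLp_gradient
    have hvs := h.memLp s
    constructor
    · calc eLpNorm (Du s) 2 volume = eLpNorm ((Du s - Du t) + Du t) 2 volume := by simp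
        _ ≤ eLpNorm (Du s - Du t) 2 volume + eLpNorm (Du t) 2 volume :=
          eLpNorm_add_le (hDs.1.sub hD.1) hD.1 (by norm_num)
        _ ≤ 1 + eLpNorm (Du t) 2 volume := by gcongr
        _ ≤ _ := le_self_add
    · calc eLpNorm (v s) 2 volume = eLpNorm ((v s - v t) + v t) 2 volume := by simp
        _ ≤ eLpNorm (v s - v t) 2 volume + eLpNorm (v t) 2 volume :=
          eLpNorm_add_le (hvs.1.sub hv.1) hv.1 (by norm_num)
        _ ≤ 1 + eLpNorm (v t) 2 volume := by gcongr
        _ ≤ _ := by gcongr; exact le_self_add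
  hasDerivAt_fst ψ hψ w t := by
    have h1 := (h.hasDerivAt _ (hψ.fderiv_apply w) t).neg
    refine h1.congr_of_eventuallyEq (Eventually.of_forall fun s => ?_)
    simp only [Pi.neg_apply]
    rw [(h.memHomogeneousSobolev s).hasWeakGradient.integral_eq ψ hψ w, neg_neg]
  hasDerivAt_snd ψ hψ t := h.wave_equation ψ hψ t

theorem gradient_apply {ψ : Space N → ℝ} (x : Space N) (j : Fin N) :
    gradient ψ x j = fderiv ℝ ψ x (stdVec j) := by
  rw [← inner_stdVec, gradient, InnerProductSpace.toDual_symm_apply]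

/-- If `F_n → F` in `L²`, then `∫ W |F_n|² → ∫ W |F|²` for every bounded weight `W`. -/
theorem tendsto_integral_mul_norm_sq {G : Type*} [NormedAddCommGroup G] {W : Space N → ℝ}
    (hW : AEStronglyMeasurable W volume) {M : ℝ} (hM : ∀ y, |W y| ≤ M) {F : ℕ → Space N → G}
    {F₀ : Space N → G} (hF : ∀ n, MemLp (F n) 2 volume) (hF₀ : MemLp F₀ 2 volume)
    (h : Tendsto (fun n => eLpNorm (F n - F₀) 2 volume) atTop (𝓝 0)) :
    Tendsto (fun n => ∫ y, W y * ‖F n y‖ ^ 2) atTop (𝓝 (∫ y, W y * ‖F₀ y‖ ^ 2)) := by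
  have hint : ∀ {F : Space N → G}, MemLp F 2 volume → Integrable fun y => W y * ‖F y‖ ^ 2 :=
    fun hF => hF.norm.integrable_sq.bdd_mul hW (ae_of_all _ hM)
  refine tendsto_integral_of_L1' _ (hint hF₀).1 (Eventually.of_forall fun n => hint (hF n)) ?_
  have hb : ∀ n, eLpNorm ((fun y => W y * ‖F n y‖ ^ 2) - fun y => W y * ‖F₀ y‖ ^ 2) 1 volume
      ≤ ENNReal.ofReal M * (eLpNorm (F n - F₀) 2 volume *
        (eLpNorm (F n - F₀) 2 volume + (eLpNorm F₀ 2 volume + eLpNorm F₀ 2 volume))) := by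
    intro n
    have hd := (hF n).sub hF₀
    have h1 : eLpNorm ((fun y => W y * ‖F n y‖ ^ 2) - fun y => W y * ‖F₀ y‖ ^ 2) 1 volume
        ≤ ENNReal.ofReal M * eLpNorm (fun y =>
          ‖(F n - F₀) y‖ • (‖(F n - F₀) y‖ + (‖F₀ y‖ + ‖F₀ y‖))) 1 volume := by
      refine eLpNorm_le_mul_eLpNorm_of_ae_le_mul (ae_of_all _ fun y => ?_) 1
      simp only [Pi.sub_apply, ← mul_sub, norm_mul, Real.norm_eq_abs, smul_eq_mul, abs_norm]
      refine mul_le_mul (hM y) ?_ (abs_nonneg _) ((abs_nonneg _).trans (hM y))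
      have e1 : ‖F n y‖ ≤ ‖F n y - F₀ y‖ + ‖F₀ y‖ := by
        simpa using norm_add_le (F n y - F₀ y) (F₀ y)
      have e2 := abs_norm_sub_norm_le (F n y) (F₀ y)
      rw [sq_sub_sq, abs_mul, mul_comm, abs_of_nonneg (a := ‖F n y‖ + ‖F₀ y‖) (by positivity),
        abs_of_nonneg (a := ‖F n y - F₀ y‖ + (‖F₀ y‖ + ‖F₀ y‖)) (by positivity)]
      refine mul_le_mul e2 (by linarith) (by positivity) (norm_nonneg _)
    refine h1.trans ?_
    gcongr
    refine (eLpNorm_smul_le_mul_eLpNorm (p := 2) (q := 2) (r := 1)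
      (hd.norm.1.add (hF₀.norm.1.add hF₀.norm.1)) hd.norm.1).trans ?_
    rw [eLpNorm_norm]
    gcongr
    refine (eLpNorm_add_le hd.norm.1 (hF₀.norm.1.add hF₀.norm.1) (by norm_num)).trans ?_
    rw [eLpNorm_norm]
    gcongr
    refine (eLpNorm_add_le hF₀.norm.1 hF₀.norm.1 (by norm_num)).trans ?_
    rw [eLpNorm_norm]
  refine tendsto_of_tendsto_of_tendsto_of_le_of_le tendsto_const_nhds ?_ (fun _ => zero_le) hb
  have h2 : Tendsto (fun n => eLpNorm (F n - F₀) 2 volume + (eLpNorm F₀ 2 volume +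
      eLpNorm F₀ 2 volume)) atTop (𝓝 (0 + (eLpNorm F₀ 2 volume + eLpNorm F₀ 2 volume))) :=
    h.add tendsto_const_nhds
  have h3 := ENNReal.Tendsto.const_mul (a := ENNReal.ofReal M)
    (ENNReal.Tendsto.mul h (Or.inr (by simp [hF₀.2.ne])) h2 (Or.inr (by simp)))
    (Or.inr (by simp))
  simpa using h3

/-- A weak solution of the first-order system loses energy with respect to the same weights as
a smooth one. -/
theorem IsFirstOrderSolution.antitone_weighted_energy {D : ℝ → Space N → Space N}
    {v : ℝ → Space N → ℝ} (h : IsFirstOrderSolution D v) {W : ℝ → Space N → ℝ}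
    (hW : ContDiff ℝ 1 (Function.uncurry W))
    (hWs : ∀ t, ∃ R : ℝ, ∀ᶠ s in 𝓝 t, ∀ y, R < ‖y‖ → W s y = 0)
    (hWt : ∀ t y, deriv (fun s => W s y) t + ‖fderiv ℝ (W t) y‖ ≤ 0) :
    Antitone fun t => ∫ y, W t y * (v t y ^ 2 + ‖D t y‖ ^ 2) := by
  have hWc : ∀ t, Continuous (W t) := fun t => hW.continuous.comp (Continuous.prodMk_right t)
  have hcs : ∀ t, HasCompactSupport (W t) := by
    intro t
    obtain ⟨R, hR⟩ := hWs t
    refine HasCompactSupport.intro (isCompact_closedBall (0 : Space N) R) fun y hy => ?_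
    exact hR.self_of_nhds y (by simpa using hy)
  have hDl : ∀ t, LocallyIntegrable (D t) volume := fun t =>
    (h.memLp_fst t).locallyIntegrable (by norm_num)
  have hvl : ∀ t, LocallyIntegrable (v t) volume := fun t =>
    (h.memLp_snd t).locallyIntegrable (by norm_num)
  -- Mollification in space commutes with the system and makes the solution smooth.
  have hmoll : ∀ ρ : Space N → ℝ, IsMollifier ρ →
      Antitone fun t => ∫ y, W t y * (mollify ρ (v t) y ^ 2 + ‖mollify ρ (D t) y‖ ^ 2) := by
    intro ρ hρ
    have hρt := hρ.toIsTestFunction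
    have hDj : ∀ t j, LocallyIntegrable (fun x => D t x j) volume := fun t j => by
      simpa using ((h.memLp_fst t).inner_const (𝕜 := ℝ) (stdVec j)).locallyIntegrable (by norm_num)
    have hcoord : ∀ t j y, mollify ρ (D t) y j = mollify ρ (fun x => D t x j) y := by
      intro t j y
      have := inner_mollify hρt (hDl t) y (stdVec j)
      simpa using this
    have key := antitone_weighted_energy_of_smooth (a := fun t => mollify ρ (v t))
      (b := fun t j => mollify ρ (fun x => D t x j)) (W := W)
      (fun t => (contDiff_mollify hρt (hvl t)).of_le (by simp))
      (fun t j => (contDiff_mollify hρt (hDj t j)).of_le (by simp)) ?_ ?_ ?_ hW hWs hWt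
    · convert! key using 4
      simp [EuclideanSpace.norm_sq_eq, hcoord]
    · intro t y
      have h1 := h.hasDerivAt_snd _ (hρt.comp_sub_left y) t
      convert! h1 using 1
      · ext s; simp [mollify, mul_comm]
      · rw [← integral_neg,
          Finset.sum_congr rfl fun j _ => fderiv_mollify hρt (hDj t j) y (stdVec j)]
        simp only [mollify]
        rw [← integral_finsetSum _ fun j _ =>
          integrable_mollify (hρt.fderiv_apply (stdVec j)) (hDj t j) y]
        refine integral_congr_ae (ae_of_all _ fun x => ?_)
        simp only [PiLp.inner_apply, gradient_apply,
          fderiv_comp_sub_left_apply hρt.differentiable]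
        simp [Finset.sum_neg_distrib]
    · intro t j y
      have h1 := h.hasDerivAt_fst _ (hρt.comp_sub_left y) (stdVec j) t
      convert! h1 using 1
      · ext s; simp [mollify]
      · rw [fderiv_mollify hρt (hvl t), mollify, ← integral_neg]
        refine integral_congr_ae (ae_of_all _ fun x => ?_)
        simp [fderiv_comp_sub_left_apply hρt.differentiable, mul_comm]
    · intro t
      obtain ⟨C, hC⟩ := h.locallyBounded t
      let A : ℝ≥0∞ := eLpNorm ρ 2 volume
        + ∑ j, eLpNorm (fun x => fderiv ℝ ρ x (stdVec j)) 2 volume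
      have hA : A * C ≠ ⊤ := by
        refine ENNReal.mul_ne_top (ENNReal.add_ne_top.2 ⟨(hρt.memLp 2).2.ne, ?_⟩) (by simp)
        exact ENNReal.sum_ne_top.2 fun j _ => ((hρt.fderiv_apply (stdVec j)).memLp 2).2.ne
      have hA1 : eLpNorm ρ 2 volume ≤ A := le_self_add
      have hA2 : ∀ j, eLpNorm (fun x => fderiv ℝ ρ x (stdVec j)) 2 volume ≤ A := fun j =>
        (Finset.single_le_sum (f := fun j => eLpNorm (fun x => fderiv ℝ ρ x (stdVec j)) 2 volume)
          (fun _ _ => zero_le) (Finset.mem_univ j)).trans le_add_self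
      refine ⟨(A * C).toReal, ?_⟩
      filter_upwards [hC] with s hs y
      have bound : ∀ (φ : Space N → ℝ) (f : Space N → ℝ), IsTestFunction φ →
          AEStronglyMeasurable f volume → eLpNorm φ 2 volume ≤ A → eLpNorm f 2 volume ≤ C →
          |mollify φ f y| ≤ (A * C).toReal := by
        intro φ f hφ hf h1 h2
        have h3 := (enorm_mollify_le hφ hf y).trans (mul_le_mul' h1 h2)
        rw [← Real.norm_eq_abs, ← toReal_enorm]
        exact ENNReal.toReal_mono hA h3
      have hDjm : ∀ j, AEStronglyMeasurable (fun x => D s x j) volume := fun j =>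
        (hDj s j).aestronglyMeasurable
      have hDjn : ∀ j, eLpNorm (fun x => D s x j) 2 volume ≤ C := fun j =>
        (eLpNorm_mono fun x => PiLp.norm_apply_le (D s x) j).trans hs.1
      refine ⟨bound _ _ hρt (h.memLp_snd s).1 hA1 hs.2, fun j =>
        ⟨bound _ _ hρt (hDjm j) hA1 (hDjn j), ?_, ?_⟩⟩
      · rw [fderiv_mollify hρt (hvl s)]
        exact bound _ _ (hρt.fderiv_apply _) (h.memLp_snd s).1 (hA2 j) hs.2
      · rw [fderiv_mollify hρt (hDj s j)]
        exact bound _ _ (hρt.fderiv_apply _) (hDjm j) (hA2 j) (hDjn j)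
  obtain ⟨ρ, hρ, hρs⟩ := exists_mollifier_seq N
  have hlim : ∀ t, Tendsto (fun n => ∫ y, W t y * (mollify (ρ n) (v t) y ^ 2
      + ‖mollify (ρ n) (D t) y‖ ^ 2)) atTop (𝓝 (∫ y, W t y * (v t y ^ 2 + ‖D t y‖ ^ 2))) := by
    intro t
    obtain ⟨M, hM⟩ := (hWc t).bounded_above_of_compact_support (hcs t)
    have hWm : AEStronglyMeasurable (W t) volume := (hWc t).aestronglyMeasurable
    have hv' := fun n => memLp_mollify (hρ n) (h.memLp_snd t)
    have hD' := fun n => memLp_mollify (hρ n) (h.memLp_fst t)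
    have h1 := tendsto_integral_mul_norm_sq hWm hM hv' (h.memLp_snd t)
      (tendsto_eLpNorm_mollify_sub hρ hρs (h.memLp_snd t))
    have h2 := tendsto_integral_mul_norm_sq hWm hM hD' (h.memLp_fst t)
      (tendsto_eLpNorm_mollify_sub hρ hρs (h.memLp_fst t))
    have hadd : ∀ (f : Space N → ℝ) (F : Space N → Space N), MemLp f 2 volume → MemLp F 2 volume →
        (∫ y, W t y * ‖f y‖ ^ 2) + ∫ y, W t y * ‖F y‖ ^ 2
          = ∫ y, W t y * (f y ^ 2 + ‖F y‖ ^ 2) := by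
      intro f F hf hF
      rw [← integral_add (hf.norm.integrable_sq.bdd_mul hWm (ae_of_all _ hM))
        (hF.norm.integrable_sq.bdd_mul hWm (ae_of_all _ hM))]
      simp [mul_add]
    have h3 := h1.add h2
    rw [hadd _ _ (h.memLp_snd t) (h.memLp_fst t)] at h3
    exact h3.congr fun n => hadd _ _ (hv' n) (hD' n)
  intro s t hst
  exact le_of_tendsto_of_tendsto' (hlim t) (hlim s) fun n => hmoll (ρ n) (hρ n) hst

end FirstOrder

/-! ### Energy outside a light cone -/

section Cone

variable {N : ℕ}

/-- The smooth regularization `(δ² + |y|²)^{1/2}` of `|y|`. -/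
noncomputable def smoothNorm (δ : ℝ) (y : Space N) : ℝ := √(δ ^ 2 + ‖y‖ ^ 2)

theorem contDiff_smoothNorm {δ : ℝ} (hδ : 0 < δ) :
    ContDiff ℝ 1 (smoothNorm δ : Space N → ℝ) := by
  refine ContDiff.sqrt ?_ fun y => by positivity
  exact contDiff_const.add (contDiff_norm_sq ℝ)

theorem norm_le_smoothNorm (δ : ℝ) (y : Space N) : ‖y‖ ≤ smoothNorm δ y :=
  Real.le_sqrt_of_sq_le (by nlinarith [sq_nonneg δ])

/-- Like the norm, its regularization is `1`-Lipschitz. -/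
theorem norm_fderiv_smoothNorm_le {δ : ℝ} (hδ : 0 < δ) (y : Space N) :
    ‖fderiv ℝ (smoothNorm δ) y‖ ≤ 1 := by
  have hpos : 0 < δ ^ 2 + ‖y‖ ^ 2 := by positivity
  have h := (((hasStrictFDerivAt_norm_sq y).hasFDerivAt).const_add (δ ^ 2)).sqrt hpos.ne'
  have h' : fderiv ℝ (smoothNorm δ) y = _ := h.fderiv
  rw [h']
  refine ContinuousLinearMap.opNorm_le_bound _ zero_le_one fun w => ?_
  have h1 : |inner ℝ y w| ≤ ‖y‖ * ‖w‖ := abs_real_inner_le_norm y w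
  have h2 : ‖y‖ ≤ √(δ ^ 2 + ‖y‖ ^ 2) := norm_le_smoothNorm δ y
  have h3 : 0 < √(δ ^ 2 + ‖y‖ ^ 2) := Real.sqrt_pos.2 hpos
  simp only [smul_apply, innerSL_apply_apply, smul_eq_mul, Real.norm_eq_abs,
    abs_mul, nsmul_eq_mul, Nat.cast_ofNat]
  rw [abs_of_pos (a := 1 / (2 * √(δ ^ 2 + ‖y‖ ^ 2))) (by positivity), abs_two,
    one_mul, one_div, inv_mul_le_iff₀ (by positivity)]
  calc 2 * |inner ℝ y w| ≤ 2 * (‖y‖ * ‖w‖) := by gcongr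
    _ ≤ 2 * (√(δ ^ 2 + ‖y‖ ^ 2) * ‖w‖) := by gcongr
    _ = _ := by ring

/-- A smooth version of the indicator function of `{t + a ≤ |y| ≤ n - t}`, which satisfies the
differential inequality of the weights. -/
noncomputable def coneWeight (a : ℝ) (n : ℕ) (t : ℝ) (y : Space N) : ℝ :=
  Real.smoothTransition (n * (smoothNorm (1 / ((n : ℝ) + 1)) y - t - a)) *
    Real.smoothTransition (n - smoothNorm (1 / ((n : ℝ) + 1)) y - t)

theorem contDiff_coneWeight (a : ℝ) (n : ℕ) :
    ContDiff ℝ 1 (Function.uncurry (coneWeight (N := N) a n)) := by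
  have hJ : ContDiff ℝ 1 (fun p : ℝ × Space N => smoothNorm (1 / ((n : ℝ) + 1)) p.2) :=
    (contDiff_smoothNorm (by positivity)).comp contDiff_snd
  refine ContDiff.mul (Real.smoothTransition.contDiff.comp ?_)
    (Real.smoothTransition.contDiff.comp ?_)
  · exact contDiff_const.mul ((hJ.sub contDiff_fst).sub contDiff_const)
  · exact (contDiff_const.sub hJ).sub contDiff_fst

theorem coneWeight_nonneg (a : ℝ) (n : ℕ) (t : ℝ) (y : Space N) : 0 ≤ coneWeight a n t y :=
  mul_nonneg (Real.smoothTransition.nonneg _) (Real.smoothTransition.nonneg _)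

theorem coneWeight_le_one (a : ℝ) (n : ℕ) (t : ℝ) (y : Space N) : coneWeight a n t y ≤ 1 :=
  mul_le_one₀ (Real.smoothTransition.le_one _) (Real.smoothTransition.nonneg _)
    (Real.smoothTransition.le_one _)

theorem coneWeight_eq_zero (a : ℝ) (n : ℕ) {t : ℝ} {y : Space N} (h : n - t ≤ ‖y‖) :
    coneWeight a n t y = 0 := by
  have := norm_le_smoothNorm (1 / ((n : ℝ) + 1)) y
  rw [coneWeight, Real.smoothTransition.zero_of_nonpos (x := n - _ - t) (by linarith), mul_zero]

/-- The differential inequality required of the weights in the energy inequality. Both transitions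
move at unit speed, the inner one outwards and the outer one inwards. -/
theorem coneWeight_deriv_add_norm_fderiv_nonpos (a : ℝ) (n : ℕ) (t : ℝ) (y : Space N) :
    deriv (fun s => coneWeight a n s y) t + ‖fderiv ℝ (coneWeight a n t) y‖ ≤ 0 := by
  set J : Space N → ℝ := smoothNorm (1 / ((n : ℝ) + 1)) with hJ
  have hJd : HasFDerivAt J (fderiv ℝ J y) y :=
    ((contDiff_smoothNorm (by positivity)).differentiable one_ne_zero y).hasFDerivAt
  have hJ1 : ‖fderiv ℝ J y‖ ≤ 1 := norm_fderiv_smoothNorm_le (by positivity) y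
  have hχ : ∀ z, HasDerivAt Real.smoothTransition (deriv Real.smoothTransition z) z := fun z =>
    ((Real.smoothTransition.contDiff (n := 1)).differentiable (by simp) z).hasDerivAt
  have hχ0 : ∀ z, 0 ≤ deriv Real.smoothTransition z := fun z =>
    Real.smoothTransition.monotone.deriv_nonneg
  set p := deriv Real.smoothTransition (n * (J y - t - a))
  set q := deriv Real.smoothTransition (n - J y - t)
  set A := Real.smoothTransition (n * (J y - t - a))
  set K := Real.smoothTransition (n - J y - t)
  have h1 : HasDerivAt (fun s => coneWeight a n s y) (-(p * n * K + A * q)) t := by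
    have e1 : HasDerivAt (fun s : ℝ => n * (J y - s - a)) (-n) t := by
      simpa using (((hasDerivAt_id t).const_sub (J y)).sub_const a).const_mul (n : ℝ)
    have e2 : HasDerivAt (fun s : ℝ => n - J y - s) (-1) t :=
      (hasDerivAt_id t).const_sub (n - J y)
    refine (((hχ _).comp t e1).mul ((hχ _).comp t e2)).congr_deriv ?_
    simp only [Function.comp_apply, A, K, p, q]
    ring
  have h2 : HasFDerivAt (coneWeight a n t) ((p * n * K - A * q) • fderiv ℝ J y) y := by
    have e1 : HasFDerivAt (fun z => n * (J z - t - a)) ((n : ℝ) • fderiv ℝ J y) y :=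
      ((hJd.sub_const t).sub_const a).const_mul (n : ℝ)
    have e2 : HasFDerivAt (fun z => n - J z - t) (- fderiv ℝ J y) y :=
      (hJd.const_sub (n : ℝ)).sub_const t
    refine (((hχ _).comp_hasFDerivAt y e1).mul ((hχ _).comp_hasFDerivAt y e2)).congr_fderiv ?_
    ext w
    simp only [Function.comp_apply, A, K, p, q, add_apply,
      smul_apply, neg_apply, smul_eq_mul]
    ring
  rw [h1.deriv, h2.fderiv, norm_smul, Real.norm_eq_abs]
  have hp : 0 ≤ p * n * K :=
    mul_nonneg (mul_nonneg (hχ0 _) n.cast_nonneg) (Real.smoothTransition.nonneg _)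
  have hq : 0 ≤ A * q := mul_nonneg (Real.smoothTransition.nonneg _) (hχ0 _)
  have h3 : |p * n * K - A * q| ≤ p * n * K + A * q := by
    rw [abs_le]; constructor <;> linarith
  have h4 : |p * n * K - A * q| * ‖fderiv ℝ J y‖ ≤ (p * n * K + A * q) * 1 := by gcongr
  linarith

theorem tendsto_coneWeight (a t : ℝ) {y : Space N} (hy : ‖y‖ ≠ t + a) :
    Tendsto (fun n : ℕ => coneWeight a n t y) atTop
      (𝓝 ({x : Space N | t + a ≤ ‖x‖}.indicator 1 y)) := by
  have hJ : Tendsto (fun n : ℕ => smoothNorm (1 / ((n : ℝ) + 1)) y) atTop (𝓝 ‖y‖) := by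
    have := (((tendsto_one_div_add_atTop_nhds_zero_nat (𝕜 := ℝ)).pow 2).add_const (‖y‖ ^ 2)).sqrt
    simpa [smoothNorm, Real.sqrt_sq (norm_nonneg y)] using this
  refine tendsto_const_nhds.congr' ?_
  rcases lt_or_gt_of_ne hy with h | h
  · filter_upwards [hJ.eventually (gt_mem_nhds h)] with n hn
    rw [Set.indicator_of_notMem (by simpa using h), coneWeight,
      Real.smoothTransition.zero_of_nonpos (x := n * _), zero_mul]
    exact mul_nonpos_of_nonneg_of_nonpos n.cast_nonneg (by linarith)
  · have hd : 0 < (‖y‖ - (t + a)) / 2 := by linarith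
    filter_upwards [hJ.eventually (lt_mem_nhds (show ‖y‖ - (‖y‖ - (t + a)) / 2 < ‖y‖ by linarith)),
      hJ.eventually (gt_mem_nhds (show ‖y‖ < ‖y‖ + 1 by linarith)),
      tendsto_natCast_atTop_atTop.eventually_ge_atTop (‖y‖ + 1 + t + 1),
      tendsto_natCast_atTop_atTop.eventually_ge_atTop (1 / ((‖y‖ - (t + a)) / 2))]
      with n h1 h2 h3 h4
    rw [Set.indicator_of_mem (show y ∈ {x : Space N | t + a ≤ ‖x‖} from h.le), coneWeight,
      Real.smoothTransition.one_of_one_le (x := n * _), Real.smoothTransition.one_of_one_le]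
    · simp
    · linarith
    · rw [div_le_iff₀ hd] at h4
      refine h4.trans ?_
      gcongr
      linarith

/-- Finite speed of propagation: the energy outside the light cone `|x| = t + a` decreases. -/
theorem IsFirstOrderSolution.setIntegral_energy_le [Nontrivial (Space N)]
    {D : ℝ → Space N → Space N} {v : ℝ → Space N → ℝ} (h : IsFirstOrderSolution D v) (a : ℝ)
    {s t : ℝ} (hst : s ≤ t) :
    ∫ x in {x : Space N | t + a ≤ ‖x‖}, (‖D t x‖ ^ 2 + v t x ^ 2)
      ≤ ∫ x in {x : Space N | s + a ≤ ‖x‖}, (‖D s x‖ ^ 2 + v s x ^ 2) := by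
  have hlim : ∀ t, Tendsto (fun n : ℕ => ∫ y, coneWeight a n t y * (v t y ^ 2 + ‖D t y‖ ^ 2)) atTop
      (𝓝 (∫ x in {x : Space N | t + a ≤ ‖x‖}, (‖D t x‖ ^ 2 + v t x ^ 2))) := by
    intro t
    have hI : Integrable fun y => v t y ^ 2 + ‖D t y‖ ^ 2 :=
      (h.memLp_snd t).integrable_sq.add (h.memLp_fst t).norm.integrable_sq
    have hm : MeasurableSet {x : Space N | t + a ≤ ‖x‖} :=
      measurableSet_le measurable_const measurable_norm
    rw [← integral_indicator hm]
    refine tendsto_integral_of_dominated_convergence _ (fun n => ?_) hI (fun n => ?_) ?_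
    · refine AEStronglyMeasurable.mul ?_ hI.1
      exact ((contDiff_coneWeight a n).continuous.comp
        (Continuous.prodMk_right t)).aestronglyMeasurable
    · refine ae_of_all _ fun y => ?_
      rw [Real.norm_eq_abs, abs_of_nonneg (mul_nonneg (coneWeight_nonneg _ _ _ _) (by positivity))]
      exact mul_le_of_le_one_left (by positivity) (coneWeight_le_one _ _ _ _)
    · have h0 : ∀ᵐ y : Space N, ‖y‖ ≠ t + a := by
        have := Measure.addHaar_sphere (volume : Measure (Space N)) 0 (t + a)
        rw [measure_eq_zero_iff_ae_notMem] at this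
        filter_upwards [this] with y hy
        simpa using hy
      filter_upwards [h0] with y hy
      have h1 := (tendsto_coneWeight a t hy).mul_const (v t y ^ 2 + ‖D t y‖ ^ 2)
      convert! h1 using 2
      by_cases hyS : y ∈ {x : Space N | t + a ≤ ‖x‖}
      · rw [Set.indicator_of_mem hyS, Set.indicator_of_mem hyS]; simp [add_comm]
      · rw [Set.indicator_of_notMem hyS, Set.indicator_of_notMem hyS]; simp
  refine le_of_tendsto_of_tendsto' (hlim t) (hlim s) fun n => ?_
  refine h.antitone_weighted_energy (contDiff_coneWeight a n) (fun r => ⟨n - r + 1, ?_⟩)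
    (coneWeight_deriv_add_norm_fderiv_nonpos a n) hst
  filter_upwards [lt_mem_nhds (show r - 1 < r by linarith)] with r' hr' y hy
  exact coneWeight_eq_zero a n (by linarith)

/-- Conservation of energy. -/
theorem IsFirstOrderSolution.integral_energy_eq [Nontrivial (Space N)]
    {D : ℝ → Space N → Space N} {v : ℝ → Space N → ℝ} (h : IsFirstOrderSolution D v) (s t : ℝ) :
    ∫ x, (‖D t x‖ ^ 2 + v t x ^ 2) = ∫ x, (‖D s x‖ ^ 2 + v s x ^ 2) := by
  have key : ∀ {D : ℝ → Space N → Space N} {v : ℝ → Space N → ℝ}, IsFirstOrderSolution D v →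
      ∀ {s t : ℝ}, s ≤ t → ∫ x, (‖D t x‖ ^ 2 + v t x ^ 2) ≤ ∫ x, (‖D s x‖ ^ 2 + v s x ^ 2) := by
    intro D v h s t hst
    -- Up to time `t` the cone `|x| = r - t` has not opened, so its exterior is the whole space.
    have huniv : ∀ r ≤ t, {x : Space N | r + -t ≤ ‖x‖} = Set.univ := fun r hr =>
      Set.eq_univ_of_forall fun x => show r + -t ≤ ‖x‖ by linarith [norm_nonneg x]
    have := h.setIntegral_energy_le (-t) hst
    rwa [huniv t le_rfl, huniv s hst, setIntegral_univ, setIntegral_univ] at this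
  have key' : ∀ {s t : ℝ}, s ≤ t →
      ∫ x, (‖D t x‖ ^ 2 + v t x ^ 2) = ∫ x, (‖D s x‖ ^ 2 + v s x ^ 2) := by
    intro s t hst
    refine le_antisymm (key h hst) ?_
    simpa using key h.timeReversal (neg_le_neg hst)
  rcases le_total s t with hst | hst
  · exact key' hst
  · exact (key' hst).symm

end Cone

/-! ### Explicit rational solutions in odd dimension -/

section Explicit

variable {N : ℕ}

/-- The derivative in time of an integral against a compactly supported function. -/
theorem hasDerivAt_integral_mul_of_contDiff {f f' : ℝ → Space N → ℝ}
    (hf : ContDiff ℝ 1 (Function.uncurry f)) (hf' : ∀ t x, HasDerivAt (fun s => f s x) (f' t x) t)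
    {ψ : Space N → ℝ} (hψ : Continuous ψ) (hψs : HasCompactSupport ψ) (t : ℝ) :
    HasDerivAt (fun s => ∫ x, f s x * ψ x) (∫ x, f' t x * ψ x) t := by
  have hf'e : Function.uncurry f' = fun z => fderiv ℝ (Function.uncurry f) z (1, 0) := by
    ext ⟨s, x⟩
    have h1 := (hf.differentiable one_ne_zero (s, x)).hasFDerivAt
    have h2 : HasDerivAt (fun s : ℝ => (s, x)) ((1 : ℝ), (0 : Space N)) s :=
      (hasDerivAt_id s).prodMk (hasDerivAt_const s x)
    have h3 := HasFDerivAt.comp_hasDerivAt (f := fun s : ℝ => (s, x)) s h1 h2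
    exact (hf' s x).unique h3
  have hf'c : Continuous (Function.uncurry f') := by
    rw [hf'e]
    exact (hf.continuous_fderiv one_ne_zero).clm_apply continuous_const
  have hfs : ∀ s, Continuous (f s) := fun s => hf.continuous.comp (Continuous.prodMk_right s)
  have hfs' : ∀ s, Continuous (f' s) := fun s => hf'c.comp (Continuous.prodMk_right s)
  obtain ⟨M, hM⟩ := ((isCompact_closedBall t 1).prod hψs).exists_bound_of_continuousOn
    hf'c.continuousOn
  refine (hasDerivAt_integral_of_dominated_loc_of_deriv_le (F' := fun s x => f' s x * ψ x)
    (bound := fun x => M * |ψ x|) (Metric.closedBall_mem_nhds t one_pos) ?_ ?_ ?_ ?_ ?_ ?_).2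
  · exact Eventually.of_forall fun s => ((hfs s).mul hψ).aestronglyMeasurable
  · exact ((hfs t).mul hψ).integrable_of_hasCompactSupport hψs.mul_left
  · exact ((hfs' t).mul hψ).aestronglyMeasurable
  · refine ae_of_all _ fun x s hs => ?_
    rw [norm_mul, Real.norm_eq_abs (ψ x)]
    by_cases hx : x ∈ tsupport ψ
    · gcongr
      exact hM (s, x) ⟨hs, hx⟩
    · simp [image_eq_zero_of_notMem_tsupport hx]
  · exact (hψ.integrable_of_hasCompactSupport hψs).norm.const_mul M
  · exact ae_of_all _ fun x s _ => (hf' s x).mul_const (ψ x)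

/-- Integration by parts against a test function. -/
theorem integral_fderiv_mul_eq_neg {f ψ : Space N → ℝ} (hf : ContDiff ℝ 1 f)
    (hψ : IsTestFunction ψ) (w : Space N) :
    ∫ x, fderiv ℝ f x w * ψ x = - ∫ x, f x * fderiv ℝ ψ x w := by
  have hfc : Continuous fun x => fderiv ℝ f x w :=
    (hf.continuous_fderiv one_ne_zero).clm_apply continuous_const
  have := integral_mul_fderiv_eq_neg_fderiv_mul_of_integrable (μ := volume) (f := f) (g := ψ)
    (v := w) ?_ ?_ ?_ (fun x _ => hf.differentiable one_ne_zero x) (fun x _ => hψ.differentiable x)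
  · rw [this, neg_neg]
  · exact (hfc.mul hψ.continuous).integrable_of_hasCompactSupport hψ.hasCompactSupport.mul_left
  · exact (hf.continuous.mul (hψ.fderiv_apply w).continuous).integrable_of_hasCompactSupport
      (hψ.fderiv_apply w).hasCompactSupport.mul_left
  · exact (hf.continuous.mul hψ.continuous).integrable_of_hasCompactSupport
      hψ.hasCompactSupport.mul_left

/-- Classical solutions are weak solutions. -/
theorem isFirstOrderSolution_of_contDiff {D : ℝ → Space N → Space N} {v : ℝ → Space N → ℝ}
    (hD : ContDiff ℝ 1 (Function.uncurry D)) (hv : ContDiff ℝ 1 (Function.uncurry v))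
    (hD2 : ∀ t, MemLp (D t) 2 volume) (hv2 : ∀ t, MemLp (v t) 2 volume)
    (hb : ∀ t, ∃ C : ℝ≥0, ∀ᶠ s in 𝓝 t, eLpNorm (D s) 2 volume ≤ C ∧ eLpNorm (v s) 2 volume ≤ C)
    (hDt : ∀ t x w, HasDerivAt (fun s => inner ℝ (D s x) w) (fderiv ℝ (v t) x w) t)
    (hvt : ∀ t x, HasDerivAt (fun s => v s x)
      (∑ j, fderiv ℝ (fun z => D t z j) x (stdVec j)) t) :
    IsFirstOrderSolution D v where
  memLp_fst := hD2
  memLp_snd := hv2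
  locallyBounded := hb
  hasDerivAt_fst ψ hψ w t := by
    have h1 := hasDerivAt_integral_mul_of_contDiff (f := fun s x => inner ℝ (D s x) w)
      (hD.inner ℝ contDiff_const) (fun t x => hDt t x w) hψ.continuous hψ.hasCompactSupport t
    rw [integral_fderiv_mul_eq_neg (f := v t) (hv.comp (contDiff_prodMk_right t)) hψ] at h1
    simpa only [mul_comm] using h1
  hasDerivAt_snd ψ hψ t := by
    have h1 := hasDerivAt_integral_mul_of_contDiff hv hvt hψ.continuous hψ.hasCompactSupport t
    have hDj : ∀ j, ContDiff ℝ 1 fun z => D t z j := fun j => by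
      have := (hD.comp (contDiff_prodMk_right t)).inner ℝ (contDiff_const (c := stdVec j))
      simpa using this
    have hI : ∀ j, Integrable fun x => fderiv ℝ (fun z => D t z j) x (stdVec j) * ψ x := fun j =>
      ((((hDj j).continuous_fderiv one_ne_zero).clm_apply continuous_const).mul
        hψ.continuous).integrable_of_hasCompactSupport hψ.hasCompactSupport.mul_left
    have hI' : ∀ j, Integrable fun x => D t x j * fderiv ℝ ψ x (stdVec j) := fun j =>
      ((hDj j).continuous.mul (hψ.fderiv_apply _).continuous).integrable_of_hasCompactSupport
        (hψ.fderiv_apply _).hasCompactSupport.mul_left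
    convert! h1 using 1
    simp only [Finset.sum_mul]
    rw [integral_finsetSum _ fun j _ => hI j,
      Finset.sum_congr rfl fun j _ => integral_fderiv_mul_eq_neg (hDj j) hψ (stdVec j),
      Finset.sum_neg_distrib, ← integral_finsetSum _ fun j _ => hI' j]
    congr 2 with x
    rw [real_inner_comm, inner_gradient_left, ← sum_apply_stdVec_mul]
    exact Finset.sum_congr rfl fun j _ => mul_comm _ _

/-- The complex Lorentz form `|x - p|² - (t - iε)²`. -/
noncomputable def lorentz (p : Space N) (ε t : ℝ) (x : Space N) : ℂ :=
  ((‖x - p‖ ^ 2 : ℝ) : ℂ) - ((t : ℂ) - ε * Complex.I) ^ 2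

/-- Up to a constant factor, the spatial gradient of `Re (c (|x - p|² - (t - iε)²)⁻ᵐ)`, a solution
of the wave equation in dimension `2m + 1`. -/
noncomputable def explicitGradient (c : ℂ) (m : ℕ) (p : Space N) (ε t : ℝ) (x : Space N) :
    Space N :=
  (-(c * (lorentz p ε t x ^ (m + 1))⁻¹).re) • (x - p)

/-- Up to the factor of `explicitGradient`, the time derivative of
`Re (c (|x - p|² - (t - iε)²)⁻ᵐ)`. -/
noncomputable def explicitVelocity (c : ℂ) (m : ℕ) (p : Space N) (ε t : ℝ) (x : Space N) : ℝ :=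
  (c * (t - ε * Complex.I) * (lorentz p ε t x ^ (m + 1))⁻¹).re

/-- The modulus of the Lorentz form; in particular the form has no zeros for `ε ≠ 0`, and it is
small only near the light cone. -/
theorem normSq_lorentz (p : Space N) (ε t : ℝ) (x : Space N) :
    ‖lorentz p ε t x‖ ^ 2 = ((‖x - p‖ - |t|) ^ 2 + ε ^ 2) * ((‖x - p‖ + |t|) ^ 2 + ε ^ 2) := by
  have h : lorentz p ε t x = ⟨‖x - p‖ ^ 2 - t ^ 2 + ε ^ 2, 2 * t * ε⟩ := by
    apply Complex.ext <;> simp [lorentz, pow_two] <;> ring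
  rw [h, Complex.sq_norm, Complex.normSq_mk]
  rcases abs_cases t with ⟨ht, _⟩ | ⟨ht, _⟩ <;> rw [ht] <;> ring

theorem lorentz_ne_zero {ε : ℝ} (hε : ε ≠ 0) (p : Space N) (t : ℝ) (x : Space N) :
    lorentz p ε t x ≠ 0 := by
  have : 0 < ‖lorentz p ε t x‖ ^ 2 := by rw [normSq_lorentz]; positivity
  intro h
  simp [h] at this

theorem contDiff_lorentz (p : Space N) (ε : ℝ) :
    ContDiff ℝ 1 (Function.uncurry (lorentz p ε)) := by
  unfold lorentz
  refine ContDiff.sub ?_ ?_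
  · have h : ContDiff ℝ 1 fun z : ℝ × Space N => ‖z.2 - p‖ ^ 2 :=
      ContDiff.norm_sq ℝ (contDiff_snd.sub contDiff_const)
    exact Complex.ofRealCLM.contDiff.comp h
  · exact ((Complex.ofRealCLM.contDiff.comp contDiff_fst).sub contDiff_const).pow 2

theorem contDiff_inv_lorentz_pow (m : ℕ) (p : Space N) {ε : ℝ} (hε : ε ≠ 0) :
    ContDiff ℝ 1 fun z : ℝ × Space N => (lorentz p ε z.1 z.2 ^ (m + 1))⁻¹ :=
  ((contDiff_lorentz p ε).pow (m + 1)).inv fun z => pow_ne_zero _ (lorentz_ne_zero hε p z.1 z.2)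

theorem contDiff_explicitGradient (c : ℂ) (m : ℕ) (p : Space N) {ε : ℝ} (hε : ε ≠ 0) :
    ContDiff ℝ 1 (Function.uncurry (explicitGradient c m p ε)) := by
  have h' : ContDiff ℝ 1 fun z : ℝ × Space N => z.2 - p := contDiff_snd.sub contDiff_const
  have h : ContDiff ℝ 1 fun z : ℝ × Space N => c * (lorentz p ε z.1 z.2 ^ (m + 1))⁻¹ :=
    contDiff_const.mul (contDiff_inv_lorentz_pow m p hε)
  have h'' : ContDiff ℝ 1 fun z : ℝ × Space N => -(c * (lorentz p ε z.1 z.2 ^ (m + 1))⁻¹).re :=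
    (Complex.reCLM.contDiff.comp h).neg
  exact h''.smul h'

theorem contDiff_explicitVelocity (c : ℂ) (m : ℕ) (p : Space N) {ε : ℝ} (hε : ε ≠ 0) :
    ContDiff ℝ 1 (Function.uncurry (explicitVelocity c m p ε)) := by
  have h1 : ContDiff ℝ 1 fun z : ℝ × Space N => (z.1 : ℂ) - ε * Complex.I :=
    (Complex.ofRealCLM.contDiff.comp contDiff_fst).sub contDiff_const
  have h : ContDiff ℝ 1 fun z : ℝ × Space N =>
      c * (z.1 - ε * Complex.I) * (lorentz p ε z.1 z.2 ^ (m + 1))⁻¹ :=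
    (contDiff_const.mul h1).mul (contDiff_inv_lorentz_pow m p hε)
  exact Complex.reCLM.contDiff.comp h

theorem _root_.HasDerivAt.inv_pow_succ {q : ℝ → ℂ} {q' : ℂ} {s : ℝ} (h : HasDerivAt q q' s)
    (h0 : q s ≠ 0) (m : ℕ) :
    HasDerivAt (fun s => (q s ^ (m + 1))⁻¹) (-((m + 1) * q' * (q s ^ (m + 2))⁻¹)) s := by
  refine ((h.pow (m + 1)).inv (pow_ne_zero _ h0)).congr_deriv ?_
  simp only [Pi.pow_apply]
  push_cast
  field_simp
  simp
  ring

theorem _root_.HasDerivAt.complex_re {f : ℝ → ℂ} {f' : ℂ} {s : ℝ} (h : HasDerivAt f f' s) :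
    HasDerivAt (fun s => (f s).re) f'.re s :=
  Complex.reCLM.hasFDerivAt.comp_hasDerivAt s h

theorem hasDerivAt_sub_I (ε t : ℝ) :
    HasDerivAt (fun s : ℝ => (s : ℂ) - ε * Complex.I) 1 t :=
  ((hasDerivAt_id t).ofReal_comp.sub_const _).congr_deriv (by simp)

theorem hasDerivAt_lorentz_time (p : Space N) (ε t : ℝ) (x : Space N) :
    HasDerivAt (fun s => lorentz p ε s x) (-(2 * (t - ε * Complex.I))) t := by
  refine (((hasDerivAt_sub_I ε t).pow 2).const_sub _).congr_deriv ?_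
  simp

theorem hasDerivAt_lorentz_line (p : Space N) (ε t : ℝ) (x w : Space N) :
    HasDerivAt (fun s : ℝ => lorentz p ε t (x + s • w))
      (2 * (inner ℝ (x - p) w : ℝ)) 0 := by
  have h1 : HasDerivAt (fun s : ℝ => x + s • w - p) w 0 := by
    simpa using (((hasDerivAt_id (0 : ℝ)).smul_const w).const_add x).sub_const p
  refine (h1.norm_sq.ofReal_comp.sub_const _).congr_deriv ?_
  simp

theorem fderiv_apply_of_hasDerivAt_line {f : Space N → ℝ} {x w : Space N} {d : ℝ}
    (hf : DifferentiableAt ℝ f x) (h : HasDerivAt (fun s : ℝ => f (x + s • w)) d 0) :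
    fderiv ℝ f x w = d := by
  rw [← hf.lineDeriv_eq_fderiv]
  exact h.deriv

theorem fderiv_re_inv_lorentz_pow (c : ℂ) (m : ℕ) (p : Space N) {ε : ℝ} (hε : ε ≠ 0) (t : ℝ)
    (x w : Space N) :
    fderiv ℝ (fun z => (c * (lorentz p ε t z ^ (m + 1))⁻¹).re) x w
      = (c * -((m + 1) * (2 * (inner ℝ (x - p) w : ℝ)) * (lorentz p ε t x ^ (m + 2))⁻¹)).re := by
  refine fderiv_apply_of_hasDerivAt_line ?_ ?_
  · have h : ContDiff ℝ 1 fun z => (c * (lorentz p ε t z ^ (m + 1))⁻¹).re :=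
      Complex.reCLM.contDiff.comp (contDiff_const.mul
        ((contDiff_inv_lorentz_pow m p hε).comp (contDiff_prodMk_right t)))
    exact h.differentiable one_ne_zero x
  · have h := (((hasDerivAt_lorentz_line p ε t x w).inv_pow_succ
      (lorentz_ne_zero hε _ _ _) m).const_mul c).complex_re
    simpa using h

theorem hasDerivAt_explicitGradient (c : ℂ) (m : ℕ) (p : Space N) {ε : ℝ} (hε : ε ≠ 0) (t : ℝ)
    (x w : Space N) :
    HasDerivAt (fun s => inner ℝ (explicitGradient c m p ε s x) w)
      (fderiv ℝ (explicitVelocity c m p ε t) x w) t := by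
  have h1 : fderiv ℝ (explicitVelocity c m p ε t) x w = _ :=
    fderiv_re_inv_lorentz_pow (c * (t - ε * Complex.I)) m p hε t x w
  have h2 := (((hasDerivAt_lorentz_time p ε t x).inv_pow_succ
      (lorentz_ne_zero hε _ _ _) m).const_mul c).complex_re
  have h3 := h2.neg.mul_const (inner ℝ (x - p) w)
  rw [h1]
  refine (h3.congr_deriv ?_).congr_of_eventuallyEq (Eventually.of_forall fun s => ?_)
  · rw [← Complex.ofReal_re (inner ℝ (x - p) w), ← Complex.neg_re, ← Complex.re_mul_ofReal]
    simp only [Complex.ofReal_re]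
    congr 1
    ring
  · simp [explicitGradient, real_inner_smul_left]

/-- The equation `∂_t v = div D` for the explicit solutions, which relies on `N = 2m + 1`. -/
theorem hasDerivAt_explicitVelocity (c : ℂ) {m : ℕ} (hN : N = 2 * m + 1) (p : Space N) {ε : ℝ}
    (hε : ε ≠ 0) (t : ℝ) (x : Space N) :
    HasDerivAt (fun s => explicitVelocity c m p ε s x)
      (∑ j, fderiv ℝ (fun z => explicitGradient c m p ε t z j) x (stdVec j)) t := by
  set q := lorentz p ε t x with hq
  have hq0 : q ≠ 0 := lorentz_ne_zero hε _ _ _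
  set α : Space N → ℝ := fun z => (c * (lorentz p ε t z ^ (m + 1))⁻¹).re with hα
  have hαd : DifferentiableAt ℝ α x := by
    have h : ContDiff ℝ 1 α :=
      Complex.reCLM.contDiff.comp (contDiff_const.mul
        ((contDiff_inv_lorentz_pow m p hε).comp (contDiff_prodMk_right t)))
    exact h.differentiable one_ne_zero x
  have hdiv : ∑ j, fderiv ℝ (fun z => explicitGradient c m p ε t z j) x (stdVec j)
      = - fderiv ℝ α x (x - p) - N * α x := by
    have hj : ∀ j, fderiv ℝ (fun z => explicitGradient c m p ε t z j) x (stdVec j)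
        = -(fderiv ℝ α x (stdVec j) * (x - p) j) - α x := by
      intro j
      have h1 : HasFDerivAt (fun z : Space N => (z - p) j)
          (EuclideanSpace.proj (𝕜 := ℝ) j : Space N →L[ℝ] ℝ) x := by
        have := (EuclideanSpace.proj (𝕜 := ℝ) j : Space N →L[ℝ] ℝ).hasFDerivAt (x := x)
        simpa using this.sub_const (p j)
      have h2 := (hαd.hasFDerivAt.neg).mul h1
      have h3 : (fun z => explicitGradient c m p ε t z j) = fun z => (-α) z * (z - p) j := by
        ext z; simp [explicitGradient, hα]
      rw [h3]
      erw [h2.fderiv]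
      simp [stdVec]
      ring
    rw [Finset.sum_congr rfl fun j _ => hj j, Finset.sum_sub_distrib, Finset.sum_neg_distrib,
      sum_apply_stdVec_mul]
    simp
  have h1 := ((((hasDerivAt_sub_I ε t).const_mul c)).mul
    ((hasDerivAt_lorentz_time p ε t x).inv_pow_succ hq0 m)).complex_re
  refine h1.congr_deriv ?_
  rw [hdiv, fderiv_re_inv_lorentz_pow c m p hε, hα]
  rw [← Complex.re_ofReal_mul, ← Complex.neg_re, ← Complex.sub_re]
  congr 1
  have e1 : ((t : ℂ) - ε * Complex.I) ^ 2 = ((‖x - p‖ ^ 2 : ℝ) : ℂ) - q := by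
    rw [hq, lorentz]; ring
  have e3 : (N : ℂ) = 2 * m + 1 := by exact_mod_cast hN
  rw [real_inner_self_eq_norm_sq, ← hq, Complex.ofReal_natCast, e3]
  have e2 : (q ^ (m + 1))⁻¹ = q * (q ^ (m + 2))⁻¹ := by field_simp; ring
  rw [e2]
  push_cast at e1 ⊢
  linear_combination 2 * c * (m + 1) * (q ^ (m + 2))⁻¹ * e1

end Explicit

/-! ### Decay of the explicit solutions -/

section ExplicitBounds

variable {N : ℕ}

/-- Pointwise energy bound, in terms of the distance `|‖x - p‖ - |t||` to the light cone and of
`‖x - p‖ + |t|`. -/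
theorem explicit_energy_le (c : ℂ) (m : ℕ) (p : Space N) {ε : ℝ} (hε : ε ≠ 0) (t : ℝ)
    (x : Space N) :
    ‖explicitGradient c m p ε t x‖ ^ 2 + explicitVelocity c m p ε t x ^ 2 ≤
      ‖c‖ ^ 2 / (((‖x - p‖ - |t|) ^ 2 + ε ^ 2) *
        (((‖x - p‖ - |t|) ^ 2 + ε ^ 2) * ((‖x - p‖ + |t|) ^ 2 + ε ^ 2)) ^ m) := by
  set A := (‖x - p‖ - |t|) ^ 2 + ε ^ 2
  set B := (‖x - p‖ + |t|) ^ 2 + ε ^ 2 with hB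
  have hA0 : 0 < A := by positivity
  have hB0 : 0 < B := by positivity
  set Q := (lorentz p ε t x ^ (m + 1))⁻¹ with hQ
  have hQn : ‖Q‖ ^ 2 = ((A * B) ^ (m + 1))⁻¹ := by
    rw [hQ, norm_inv, norm_pow, inv_pow, ← pow_mul, mul_comm, pow_mul, normSq_lorentz]
  have h1 : ‖explicitGradient c m p ε t x‖ ^ 2 ≤ ‖c‖ ^ 2 * ‖Q‖ ^ 2 * ‖x - p‖ ^ 2 := by
    rw [explicitGradient, norm_smul, mul_pow, norm_neg, ← mul_pow ‖c‖, ← norm_mul]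
    gcongr
    exact Complex.abs_re_le_norm _
  have h2 : explicitVelocity c m p ε t x ^ 2 ≤ ‖c‖ ^ 2 * ‖Q‖ ^ 2 * (t ^ 2 + ε ^ 2) := by
    have e1 : ‖(t : ℂ) - ε * Complex.I‖ ^ 2 = t ^ 2 + ε ^ 2 := by
      have : (t : ℂ) - ε * Complex.I = ⟨t, -ε⟩ := by apply Complex.ext <;> simp
      rw [this, Complex.sq_norm, Complex.normSq_mk]; ring
    rw [← e1, ← mul_pow, ← mul_pow, ← norm_mul, ← norm_mul, explicitVelocity, ← sq_abs,
      mul_right_comm]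
    gcongr
    exact Complex.abs_re_le_norm _
  have h3 : ‖x - p‖ ^ 2 + (t ^ 2 + ε ^ 2) ≤ B := by
    rw [hB, ← sq_abs t]
    nlinarith [mul_nonneg (norm_nonneg (x - p)) (abs_nonneg t)]
  calc _ ≤ ‖c‖ ^ 2 * ‖Q‖ ^ 2 * (‖x - p‖ ^ 2 + (t ^ 2 + ε ^ 2)) := by rw [mul_add]; gcongr
    _ ≤ ‖c‖ ^ 2 * ‖Q‖ ^ 2 * B := by gcongr
    _ = _ := by
      rw [hQn]
      field_simp
      rw [pow_succ]
      ring

/-- A shift by `β` costs a constant factor, because `ε` keeps the right-hand side away from zero. -/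
theorem add_sq_le_mul_sq_add_sq {ε : ℝ} (hε : ε ≠ 0) (β y : ℝ) :
    (β + |y|) ^ 2 ≤ (2 + 2 * β ^ 2 / ε ^ 2) * (y ^ 2 + ε ^ 2) := by
  have h1 : (2 + 2 * β ^ 2 / ε ^ 2) * (y ^ 2 + ε ^ 2)
      = 2 * y ^ 2 + 2 * β ^ 2 + (2 * ε ^ 2 + 2 * β ^ 2 / ε ^ 2 * y ^ 2) := by
    field_simp; ring
  have h2 : 0 ≤ 2 * ε ^ 2 + 2 * β ^ 2 / ε ^ 2 * y ^ 2 := by positivity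
  have h3 : (β + |y|) ^ 2 ≤ 2 * β ^ 2 + 2 * y ^ 2 := by
    nlinarith [sq_nonneg (β - |y|), sq_abs y]
  rw [h1]
  linarith

theorem memLp_inv_one_add_norm_pow (hN : N ≠ 0) :
    MemLp (fun x : Space N => ((1 + ‖x‖) ^ N)⁻¹) 2 volume := by
  have hc : Continuous fun x : Space N => ((1 + ‖x‖) ^ N)⁻¹ :=
    ((continuous_const.add continuous_norm).pow N).inv₀ fun x =>
      (pow_pos (by positivity : (0 : ℝ) < 1 + ‖x‖) N).ne'
  rw [memLp_two_iff_integrable_sq hc.aestronglyMeasurable]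
  have h := integrable_one_add_norm (E := Space N) (μ := volume) (r := 2 * N) (by
    simp only [finrank_euclideanSpace, Fintype.card_fin]
    have : (0 : ℝ) < N := Nat.cast_pos.2 (Nat.pos_of_ne_zero hN)
    linarith)
  refine h.congr (ae_of_all _ fun x => ?_)
  have hx : 0 ≤ 1 + ‖x‖ := by positivity
  simp only
  rw [Real.rpow_neg hx, inv_pow, ← pow_mul, ← Real.rpow_natCast]
  push_cast
  rw [mul_comm]

/-- On bounded time intervals, the explicit solutions decay like `|x|⁻ᴺ`. -/
theorem exists_explicit_energy_le_of_abs_le (c : ℂ) {m : ℕ} (hN : N = 2 * m + 1) (p : Space N)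
    {ε : ℝ} (hε : ε ≠ 0) (T : ℝ) : ∃ K : ℝ, 0 ≤ K ∧ ∀ t, |t| ≤ T → ∀ x : Space N,
      ‖explicitGradient c m p ε t x‖ ≤ K * ((1 + ‖x‖) ^ N)⁻¹ ∧
      ‖explicitVelocity c m p ε t x‖ ≤ K * ((1 + ‖x‖) ^ N)⁻¹ := by
  set β := 1 + ‖p‖ + T
  set M := 2 + 2 * β ^ 2 / ε ^ 2 with hM
  have hM0 : 0 < M := by positivity
  refine ⟨√(‖c‖ ^ 2 * M ^ N), Real.sqrt_nonneg _, fun t ht x => ?_⟩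
  set A := (‖x - p‖ - |t|) ^ 2 + ε ^ 2 with hA
  set B := (‖x - p‖ + |t|) ^ 2 + ε ^ 2 with hB
  have hA0 : 0 < A := by positivity
  have hAB : A ≤ B := by
    rw [hA, hB]
    nlinarith [mul_nonneg (norm_nonneg (x - p)) (abs_nonneg t)]
  have hAM : (1 + ‖x‖) ^ 2 ≤ M * A := by
    refine le_trans ?_ (add_sq_le_mul_sq_add_sq hε β _)
    have h1 : ‖x‖ ≤ ‖x - p‖ + ‖p‖ := by simpa using norm_add_le (x - p) p
    have h2 := le_abs_self (‖x - p‖ - |t|)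
    refine pow_le_pow_left₀ (by positivity) ?_ 2
    simp only [β]
    linarith
  have hbound : ‖explicitGradient c m p ε t x‖ ^ 2 + explicitVelocity c m p ε t x ^ 2
      ≤ (√(‖c‖ ^ 2 * M ^ N) * ((1 + ‖x‖) ^ N)⁻¹) ^ 2 := by
    calc _ ≤ ‖c‖ ^ 2 / (A * (A * B) ^ m) := explicit_energy_le c m p hε t x
      _ ≤ ‖c‖ ^ 2 / (A * (A * A) ^ m) := by gcongr
      _ = ‖c‖ ^ 2 * M ^ N * ((M * A) ^ N)⁻¹ := by
        have h1 : A * (A * A) ^ m = A ^ N := by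
          rw [hN, ← pow_two, ← pow_mul, ← pow_succ']
        rw [h1, mul_pow]
        field_simp
      _ ≤ ‖c‖ ^ 2 * M ^ N * (((1 + ‖x‖) ^ 2) ^ N)⁻¹ := by gcongr
      _ = _ := by
        rw [mul_pow (√(‖c‖ ^ 2 * M ^ N)), Real.sq_sqrt (by positivity), inv_pow, ← pow_mul,
          ← pow_mul, mul_comm 2 N]
  have h0 : 0 ≤ √(‖c‖ ^ 2 * M ^ N) * ((1 + ‖x‖) ^ N)⁻¹ := by positivity
  constructor
  · exact (sq_le_sq₀ (norm_nonneg _) h0).1 (by nlinarith [sq_nonneg (explicitVelocity c m p ε t x)])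
  · refine (sq_le_sq₀ (norm_nonneg _) h0).1 ?_
    rw [Real.norm_eq_abs, sq_abs]
    nlinarith [sq_nonneg ‖explicitGradient c m p ε t x‖]

/-- The explicit solutions have finite energy and solve the first-order system in dimension
`2m + 1`. -/
theorem isFirstOrderSolution_explicit (c : ℂ) {m : ℕ} (hN : N = 2 * m + 1) (p : Space N) {ε : ℝ}
    (hε : ε ≠ 0) :
    IsFirstOrderSolution (explicitGradient c m p ε) (explicitVelocity c m p ε) := by
  have hN0 : N ≠ 0 := by omega
  have hg := memLp_inv_one_add_norm_pow hN0
  have hD := contDiff_explicitGradient c m p hε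
  have hv := contDiff_explicitVelocity c m p hε
  have hDc : ∀ t, Continuous (explicitGradient c m p ε t) := fun t =>
    hD.continuous.uncurry_left t
  have hvc : ∀ t, Continuous (explicitVelocity c m p ε t) := fun t =>
    hv.continuous.uncurry_left t
  refine isFirstOrderSolution_of_contDiff hD hv (fun t => ?_) (fun t => ?_) (fun t => ?_)
    (fun t x w => hasDerivAt_explicitGradient c m p hε t x w)
    (fun t x => hasDerivAt_explicitVelocity c hN p hε t x)
  · obtain ⟨K, hK, h⟩ := exists_explicit_energy_le_of_abs_le c hN p hε |t|
    refine (hg.const_mul K).of_le (hDc t).aestronglyMeasurable (ae_of_all _ fun x => ?_)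
    rw [Real.norm_eq_abs]
    exact ((h t le_rfl x).1).trans (le_abs_self _)
  · obtain ⟨K, hK, h⟩ := exists_explicit_energy_le_of_abs_le c hN p hε |t|
    refine (hg.const_mul K).of_le (hvc t).aestronglyMeasurable (ae_of_all _ fun x => ?_)
    rw [Real.norm_eq_abs (K * _)]
    exact ((h t le_rfl x).2).trans (le_abs_self _)
  · obtain ⟨K, hK, h⟩ := exists_explicit_energy_le_of_abs_le c hN p hε (|t| + 1)
    refine ⟨(eLpNorm (fun x : Space N => K * ((1 + ‖x‖) ^ N)⁻¹) 2 volume).toNNReal, ?_⟩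
    rw [ENNReal.coe_toNNReal (hg.const_mul K).2.ne]
    filter_upwards [(continuous_abs.tendsto t).eventually (gt_mem_nhds (lt_add_one |t|))] with s hs
    exact ⟨eLpNorm_mono_real fun x => (h s hs.le x).1, eLpNorm_mono_real fun x => (h s hs.le x).2⟩

/-- Uniformly in time, the explicit solutions concentrate near the light cone `|x| = |t|`. -/
theorem exists_norm_pow_mul_explicit_energy_le (c : ℂ) (m : ℕ) (p : Space N) {ε : ℝ}
    (hε : ε ≠ 0) : ∃ C : ℝ, ∀ t (x : Space N),
      ‖x‖ ^ (2 * m) * (‖explicitGradient c m p ε t x‖ ^ 2 + explicitVelocity c m p ε t x ^ 2)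
        ≤ C / (1 + (‖x‖ - |t|) ^ 2) := by
  set β := 1 + ‖p‖
  set M := 2 + 2 * β ^ 2 / ε ^ 2 with hM
  have hM0 : 0 < M := by positivity
  refine ⟨‖c‖ ^ 2 * (M / ε ^ 2) ^ m * M, fun t x => ?_⟩
  set A := (‖x - p‖ - |t|) ^ 2 + ε ^ 2 with hA
  set B := (‖x - p‖ + |t|) ^ 2 + ε ^ 2 with hB
  have hA0 : 0 < A := by positivity
  have hB0 : 0 < B := by positivity
  have hε2 : 0 < ε ^ 2 := by positivity
  have hAε : ε ^ 2 ≤ A := by rw [hA]; nlinarith [sq_nonneg (‖x - p‖ - |t|)]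
  have hx1 : ‖x‖ ≤ ‖x - p‖ + ‖p‖ := by simpa using norm_add_le (x - p) p
  have hx2 : ‖x - p‖ ≤ ‖x‖ + ‖p‖ := norm_sub_le x p
  have hBM : ‖x‖ ^ 2 ≤ M * B := by
    refine le_trans ?_ (add_sq_le_mul_sq_add_sq hε β _)
    have h2 := le_abs_self (‖x - p‖ + |t|)
    have h3 := abs_nonneg t
    refine pow_le_pow_left₀ (by positivity) ?_ 2
    rw [abs_of_nonneg (by positivity)]
    simp only [β]
    linarith
  have hAM : 1 + (‖x‖ - |t|) ^ 2 ≤ M * A := by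
    refine le_trans ?_ (add_sq_le_mul_sq_add_sq hε β _)
    have h2 := abs_nonneg (‖x - p‖ - |t|)
    have h3 : |(‖x‖ - |t|)| ≤ ‖p‖ + |(‖x - p‖ - |t|)| := by
      rw [abs_le]
      constructor
      · linarith [neg_abs_le (‖x - p‖ - |t|)]
      · linarith [le_abs_self (‖x - p‖ - |t|)]
    have h4 : (‖x‖ - |t|) ^ 2 ≤ (‖p‖ + |(‖x - p‖ - |t|)|) ^ 2 := by
      rw [← sq_abs (‖x‖ - |t|)]; gcongr
    simp only [β]
    nlinarith [norm_nonneg p]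
  calc _ ≤ (M * B) ^ m * (‖c‖ ^ 2 / (A * (A * B) ^ m)) := by
        rw [pow_mul]
        gcongr
        exact explicit_energy_le c m p hε t x
    _ = ‖c‖ ^ 2 * (M / A) ^ m * M / (M * A) := by
        rw [mul_pow, mul_pow, div_pow]
        field_simp
    _ ≤ ‖c‖ ^ 2 * (M / ε ^ 2) ^ m * M / (1 + (‖x‖ - |t|) ^ 2) := by gcongr

end ExplicitBounds

/-! ### Radiation fields -/

section Radiation

variable {N : ℕ}

/-- The product of the surface measure of the unit sphere and of Lebesgue measure on the line. -/
noncomputable abbrev coneMeasure (N : ℕ) :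
    Measure (Metric.sphere (0 : Space N) 1 × ℝ) :=
  (volume : Measure (Space N)).toSphere.prod volume

/-- Polar coordinates, with the radius as a variable in all of `ℝ`. -/
theorem integral_eq_integral_sphere_prod [Nontrivial (Space N)] (f : Space N → ℝ) :
    ∫ x, f x = ∫ z, {z | 0 < z.2}.indicator
      (fun z => z.2 ^ (N - 1) * f (z.2 • (z.1 : Space N))) z ∂(coneMeasure N) := by
  have hsf : SigmaFinite (Measure.comap (Subtype.val : Set.Ioi (0 : ℝ) → ℝ) volume) := by
    refine SigmaFinite.of_map _ measurable_subtype_coe.aemeasurable ?_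
    rw [map_comap_subtype_coe measurableSet_Ioi]
    infer_instance
  have hS : MeasurableSet {z : Metric.sphere (0 : Space N) 1 × ℝ | 0 < z.2} :=
    measurableSet_lt measurable_const measurable_snd
  have e : MeasurableEmbedding (Prod.map id Subtype.val :
      Metric.sphere (0 : Space N) 1 × Set.Ioi (0 : ℝ) → Metric.sphere (0 : Space N) 1 × ℝ) :=
    MeasurableEmbedding.id.prodMap (MeasurableEmbedding.subtype_coe measurableSet_Ioi)
  have hmap : Measure.map (Prod.map id Subtype.val :
      Metric.sphere (0 : Space N) 1 × Set.Ioi (0 : ℝ) → Metric.sphere (0 : Space N) 1 × ℝ)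
      ((volume : Measure (Space N)).toSphere.prod (Measure.comap Subtype.val volume))
      = (coneMeasure N).restrict {z | 0 < z.2} := by
    rw [← Measure.map_prod_map _ _ measurable_id measurable_subtype_coe, Measure.map_id,
      map_comap_subtype_coe measurableSet_Ioi]
    rw [show {z : Metric.sphere (0 : Space N) 1 × ℝ | 0 < z.2} = Set.univ ×ˢ Set.Ioi 0 by
      ext z; simp, ← Measure.prod_restrict, Measure.restrict_univ]
  calc ∫ x, f x = ∫ x : ({(0 : Space N)}ᶜ : Set (Space N)), f x
          ∂(Measure.comap (Subtype.val : ({(0 : Space N)}ᶜ : Set (Space N)) → Space N) volume) := by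
        rw [integral_subtype_comap (measurableSet_singleton _).compl f, restrict_compl_singleton]
    _ = ∫ z, f ((z.2 : ℝ) • (z.1 : Space N)) ∂((volume : Measure (Space N)).toSphere.prod
          (Measure.volumeIoiPow (N - 1))) := by
        have := (Measure.measurePreserving_homeomorphUnitSphereProd
          (volume : Measure (Space N))).integral_comp (Homeomorph.measurableEmbedding _)
          (fun z => f ((z.2 : ℝ) • (z.1 : Space N)))
        rw [finrank_euclideanSpace, Fintype.card_fin] at this
        rw [← this]
        refine integral_congr_ae (ae_of_all _ fun x => ?_)
        have hx : ‖(x : Space N)‖ ≠ 0 := norm_ne_zero_iff.2 x.2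
        simp [smul_smul, hx]
    _ = ∫ z, (z.2 : ℝ) ^ (N - 1) * f ((z.2 : ℝ) • (z.1 : Space N))
          ∂((volume : Measure (Space N)).toSphere.prod
            (Measure.comap (Subtype.val : Set.Ioi (0 : ℝ) → ℝ) volume)) := by
        have hm : Measurable fun r : Set.Ioi (0 : ℝ) => ENNReal.ofReal ((r : ℝ) ^ (N - 1)) :=
          (measurable_subtype_coe.pow_const _).ennreal_ofReal
        rw [Measure.volumeIoiPow, prod_withDensity_right hm,
          integral_withDensity_eq_integral_toReal_smul
            (f := fun z : Metric.sphere (0 : Space N) 1 × Set.Ioi (0 : ℝ) =>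
              ENNReal.ofReal ((z.2 : ℝ) ^ (N - 1))) (hm.comp measurable_snd)
            (ae_of_all _ fun _ => ENNReal.ofReal_lt_top)]
        refine integral_congr_ae (ae_of_all _ fun z => ?_)
        have hz : (0 : ℝ) ≤ (z.2 : ℝ) ^ (N - 1) := pow_nonneg z.2.2.out.le _
        simp [ENNReal.toReal_ofReal hz]
    _ = _ := by
        rw [integral_indicator hS, ← hmap, e.integral_map]
        rfl

/-- Polar coordinates centered at the sphere of radius `t`. -/
theorem integral_eq_integral_shifted_polar [Nontrivial (Space N)] (f : Space N → ℝ) (t : ℝ) :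
    ∫ x, f x = ∫ z, {z | 0 < t + z.2}.indicator
      (fun z => (t + z.2) ^ (N - 1) * f ((t + z.2) • (z.1 : Space N))) z ∂(coneMeasure N) := by
  rw [integral_eq_integral_sphere_prod]
  have hmp : MeasurePreserving (Prod.map id (fun s => t + s)) (coneMeasure N) (coneMeasure N) :=
    (MeasurePreserving.id _).prod (measurePreserving_add_left volume t)
  have hme : MeasurableEmbedding (Prod.map id (fun s => t + s) :
      Metric.sphere (0 : Space N) 1 × ℝ → _) :=
    MeasurableEmbedding.id.prodMap (measurableEmbedding_addLeft t)
  rw [← hmp.integral_comp hme]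
  rfl

/-- If `t^{2m} e(t, (t + s)θ)` converges to `G(θ, s)` as `t → ∞`, and the energy density `e`
concentrates near the light cone, then the energy between shifted light cones converges. -/
theorem tendsto_setIntegral_of_radiation [Nontrivial (Space N)] {m : ℕ} (hN : N = 2 * m + 1)
    {e : ℝ → Space N → ℝ} (hec : ∀ t, Continuous (e t)) (he0 : ∀ t x, 0 ≤ e t x) {C : ℝ}
    (hC : ∀ t, 0 ≤ t → ∀ x, ‖x‖ ^ (2 * m) * e t x ≤ C / (1 + (‖x‖ - t) ^ 2))
    {G : Metric.sphere (0 : Space N) 1 → ℝ → ℝ}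
    (hG : ∀ (θ : Metric.sphere (0 : Space N) 1) (s : ℝ),
      Tendsto (fun t : ℝ => t ^ (2 * m) * e t ((t + s) • (θ : Space N))) atTop (𝓝 (G θ s)))
    {P : Set ℝ} (hP : MeasurableSet P) :
    Tendsto (fun t => ∫ x in {x | ‖x‖ - t ∈ P}, e t x) atTop
      (𝓝 (∫ z in {z | z.2 ∈ P}, G z.1 z.2 ∂(coneMeasure N))) := by
  have hPm : MeasurableSet {z : Metric.sphere (0 : Space N) 1 × ℝ | z.2 ∈ P} := measurable_snd hP
  have hPx : ∀ t, MeasurableSet {x : Space N | ‖x‖ - t ∈ P} := fun t =>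
    (measurable_norm.sub_const t) hP
  let F : ℝ → Metric.sphere (0 : Space N) 1 × ℝ → ℝ := fun t =>
    {z | 0 < t + z.2}.indicator
      (fun z => (t + z.2) ^ (2 * m) * e t ((t + z.2) • (z.1 : Space N)))
  have hFm : ∀ t, AEStronglyMeasurable (F t) (coneMeasure N) := by
    intro t
    have hc := hec t
    refine (Continuous.aestronglyMeasurable ?_).indicator
      (measurableSet_lt measurable_const (measurable_const.add measurable_snd))
    fun_prop
  have h1 : ∀ t, ∫ x in {x | ‖x‖ - t ∈ P}, e t x
      = ∫ z in {z | z.2 ∈ P}, F t z ∂(coneMeasure N) := by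
    intro t
    rw [← integral_indicator (hPx t), integral_eq_integral_shifted_polar _ t,
      ← integral_indicator hPm]
    congr 1
    ext z
    have hN1 : N - 1 = 2 * m := by omega
    by_cases hz : 0 < t + z.2
    · have hn : ‖(t + z.2) • (z.1 : Space N)‖ = t + z.2 := by
        rw [norm_smul, norm_eq_of_mem_sphere, mul_one, Real.norm_of_nonneg hz.le]
      by_cases hzP : z.2 ∈ P
      · simp [F, Set.indicator, hz, hn, hzP, hN1]
      · simp [F, Set.indicator, hz, hn, hzP]
    · simp [F, Set.indicator, hz]
  simp only [h1]
  refine tendsto_integral_filter_of_dominated_convergence (fun z => C * (1 + z.2 ^ 2)⁻¹)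
    (Eventually.of_forall fun t => (hFm t).restrict) ?_ ?_ ?_
  · filter_upwards [eventually_ge_atTop 0] with t ht
    refine ae_of_all _ fun z => ?_
    by_cases hz : 0 < t + z.2
    · have hn : ‖(t + z.2) • (z.1 : Space N)‖ = t + z.2 := by
        rw [norm_smul, norm_eq_of_mem_sphere, mul_one, Real.norm_of_nonneg hz.le]
      have h2 := hC t ht ((t + z.2) • (z.1 : Space N))
      rw [hn, add_sub_cancel_left] at h2
      simp only [F]
      rw [Set.indicator_of_mem (show z ∈ {z : Metric.sphere (0 : Space N) 1 × ℝ | 0 < t + z.2}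
        from hz), Real.norm_of_nonneg (mul_nonneg (pow_nonneg hz.le _) (he0 _ _))]
      exact h2
    · simp only [F]
      rw [Set.indicator_of_notMem (show z ∉ {z : Metric.sphere (0 : Space N) 1 × ℝ | 0 < t + z.2}
        from hz), norm_zero]
      have h0 : 0 ≤ C := by
        have := (mul_nonneg (pow_nonneg (norm_nonneg (0 : Space N)) (2 * m)) (he0 0 0)).trans
          (hC 0 le_rfl 0)
        simpa using this
      positivity
  · exact ((integrable_inv_one_add_sq.const_mul C).comp_snd _).restrict
  · refine ae_of_all _ fun z => ?_
    have h2 : Tendsto (fun t : ℝ => (1 + z.2 / t) ^ (2 * m)) atTop (𝓝 1) := by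
      have : Tendsto (fun t : ℝ => (1 + z.2 / t) ^ (2 * m)) atTop (𝓝 ((1 + 0) ^ (2 * m))) :=
        (tendsto_const_nhds.add (tendsto_const_nhds.div_atTop tendsto_id)).pow _
      simpa using this
    have h3 := h2.mul (hG z.1 z.2)
    rw [one_mul] at h3
    refine h3.congr' ?_
    filter_upwards [eventually_gt_atTop 0, eventually_gt_atTop (-z.2)] with t ht ht2
    simp only [F]
    rw [Set.indicator_of_mem (show z ∈ {z : Metric.sphere (0 : Space N) 1 × ℝ | 0 < t + z.2}
        by simp only [Set.mem_ofPred_eq]; linarith), ← mul_assoc, ← mul_pow]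
    congr 2
    field_simp

/-- The state `(D, v)` has the radiation field `g`: as `t → +∞`, `t^m v(t, (t + s)θ)` tends to
`g(θ, s)` and `t^m D(t, (t + s)θ)` to the radial vector `-g(θ, s) θ`, while the asymptotics as
`t → -∞`, read at the antipodal point, are given up to sign by the reflection `g(θ, -s)` of the same
function. The last fact is characteristic of the odd dimensions `2m + 1`. The field `bound` says
that the energy concentrates near the light cone `|x| = |t|`. -/
structure HasRadiationField (m : ℕ) (D : ℝ → Space N → Space N) (v : ℝ → Space N → ℝ)
    (g : Metric.sphere (0 : Space N) 1 → ℝ → ℝ) : Prop where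
  continuous_fst : ∀ t, Continuous (D t)
  continuous_snd : ∀ t, Continuous (v t)
  bound : ∃ C : ℝ, ∀ t x, ‖x‖ ^ (2 * m) * (‖D t x‖ ^ 2 + v t x ^ 2) ≤ C / (1 + (‖x‖ - |t|) ^ 2)
  future_fst : ∀ (θ : Metric.sphere (0 : Space N) 1) (s : ℝ),
    Tendsto (fun t : ℝ => t ^ m • D t ((t + s) • (θ : Space N))) atTop
    (𝓝 (-(g θ s) • (θ : Space N)))
  future_snd : ∀ (θ : Metric.sphere (0 : Space N) 1) (s : ℝ),
    Tendsto (fun t : ℝ => t ^ m * v t ((t + s) • (θ : Space N))) atTop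
    (𝓝 (g θ s))
  past_fst : ∀ (θ : Metric.sphere (0 : Space N) 1) (s : ℝ),
    Tendsto (fun t : ℝ => t ^ m • D (-t) (-((t + s) • (θ : Space N)))) atTop
    (𝓝 (((-1) ^ (m + 1) * g θ (-s)) • (θ : Space N)))
  past_snd : ∀ (θ : Metric.sphere (0 : Space N) 1) (s : ℝ),
    Tendsto (fun t : ℝ => t ^ m * v (-t) (-((t + s) • (θ : Space N)))) atTop
    (𝓝 (-((-1) ^ (m + 1) * g θ (-s))))

/-- The energies outside the light cone at `t = ±∞` of a solution with a radiation field add up to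
the total energy: the exterior energy at `-∞` is the interior energy at `+∞`. -/
theorem HasRadiationField.tendsto_exterior [Nontrivial (Space N)] {m : ℕ} (hN : N = 2 * m + 1)
    {D : ℝ → Space N → Space N} {v : ℝ → Space N → ℝ}
    {g : Metric.sphere (0 : Space N) 1 → ℝ → ℝ} (hg : HasRadiationField m D v g)
    (h : IsFirstOrderSolution D v) :
    ∃ A B : ℝ, Tendsto (fun t => ∫ x in {x | |t| ≤ ‖x‖}, (‖D t x‖ ^ 2 + v t x ^ 2)) atTop (𝓝 A) ∧
      Tendsto (fun t => ∫ x in {x | |t| ≤ ‖x‖}, (‖D t x‖ ^ 2 + v t x ^ 2)) atBot (𝓝 B) ∧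
      A + B = ∫ x, (‖D 0 x‖ ^ 2 + v 0 x ^ 2) := by
  obtain ⟨C, hC⟩ := hg.bound
  have hDc := hg.continuous_fst
  have hvc := hg.continuous_snd
  have hfut : ∀ (θ : Metric.sphere (0 : Space N) 1) (s : ℝ),
      Tendsto (fun t : ℝ => t ^ (2 * m) * (‖D t ((t + s) • (θ : Space N))‖ ^ 2
      + v t ((t + s) • (θ : Space N)) ^ 2)) atTop (𝓝 (2 * g θ s ^ 2)) := by
    intro θ s
    have h1 := ((hg.future_fst θ s).norm.pow 2).add ((hg.future_snd θ s).pow 2)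
    rw [norm_smul, norm_eq_of_mem_sphere, mul_one, norm_neg, Real.norm_eq_abs, sq_abs,
      ← two_mul] at h1
    refine h1.congr fun t => ?_
    rw [norm_smul, mul_pow, mul_pow, Real.norm_eq_abs, sq_abs, mul_add, ← pow_mul, mul_comm m 2]
  have hpast : ∀ (θ : Metric.sphere (0 : Space N) 1) (s : ℝ),
      Tendsto (fun t : ℝ => t ^ (2 * m) * (‖D (-t) (-((t + s) • (θ : Space N)))‖ ^ 2
      + v (-t) (-((t + s) • (θ : Space N))) ^ 2)) atTop (𝓝 (2 * g θ (-s) ^ 2)) := by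
    intro θ s
    have h1 := ((hg.past_fst θ s).norm.pow 2).add ((hg.past_snd θ s).pow 2)
    have hsq : ((-1 : ℝ) ^ (m + 1)) ^ 2 = 1 := by rw [← pow_mul, mul_comm, pow_mul]; simp
    rw [norm_smul, norm_eq_of_mem_sphere, mul_one, Real.norm_eq_abs, sq_abs, neg_sq, ← two_mul,
      mul_pow, hsq, one_mul] at h1
    refine h1.congr fun t => ?_
    rw [norm_smul, mul_pow, mul_pow, Real.norm_eq_abs, sq_abs, mul_add, ← pow_mul, mul_comm m 2]
  have hlim := fun (P : Set ℝ) (hP : MeasurableSet P) =>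
    tendsto_setIntegral_of_radiation hN (e := fun t x => ‖D t x‖ ^ 2 + v t x ^ 2)
    (fun t => by have := hDc t; have := hvc t; fun_prop) (fun t x => by positivity)
    (fun t ht x => by simpa only [abs_of_nonneg ht] using hC t x) hfut hP
  have hlim' := tendsto_setIntegral_of_radiation hN
    (e := fun t x => ‖D (-t) (-x)‖ ^ 2 + v (-t) (-x) ^ 2)
    (fun t => by have := hDc (-t); have := hvc (-t); fun_prop) (fun t x => by positivity)
    (fun t ht x => by simpa only [abs_of_nonneg ht, abs_neg, norm_neg] using hC (-t) (-x)) hpast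
    (measurableSet_Ici (a := (0 : ℝ)))
  have hA := hlim (Set.Ici 0) measurableSet_Ici
  have hB := hlim (Set.Iio 0) measurableSet_Iio
  refine ⟨_, ∫ z in {z | z.2 ∈ Set.Iio (0 : ℝ)}, 2 * g z.1 z.2 ^ 2 ∂(coneMeasure N),
    hA.congr' ?_, ?_, ?_⟩
  · filter_upwards [eventually_ge_atTop 0] with t ht
    simp [abs_of_nonneg ht]
  · -- The change of variables `x ↦ -x` at time `-t`, then `s ↦ -s`.
    have hneg : MeasurePreserving (Prod.map id (fun s : ℝ => -s)) (coneMeasure N) (coneMeasure N) :=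
      (MeasurePreserving.id _).prod (Measure.measurePreserving_neg volume)
    have hemb : MeasurableEmbedding (Prod.map id (fun s : ℝ => -s) :
        Metric.sphere (0 : Space N) 1 × ℝ → _) :=
      MeasurableEmbedding.id.prodMap (MeasurableEquiv.neg ℝ).measurableEmbedding
    have hval : ∫ z in {z | z.2 ∈ Set.Ici (0 : ℝ)}, 2 * g z.1 (-z.2) ^ 2 ∂(coneMeasure N)
        = ∫ z in {z | z.2 ∈ Set.Iio (0 : ℝ)}, 2 * g z.1 z.2 ^ 2 ∂(coneMeasure N) := by
      have h1 := hneg.setIntegral_preimage_emb hemb (fun z => 2 * g z.1 z.2 ^ 2)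
        {z | z.2 ∈ Set.Iic (0 : ℝ)}
      have h2 : ({z | z.2 ∈ Set.Iio (0 : ℝ)} : Set (Metric.sphere (0 : Space N) 1 × ℝ))
          =ᵐ[coneMeasure N] {z | z.2 ∈ Set.Iic (0 : ℝ)} :=
        Measure.quasiMeasurePreserving_snd.preimage_ae_eq Iio_ae_eq_Iic
      rw [setIntegral_congr_set h2, ← h1]
      congr 2
      ext z
      simp
    rw [hval] at hlim'
    have h3 := hlim'.comp tendsto_neg_atBot_atTop
    refine h3.congr' ?_
    filter_upwards [eventually_le_atBot 0] with t ht
    simp only [Function.comp, neg_neg]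
    have h4 := (Measure.measurePreserving_neg (volume : Measure (Space N))).setIntegral_preimage_emb
      (MeasurableEquiv.neg (Space N)).measurableEmbedding
      (fun x => ‖D t x‖ ^ 2 + v t x ^ 2) {x | |t| ≤ ‖x‖}
    rw [← h4, abs_of_nonpos ht]
    congr 2
    ext x
    simp only [Set.mem_ofPred_eq, Set.mem_Ici, sub_neg_eq_add, Set.mem_preimage, norm_neg]
    constructor <;> intro <;> linarith
  · refine tendsto_nhds_unique ((hA.add hB).congr fun t => ?_)
      (tendsto_const_nhds (x := ∫ x, (‖D 0 x‖ ^ 2 + v 0 x ^ 2)))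
    have hI : Integrable fun x => ‖D t x‖ ^ 2 + v t x ^ 2 :=
      (h.memLp_fst t).norm.integrable_sq.add (h.memLp_snd t).integrable_sq
    have hm : MeasurableSet {x : Space N | ‖x‖ - t ∈ Set.Ici (0 : ℝ)} :=
      (measurable_norm.sub_const t) measurableSet_Ici
    rw [← h.integral_energy_eq 0 t, ← integral_add_compl hm hI]
    congr 3
    ext x
    simp

end Radiation

/-! ### Radiation fields of the explicit solutions -/

section RadiationLinear

variable {N : ℕ} {m : ℕ}

theorem HasRadiationField.add {D D' : ℝ → Space N → Space N} {v v' : ℝ → Space N → ℝ}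
    {g g' : Metric.sphere (0 : Space N) 1 → ℝ → ℝ} (h : HasRadiationField m D v g)
    (h' : HasRadiationField m D' v' g') :
    HasRadiationField m (fun t x => D t x + D' t x) (fun t x => v t x + v' t x)
      (fun θ s => g θ s + g' θ s) where
  continuous_fst t := (h.continuous_fst t).add (h'.continuous_fst t)
  continuous_snd t := (h.continuous_snd t).add (h'.continuous_snd t)
  bound := by
    obtain ⟨C, hC⟩ := h.bound
    obtain ⟨C', hC'⟩ := h'.bound
    refine ⟨2 * C + 2 * C', fun t x => ?_⟩
    have h1 : ‖D t x + D' t x‖ ^ 2 ≤ 2 * ‖D t x‖ ^ 2 + 2 * ‖D' t x‖ ^ 2 := by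
      have := pow_le_pow_left₀ (norm_nonneg _) (norm_add_le (D t x) (D' t x)) 2
      nlinarith [sq_nonneg (‖D t x‖ - ‖D' t x‖)]
    have h2 : (v t x + v' t x) ^ 2 ≤ 2 * v t x ^ 2 + 2 * v' t x ^ 2 := by
      nlinarith [sq_nonneg (v t x - v' t x)]
    calc _ ≤ ‖x‖ ^ (2 * m) * (2 * (‖D t x‖ ^ 2 + v t x ^ 2)
          + 2 * (‖D' t x‖ ^ 2 + v' t x ^ 2)) := 
          mul_le_mul_of_nonneg_left (by linarith) (by positivity)
      _ ≤ 2 * (C / (1 + (‖x‖ - |t|) ^ 2)) + 2 * (C' / (1 + (‖x‖ - |t|) ^ 2)) := by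
        have := hC t x; have := hC' t x; linarith
      _ = _ := by ring
  future_fst θ s := by
    have := (h.future_fst θ s).add (h'.future_fst θ s)
    simpa only [smul_add, neg_add, add_smul] using this
  future_snd θ s := by
    simpa only [mul_add] using (h.future_snd θ s).add (h'.future_snd θ s)
  past_fst θ s := by
    simpa only [smul_add, mul_add, add_smul] using (h.past_fst θ s).add (h'.past_fst θ s)
  past_snd θ s := by
    simpa only [neg_add, mul_add] using (h.past_snd θ s).add (h'.past_snd θ s)

theorem HasRadiationField.const_smul {D : ℝ → Space N → Space N} {v : ℝ → Space N → ℝ}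
    {g : Metric.sphere (0 : Space N) 1 → ℝ → ℝ} (h : HasRadiationField m D v g) (c : ℝ) :
    HasRadiationField m (fun t x => c • D t x) (fun t x => c * v t x) (fun θ s => c * g θ s) where
  continuous_fst t := (h.continuous_fst t).const_smul c
  continuous_snd t := (h.continuous_snd t).const_mul c
  bound := by
    obtain ⟨C, hC⟩ := h.bound
    refine ⟨c ^ 2 * C, fun t x => ?_⟩
    rw [norm_smul, mul_pow, mul_pow, Real.norm_eq_abs, sq_abs, ← mul_add, mul_left_comm,
      mul_div_assoc]
    exact mul_le_mul_of_nonneg_left (hC t x) (sq_nonneg c)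
  future_fst θ s := by
    have := (h.future_fst θ s).const_smul c
    rw [smul_smul, mul_neg] at this
    simpa only [smul_comm c] using this
  future_snd θ s := by
    simpa only [mul_left_comm c] using (h.future_snd θ s).const_mul c
  past_fst θ s := by
    have := (h.past_fst θ s).const_smul c
    simpa only [smul_smul, mul_left_comm c, mul_comm c] using this
  past_snd θ s := by
    simpa only [mul_left_comm c, mul_neg] using (h.past_snd θ s).const_mul c

theorem HasRadiationField.zero :
    HasRadiationField m (fun _ _ => 0 : ℝ → Space N → Space N) (fun _ _ => 0) (fun _ _ => 0) where
  continuous_fst _ := continuous_const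
  continuous_snd _ := continuous_const
  bound := ⟨0, by simp⟩
  future_fst _ _ := by simp
  future_snd _ _ := by simp
  past_fst _ _ := by simp
  past_snd _ _ := by simp

theorem tendsto_inv_pow_div {q : ℝ → ℂ} {L : ℂ} (hL : L ≠ 0) (m : ℕ)
    (h : Tendsto (fun t : ℝ => q t / t) atTop (𝓝 L)) :
    Tendsto (fun t : ℝ => (t : ℂ) ^ (m + 1) * (q t ^ (m + 1))⁻¹) atTop (𝓝 ((L ^ (m + 1))⁻¹)) := by
  refine ((h.pow (m + 1)).inv₀ (pow_ne_zero _ hL)).congr fun t => ?_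
  rw [div_pow, inv_div, div_eq_mul_inv]

/-- Near the light cone the Lorentz form grows only linearly in time, the quadratic terms cancel. -/
theorem tendsto_lorentz_future (p : Space N) (ε : ℝ) (θ : Metric.sphere (0 : Space N) 1) (s : ℝ) :
    Tendsto (fun t : ℝ => lorentz p ε t ((t + s) • (θ : Space N)) / t) atTop
      (𝓝 (2 * (s - (inner ℝ p (θ : Space N) : ℝ) + ε * Complex.I))) := by
  set κ : ℝ := inner ℝ p (θ : Space N)
  have h1 : Tendsto (fun t : ℝ => (2 * ((s : ℂ) - κ + ε * Complex.I))
      + ((s ^ 2 - 2 * s * κ + ‖p‖ ^ 2 + ε ^ 2 : ℝ) : ℂ) * ((t⁻¹ : ℝ) : ℂ)) atTop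
      (𝓝 (2 * (s - κ + ε * Complex.I) + ((s ^ 2 - 2 * s * κ + ‖p‖ ^ 2 + ε ^ 2 : ℝ) : ℂ)
        * ((0 : ℝ) : ℂ))) :=
    tendsto_const_nhds.add (tendsto_const_nhds.mul
      ((Complex.continuous_ofReal.tendsto 0).comp tendsto_inv_atTop_zero))
  rw [Complex.ofReal_zero, mul_zero, add_zero] at h1
  refine h1.congr' ?_
  filter_upwards [eventually_gt_atTop 0] with t ht
  have ht' : (t : ℂ) ≠ 0 := by exact_mod_cast ht.ne'
  have hn : ‖(t + s) • (θ : Space N) - p‖ ^ 2 = (t + s) ^ 2 - 2 * (t + s) * κ + ‖p‖ ^ 2 := by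
    rw [norm_sub_sq_real, norm_smul, norm_eq_of_mem_sphere, real_inner_smul_left, real_inner_comm,
      mul_one, Real.norm_eq_abs, sq_abs]
    ring
  rw [lorentz, hn]
  push_cast
  field_simp
  linear_combination ((ε : ℂ) ^ 2) * Complex.I_sq

theorem tendsto_lorentz_past (p : Space N) (ε : ℝ) (θ : Metric.sphere (0 : Space N) 1) (s : ℝ) :
    Tendsto (fun t : ℝ => lorentz p ε (-t) (-((t + s) • (θ : Space N))) / t) atTop
      (𝓝 (-(2 * ((-s : ℝ) - (inner ℝ p (θ : Space N) : ℝ) + ε * Complex.I)))) := by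
  set κ : ℝ := inner ℝ p (θ : Space N)
  have h1 : Tendsto (fun t : ℝ => (-(2 * (((-s : ℝ) : ℂ) - κ + ε * Complex.I)))
      + ((s ^ 2 + 2 * s * κ + ‖p‖ ^ 2 + ε ^ 2 : ℝ) : ℂ) * ((t⁻¹ : ℝ) : ℂ)) atTop
      (𝓝 (-(2 * (((-s : ℝ) : ℂ) - κ + ε * Complex.I))
        + ((s ^ 2 + 2 * s * κ + ‖p‖ ^ 2 + ε ^ 2 : ℝ) : ℂ) * ((0 : ℝ) : ℂ))) :=
    tendsto_const_nhds.add (tendsto_const_nhds.mul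
      ((Complex.continuous_ofReal.tendsto 0).comp tendsto_inv_atTop_zero))
  rw [Complex.ofReal_zero, mul_zero, add_zero] at h1
  refine h1.congr' ?_
  filter_upwards [eventually_gt_atTop 0] with t ht
  have ht' : (t : ℂ) ≠ 0 := by exact_mod_cast ht.ne'
  have hn : ‖-((t + s) • (θ : Space N)) - p‖ ^ 2 = (t + s) ^ 2 + 2 * (t + s) * κ + ‖p‖ ^ 2 := by
    rw [norm_sub_sq_real, norm_neg, norm_smul, norm_eq_of_mem_sphere, inner_neg_left,
      real_inner_smul_left, real_inner_comm, mul_one, Real.norm_eq_abs, sq_abs]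
    ring
  rw [lorentz, hn]
  push_cast
  field_simp
  linear_combination ((ε : ℂ) ^ 2) * Complex.I_sq

theorem two_mul_add_mul_I_ne_zero (a : ℝ) {ε : ℝ} (hε : ε ≠ 0) :
    (2 * ((a : ℂ) + ε * Complex.I)) ≠ 0 := by
  intro h
  have := congrArg Complex.im h
  simp at this
  exact hε this

/-- The radiation field of the explicit solutions is `Re (c (2 (s - p · θ + iε))⁻ᵐ⁻¹)`. -/
theorem hasRadiationField_explicit (c : ℂ) (m : ℕ) (p : Space N) {ε : ℝ} (hε : ε ≠ 0) :
    HasRadiationField m (explicitGradient c m p ε) (explicitVelocity c m p ε) (fun θ s =>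
      (c * ((2 * (s - (inner ℝ p (θ : Space N) : ℝ) + ε * Complex.I)) ^ (m + 1))⁻¹).re) where
  continuous_fst t := (contDiff_explicitGradient c m p hε).continuous.uncurry_left t
  continuous_snd t := (contDiff_explicitVelocity c m p hε).continuous.uncurry_left t
  bound := exists_norm_pow_mul_explicit_energy_le c m p hε
  future_fst θ s := by
    have hL := two_mul_add_mul_I_ne_zero (s - inner ℝ p (θ : Space N)) hε
    rw [Complex.ofReal_sub] at hL
    have h1 := (tendsto_inv_pow_div hL m (tendsto_lorentz_future p ε θ s)).const_mul c
    have h2 := (Complex.continuous_re.tendsto _).comp h1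
    have h3 : Tendsto (fun t : ℝ => (θ : Space N) + t⁻¹ • (s • (θ : Space N) - p)) atTop
        (𝓝 ((θ : Space N) + (0 : ℝ) • (s • (θ : Space N) - p))) :=
      tendsto_const_nhds.add (tendsto_inv_atTop_zero.smul_const _)
    rw [zero_smul, add_zero] at h3
    refine (h2.neg.smul h3).congr' ?_
    filter_upwards [eventually_ne_atTop 0] with t ht
    have h4 : (θ : Space N) + t⁻¹ • (s • (θ : Space N) - p)
        = t⁻¹ • ((t + s) • (θ : Space N) - p) := by
      rw [add_smul, add_sub_assoc, smul_add, smul_smul, inv_mul_cancel₀ ht, one_smul]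
    rw [h4, explicitGradient, Function.comp_apply, smul_smul, smul_smul, mul_left_comm,
      ← Complex.ofReal_pow, Complex.re_ofReal_mul]
    congr 1
    field_simp
    ring
  future_snd θ s := by
    have hL := two_mul_add_mul_I_ne_zero (s - inner ℝ p (θ : Space N)) hε
    rw [Complex.ofReal_sub] at hL
    have h1 := (tendsto_inv_pow_div hL m (tendsto_lorentz_future p ε θ s)).const_mul c
    have h3 : Tendsto (fun t : ℝ => (1 : ℂ) - ((t⁻¹ : ℝ) : ℂ) * (ε * Complex.I)) atTop
        (𝓝 ((1 : ℂ) - ((0 : ℝ) : ℂ) * (ε * Complex.I))) :=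
      tendsto_const_nhds.sub (((Complex.continuous_ofReal.tendsto 0).comp
        tendsto_inv_atTop_zero).mul_const _)
    rw [Complex.ofReal_zero, zero_mul, sub_zero] at h3
    have h2 := (Complex.continuous_re.tendsto _).comp (h3.mul h1)
    rw [one_mul] at h2
    refine h2.congr' ?_
    filter_upwards [eventually_ne_atTop 0] with t ht
    have ht' : (t : ℂ) ≠ 0 := by exact_mod_cast ht
    rw [explicitVelocity, Function.comp_apply, ← Complex.re_ofReal_mul]
    congr 1
    push_cast
    field_simp
    ring
  past_fst θ s := by
    have hL := two_mul_add_mul_I_ne_zero (-s - inner ℝ p (θ : Space N)) hε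
    rw [Complex.ofReal_sub] at hL
    have h1 := (tendsto_inv_pow_div (neg_ne_zero.2 hL) m (tendsto_lorentz_past p ε θ s)).const_mul c
    have h2 := (Complex.continuous_re.tendsto _).comp h1
    have h3 : Tendsto (fun t : ℝ => (θ : Space N) + t⁻¹ • (s • (θ : Space N) + p)) atTop
        (𝓝 ((θ : Space N) + (0 : ℝ) • (s • (θ : Space N) + p))) :=
      tendsto_const_nhds.add (tendsto_inv_atTop_zero.smul_const _)
    rw [zero_smul, add_zero] at h3
    have h5 := h2.smul h3
    rw [neg_pow, mul_inv, mul_left_comm, ← inv_pow, inv_neg_one, ← Complex.ofReal_one,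
      ← Complex.ofReal_neg, ← Complex.ofReal_pow, Complex.re_ofReal_mul] at h5
    refine h5.congr' ?_
    filter_upwards [eventually_ne_atTop 0] with t ht
    have h4 : (θ : Space N) + t⁻¹ • (s • (θ : Space N) + p)
        = -(t⁻¹ • (-((t + s) • (θ : Space N)) - p)) := by
      rw [← smul_neg, neg_sub, sub_neg_eq_add, add_comm p, add_smul, add_assoc,
        smul_add t⁻¹ (t • (θ : Space N)), smul_smul, inv_mul_cancel₀ ht, one_smul]
    rw [h4, explicitGradient, Function.comp_apply, smul_neg, ← neg_smul, smul_smul, smul_smul,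
      mul_left_comm, ← Complex.ofReal_pow, Complex.re_ofReal_mul]
    congr 1
    field_simp
    ring
  past_snd θ s := by
    have hL := two_mul_add_mul_I_ne_zero (-s - inner ℝ p (θ : Space N)) hε
    rw [Complex.ofReal_sub] at hL
    have h1 := (tendsto_inv_pow_div (neg_ne_zero.2 hL) m (tendsto_lorentz_past p ε θ s)).const_mul c
    have h3 : Tendsto (fun t : ℝ => (-1 : ℂ) - ((t⁻¹ : ℝ) : ℂ) * (ε * Complex.I)) atTop
        (𝓝 ((-1 : ℂ) - ((0 : ℝ) : ℂ) * (ε * Complex.I))) :=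
      tendsto_const_nhds.sub (((Complex.continuous_ofReal.tendsto 0).comp
        tendsto_inv_atTop_zero).mul_const _)
    rw [Complex.ofReal_zero, zero_mul, sub_zero] at h3
    have h2 := (Complex.continuous_re.tendsto _).comp (h3.mul h1)
    rw [neg_pow, mul_inv, mul_left_comm c, ← inv_pow, inv_neg_one, neg_one_mul, Complex.neg_re,
      ← Complex.ofReal_one, ← Complex.ofReal_neg, ← Complex.ofReal_pow,
      Complex.re_ofReal_mul] at h2
    refine h2.congr' ?_
    filter_upwards [eventually_ne_atTop 0] with t ht
    have ht' : (t : ℂ) ≠ 0 := by exact_mod_cast ht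
    rw [explicitVelocity, Function.comp_apply, ← Complex.re_ofReal_mul]
    congr 1
    push_cast
    field_simp
    ring

end RadiationLinear

/-! ### Rational kernels -/

section Kernels

variable {N : ℕ}

theorem aestronglyMeasurable_comp_sub {G : Type*} [NormedAddCommGroup G] {Z : Space N → G}
    (hZ : AEStronglyMeasurable Z volume) :
    AEStronglyMeasurable (fun a : Space N × Space N => Z (a.1 - a.2))
      ((volume : Measure (Space N)).prod volume) :=
  hZ.comp_quasiMeasurePreserving
    (quasiMeasurePreserving_sub_of_right_invariant (volume : Measure (Space N)) volume)

section MollifyInner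

variable {H : Type*} [NormedAddCommGroup H] [InnerProductSpace ℝ H]

/-- The integrand of `∫ ⟨ρ * Z, V⟩` is integrable on the product space, by
`|⟨a, b⟩| ≤ |a|² + |b|²`. -/
theorem integrable_prod_mul_inner_sub {ρ : Space N → ℝ} (hρ : IsTestFunction ρ)
    {Z V : Space N → H} (hZ : MemLp Z 2 volume) (hV : MemLp V 2 volume) :
    Integrable (fun a : Space N × Space N => ρ a.2 * inner ℝ (Z (a.1 - a.2)) (V a.1))
      ((volume : Measure (Space N)).prod volume) := by
  have hZ2 : Integrable (fun x => ‖Z x‖ ^ 2) := hZ.integrable_norm_pow (by norm_num)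
  have hV2 : Integrable (fun x => ‖V x‖ ^ 2) := hV.integrable_norm_pow (by norm_num)
  have h1 := hρ.integrable.norm.convolution_integrand (ContinuousLinearMap.mul ℝ ℝ) hZ2
  have h2 := hV2.mul_prod hρ.integrable.norm
  refine (h1.add h2).mono' ((hρ.continuous.aestronglyMeasurable (μ := volume)).comp_snd.mul
    ((aestronglyMeasurable_comp_sub hZ.1).inner hV.1.comp_fst)) (ae_of_all _ fun a => ?_)
  have h3 : ‖(inner ℝ (Z (a.1 - a.2)) (V a.1) : ℝ)‖ ≤ ‖Z (a.1 - a.2)‖ ^ 2 + ‖V a.1‖ ^ 2 :=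
    (norm_inner_le_norm _ _).trans (by
      nlinarith [sq_nonneg (‖Z (a.1 - a.2)‖ - ‖V a.1‖), sq_nonneg ‖Z (a.1 - a.2)‖,
        sq_nonneg ‖V a.1‖])
  rw [norm_mul]
  refine (mul_le_mul_of_nonneg_left h3 (norm_nonneg _)).trans_eq ?_
  simp only [Pi.add_apply, ContinuousLinearMap.mul_apply']
  ring

variable [CompleteSpace H]

theorem inner_mollify_eq_integral {ρ : Space N → ℝ} (hρ : IsTestFunction ρ)
    {Z : Space N → H} (hZ : MemLp Z 2 volume) (y : Space N) (w : H) :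
    inner ℝ (mollify ρ Z y) w = ∫ q, ρ q * inner ℝ (Z (y - q)) w := by
  rw [inner_mollify hρ (hZ.locallyIntegrable (by norm_num)), mollify,
    ← integral_sub_left_eq_self (fun q => ρ q * inner ℝ (Z (y - q)) w) volume y]
  simp

theorem integrable_inner_mollify {ρ : Space N → ℝ} (hρ : IsTestFunction ρ)
    {Z V : Space N → H} (hZ : MemLp Z 2 volume) (hV : MemLp V 2 volume) :
    Integrable fun y => (inner ℝ (mollify ρ Z y) (V y) : ℝ) := by
  simp_rw [inner_mollify_eq_integral hρ hZ]
  exact (integrable_prod_mul_inner_sub hρ hZ hV).integral_prod_left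

/-- If `Z` is orthogonal to all translates of `V`, so are its mollifications. -/
theorem integral_inner_mollify_eq_zero {ρ : Space N → ℝ} (hρ : IsTestFunction ρ)
    {Z V : Space N → H} (hZ : MemLp Z 2 volume) (hV : MemLp V 2 volume)
    (h : ∀ p, ∫ x, (inner ℝ (Z x) (V (x - p)) : ℝ) = 0) :
    ∫ y, (inner ℝ (mollify ρ Z y) (V y) : ℝ) = 0 := by
  simp_rw [inner_mollify_eq_integral hρ hZ]
  rw [integral_integral_swap (integrable_prod_mul_inner_sub hρ hZ hV)]
  refine integral_eq_zero_of_ae (ae_of_all _ fun q => ?_)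
  simp only [Pi.zero_apply]
  rw [integral_const_mul, ← integral_add_right_eq_self _ q]
  have := h (-q)
  simp only [sub_neg_eq_add] at this
  simp [this]

end MollifyInner

/-- The dilations of a kernel of nonzero mass separate the values at the origin. -/
theorem eq_zero_of_integral_mul_comp_smul_eq_zero {T f : Space N → ℝ} (hT : Integrable T)
    (hT0 : ∫ x, T x ≠ 0) (hf : Continuous f) {C : ℝ} (hC : ∀ x, ‖f x‖ ≤ C)
    (h : ∀ ε : ℝ, 0 < ε → ∫ x, T x * f (ε • x) = 0) : f 0 = 0 := by
  have hlim : Tendsto (fun n : ℕ => ∫ x, T x * f ((1 / ((n : ℝ) + 1)) • x)) atTop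
      (𝓝 (∫ x, T x * f 0)) := by
    refine tendsto_integral_of_dominated_convergence (fun x => ‖T x‖ * C)
      (fun n => hT.1.mul (by fun_prop)) (hT.norm.mul_const C)
      (fun n => ae_of_all _ fun x => ?_) (ae_of_all _ fun x => ?_)
    · rw [norm_mul]
      exact mul_le_mul_of_nonneg_left (hC _) (norm_nonneg _)
    · refine tendsto_const_nhds.mul ((hf.tendsto 0).comp ?_)
      simpa using (tendsto_one_div_add_atTop_nhds_zero_nat (𝕜 := ℝ)).smul_const x
  have h0 : (fun n : ℕ => ∫ x, T x * f ((1 / ((n : ℝ) + 1)) • x)) = fun _ => 0 :=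
    funext fun n => h _ (by positivity)
  rw [h0, integral_mul_const] at hlim
  exact (mul_eq_zero.1 (tendsto_nhds_unique hlim tendsto_const_nhds)).resolve_left hT0

/-- The kernel `(|x|² + ε²)⁻ᵏ`. -/
noncomputable def kernel (k : ℕ) (ε : ℝ) (x : Space N) : ℝ := ((‖x‖ ^ 2 + ε ^ 2) ^ k)⁻¹

theorem kernel_pos (k : ℕ) {ε : ℝ} (hε : ε ≠ 0) (x : Space N) : 0 < kernel k ε x := by
  unfold kernel; positivity

theorem contDiff_kernel (k : ℕ) {ε : ℝ} (hε : ε ≠ 0) :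
    ContDiff ℝ 1 (kernel k ε : Space N → ℝ) :=
  (((contDiff_norm_sq ℝ).add contDiff_const).pow k).inv fun x => by positivity

theorem kernel_smul (k : ℕ) {ε : ℝ} (κ : ℝ) (x : Space N) :
    kernel k (ε * κ) (ε • x) = (ε ^ (2 * k))⁻¹ * kernel k κ x := by
  unfold kernel
  rw [norm_smul, mul_pow, mul_pow, Real.norm_eq_abs, sq_abs, ← mul_add, mul_pow, mul_inv, pow_mul]

theorem kernel_le (k : ℕ) {ε : ℝ} (hε : ε ≠ 0) (x : Space N) :
    kernel k ε x ≤ (1 + (ε ^ 2)⁻¹) ^ k * kernel k 1 x := by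
  have hε2 : 0 < ε ^ 2 := by positivity
  unfold kernel
  rw [← div_eq_mul_inv, le_div_iff₀ (by positivity), inv_mul_le_iff₀ (by positivity), ← mul_pow]
  refine pow_le_pow_left₀ (by positivity) ?_ k
  have h1 : (ε ^ 2)⁻¹ * ε ^ 2 = 1 := inv_mul_cancel₀ hε2.ne'
  have h2 : 0 ≤ (ε ^ 2)⁻¹ * ‖x‖ ^ 2 := by positivity
  nlinarith

theorem integrable_kernel {k : ℕ} (hk : N < 2 * k) {ε : ℝ} (hε : ε ≠ 0) :
    Integrable (kernel k ε : Space N → ℝ) := by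
  have h := integrable_rpow_neg_one_add_norm_sq (E := Space N) (μ := volume) (r := 2 * k) (by
    simp only [finrank_euclideanSpace, Fintype.card_fin]
    exact_mod_cast hk)
  refine (h.const_mul ((1 + (ε ^ 2)⁻¹) ^ k)).mono'
    (contDiff_kernel k hε).continuous.aestronglyMeasurable (ae_of_all _ fun x => ?_)
  rw [Real.norm_of_nonneg (kernel_pos k hε x).le]
  refine (kernel_le k hε x).trans_eq ?_
  rw [neg_div, mul_div_cancel_left₀ _ two_ne_zero, Real.rpow_neg (by positivity), Real.rpow_natCast,
    kernel, one_pow, add_comm (1 : ℝ) (‖x‖ ^ 2)]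

/-- The kernel of order `k = m` is not integrable in dimension `2m + 1`, but it is square integrable
as soon as `m ≥ 1`. -/
theorem memLp_kernel {k : ℕ} (hk : N < 4 * k) {ε : ℝ} (hε : ε ≠ 0) :
    MemLp (kernel k ε : Space N → ℝ) 2 volume := by
  rw [memLp_two_iff_integrable_sq (contDiff_kernel k hε).continuous.aestronglyMeasurable]
  refine (integrable_kernel (k := 2 * k) (by omega) hε).congr (ae_of_all _ fun x => ?_)
  simp only [kernel]
  rw [inv_pow, ← pow_mul, mul_comm]

theorem fderiv_kernel (m : ℕ) {ε : ℝ} (hε : ε ≠ 0) (x w : Space N) :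
    fderiv ℝ (kernel m ε) x w = -(2 * m) * (kernel (m + 1) ε x * inner ℝ x w) := by
  have h1 : HasFDerivAt (fun x : Space N => ‖x‖ ^ 2 + ε ^ 2) (2 • innerSL ℝ x) x :=
    ((hasStrictFDerivAt_norm_sq x).hasFDerivAt).add_const _
  have h0 : ‖x‖ ^ 2 + ε ^ 2 ≠ 0 := by positivity
  have h2 : HasFDerivAt (kernel m ε) _ x :=
    ((hasDerivAt_inv (pow_ne_zero m h0)).comp_hasFDerivAt x (h1.pow m))
  rw [h2.fderiv]
  rcases m with _ | m
  · simp
  · simp [kernel]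
    field_simp
    ring

/-- The gradient of `kernel m ε` is square integrable. -/
theorem memLp_kernel_smul {m : ℕ} (hm : N < 4 * m) {ε : ℝ} (hε : ε ≠ 0) :
    MemLp (fun x : Space N => kernel (m + 1) ε x • x) 2 volume := by
  refine (memLp_kernel hm hε).of_le_mul (c := (2 * |ε|)⁻¹) (by
    have := (contDiff_kernel (N := N) (m + 1) hε).continuous
    fun_prop) (ae_of_all _ fun x => ?_)
  have hε' : 0 < |ε| := abs_pos.2 hε
  rw [norm_smul, Real.norm_of_nonneg (kernel_pos _ hε x).le,
    Real.norm_of_nonneg (kernel_pos _ hε x).le, kernel, kernel, pow_succ, mul_inv, mul_assoc,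
    mul_comm _⁻¹ (_ * _)]
  refine mul_le_mul_of_nonneg_right ?_ (by positivity)
  rw [inv_mul_le_iff₀ (by positivity), ← div_eq_mul_inv, le_div_iff₀ (by positivity)]
  nlinarith [sq_nonneg (‖x‖ - |ε|), sq_abs ε]

/-- The difference of two of the slowly decaying kernels decays one power faster. -/
theorem kernel_sub_kernel_le (m : ℕ) (x : Space N) :
    kernel m 1 x - kernel m 2 x ≤ 3 * m * kernel (m + 1) 1 x := by
  simp only [kernel]
  set a : ℝ := ‖x‖ ^ 2 + 1 ^ 2 with ha
  have ha0 : 0 < a := by positivity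
  have hb : ‖x‖ ^ 2 + 2 ^ 2 = a + 3 := by rw [ha]; ring
  rw [hb]
  have h1 : (1 : ℝ) + m * (-(3 / (a + 3))) ≤ (a / (a + 3)) ^ m := by
    have := one_add_mul_le_pow (a := -(3 / (a + 3))) (by
      have : 3 / (a + 3) ≤ 1 := by rw [div_le_one (by positivity)]; linarith
      linarith) m
    refine this.trans_eq ?_
    congr 1
    field_simp
    ring
  have h2 : ((a + 3) ^ m)⁻¹ = (a ^ m)⁻¹ * (a / (a + 3)) ^ m := by
    rw [div_pow]; field_simp
  have h3 : 3 / (a + 3) ≤ 3 * a⁻¹ := by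
    rw [← div_eq_mul_inv]; gcongr; linarith
  have h4 : (0 : ℝ) ≤ m := Nat.cast_nonneg m
  rw [h2, pow_succ, mul_inv]
  have h5 : 0 ≤ (a ^ m)⁻¹ := by positivity
  have h6 : 1 - (a / (a + 3)) ^ m ≤ m * (3 * a⁻¹) := by nlinarith
  calc (a ^ m)⁻¹ - (a ^ m)⁻¹ * (a / (a + 3)) ^ m = (a ^ m)⁻¹ * (1 - (a / (a + 3)) ^ m) := by ring
    _ ≤ (a ^ m)⁻¹ * (m * (3 * a⁻¹)) := mul_le_mul_of_nonneg_left h6 h5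
    _ = _ := by ring

theorem kernel_sub_kernel_pos {m : ℕ} (hm : m ≠ 0) (x : Space N) :
    0 < kernel m 1 x - kernel m 2 x := by
  simp only [kernel]
  rw [sub_pos]
  refine inv_strictAnti₀ (by positivity) (pow_lt_pow_left₀ ?_ (by positivity) hm)
  norm_num

theorem integrable_kernel_sub_kernel {m : ℕ} (hm : m ≠ 0) (hN : N < 2 * (m + 1)) :
    Integrable (fun x : Space N => kernel m 1 x - kernel m 2 x) := by
  refine ((integrable_kernel hN one_ne_zero).const_mul (3 * (m : ℝ))).mono'
    (((contDiff_kernel m one_ne_zero).continuous.sub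
      (contDiff_kernel m two_ne_zero).continuous).aestronglyMeasurable) (ae_of_all _ fun x => ?_)
  rw [Real.norm_of_nonneg (kernel_sub_kernel_pos hm x).le]
  exact kernel_sub_kernel_le m x

theorem integral_ne_zero_of_pos {T : Space N → ℝ} (hT : Integrable T) (h : ∀ x, 0 < T x) :
    ∫ x, T x ≠ 0 := by
  refine ((integral_pos_iff_support_of_nonneg (fun x => (h x).le) hT).2 ?_).ne'
  have : Function.support T = Set.univ := Set.eq_univ_of_forall fun x => (h x).ne'
  rw [this]
  exact isOpen_univ.measure_pos volume Set.univ_nonempty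

end Kernels

/-! ### Orthogonality to the translates of the kernels -/

section Orthogonality

variable {N : ℕ}

theorem exists_norm_mollify_le {G : Type*} [NormedAddCommGroup G] [NormedSpace ℝ G]
    {ρ : Space N → ℝ} (hρ : IsTestFunction ρ) {F : Space N → G} (hF : MemLp F 2 volume) :
    ∃ C : ℝ, ∀ y, ‖mollify ρ F y‖ ≤ C := by
  have hfin : eLpNorm ρ 2 volume * eLpNorm F 2 volume < ⊤ :=
    ENNReal.mul_lt_top (hρ.memLp 2).2 hF.2
  refine ⟨(eLpNorm ρ 2 volume * eLpNorm F 2 volume).toReal, fun y => ?_⟩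
  rw [← toReal_enorm]
  exact ENNReal.toReal_mono hfin.ne (enorm_mollify_le hρ hF.1 y)

theorem integral_kernel_mul_comp_smul (k : ℕ) {ε : ℝ} (hε : 0 < ε) (κ : ℝ) (f : Space N → ℝ)
    (h : ∫ x, f x * kernel k (ε * κ) x = 0) : ∫ x, kernel k κ x * f (ε • x) = 0 := by
  have h1 := Measure.integral_comp_smul (volume : Measure (Space N))
    (fun x => f x * kernel k (ε * κ) x) ε
  rw [h, smul_zero] at h1
  simp_rw [kernel_smul] at h1
  have h2 : (fun x : Space N => f (ε • x) * ((ε ^ (2 * k))⁻¹ * kernel k κ x))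
      = fun x => (ε ^ (2 * k))⁻¹ * (kernel k κ x * f (ε • x)) := by ext x; ring
  rw [h2, integral_const_mul] at h1
  exact (mul_eq_zero.1 h1).resolve_left (by positivity)

theorem integrable_kernel_mul_comp_smul (k : ℕ) {ε : ℝ} (hε : 0 < ε) (κ : ℝ) (f : Space N → ℝ)
    (h : Integrable fun x => f x * kernel k (ε * κ) x) :
    Integrable fun x => kernel k κ x * f (ε • x) := by
  have h1 := (h.comp_smul hε.ne').const_mul (ε ^ (2 * k))
  refine h1.congr (ae_of_all _ fun x => ?_)
  simp only [kernel_smul]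
  field_simp

/-- The translates and dilations of an integrable kernel span a dense subspace of `L²`. -/
theorem ae_eq_zero_of_integral_mul_kernel_eq_zero {k : ℕ} (hk : N < 2 * k) {Z : Space N → ℝ}
    (hZ : MemLp Z 2 volume)
    (h : ∀ (p : Space N) (ε : ℝ), 0 < ε → ∫ x, Z x * kernel k ε (x - p) = 0) :
    Z =ᵐ[volume] 0 := by
  refine ae_eq_zero_of_integral_contDiff_smul_eq_zero (hZ.locallyIntegrable (by norm_num))
    fun g hg hgs => ?_
  have hρ : IsTestFunction (fun x => g (0 - x)) := IsTestFunction.comp_sub_left ⟨hg, hgs⟩ 0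
  have hU : ∫ x, g x • Z x = mollify (fun x => g (0 - x)) Z 0 := by
    simp [mollify]
  rw [hU]
  obtain ⟨C, hC⟩ := exists_norm_mollify_le hρ hZ
  refine eq_zero_of_integral_mul_comp_smul_eq_zero (integrable_kernel hk one_ne_zero)
    (integral_ne_zero_of_pos (integrable_kernel hk one_ne_zero) (kernel_pos k one_ne_zero))
    (contDiff_mollify hρ (hZ.locallyIntegrable (by norm_num))).continuous hC fun ε hε => ?_
  refine integral_kernel_mul_comp_smul k hε 1 _ ?_
  rw [mul_one]
  have := integral_inner_mollify_eq_zero hρ hZ (memLp_kernel (k := k) (by omega) hε.ne')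
    fun p => by
      rw [← h p ε hε]
      refine integral_congr_ae (ae_of_all _ fun x => ?_)
      simp [mul_comm]
  rw [← this]
  refine integral_congr_ae (ae_of_all _ fun x => ?_)
  simp [mul_comm]

theorem mollify_apply {ρ : Space N → ℝ} (hρ : IsTestFunction ρ) {Z : Space N → Space N}
    (hZ : MemLp Z 2 volume) (y : Space N) (j : Fin N) :
    mollify ρ Z y j = mollify ρ (fun x => Z x j) y := by
  rw [← inner_stdVec, inner_mollify hρ (hZ.locallyIntegrable (by norm_num))]
  simp

theorem memLp_apply {Z : Space N → Space N} (hZ : MemLp Z 2 volume) (j : Fin N) :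
    MemLp (fun x => Z x j) 2 volume := by
  simpa using hZ.inner_const (𝕜 := ℝ) (stdVec j)

theorem inner_eq_sum_mul (x y : Space N) : inner ℝ x y = ∑ j, x j * y j := by
  simp [PiLp.inner_apply, mul_comm]

/-- A field orthogonal to the gradients of all `(|x - p|² + ε²)⁻ᵐ` is divergence free. -/
theorem sum_mollify_fderiv_eq_zero {m : ℕ} (hm : m ≠ 0) (hN : N = 2 * m + 1)
    {Z : Space N → Space N} (hZ : MemLp Z 2 volume)
    (h : ∀ (p : Space N) (ε : ℝ), 0 < ε →
      ∫ x, (inner ℝ (Z x) (kernel (m + 1) ε (x - p) • (x - p)) : ℝ) = 0)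
    {ρ : Space N → ℝ} (hρ : IsTestFunction ρ) (y : Space N) :
    ∑ j, mollify (fun x => fderiv ℝ ρ x (stdVec j)) (fun x => Z x j) y = 0 := by
  have hzL : ∀ j, LocallyIntegrable (fun x => Z x j) (volume : Measure (Space N)) := fun j =>
    (memLp_apply hZ j).locallyIntegrable (by norm_num)
  have key : ∀ {ρ : Space N → ℝ}, IsTestFunction ρ →
      ∑ j, mollify (fun x => fderiv ℝ ρ x (stdVec j)) (fun x => Z x j) 0 = 0 := by
    intro ρ hρ
    set f : Space N → ℝ := fun y =>
      ∑ j, mollify (fun x => fderiv ℝ ρ x (stdVec j)) (fun x => Z x j) y with hf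
    have hprod : ∀ {ρ : Space N → ℝ} (_ : IsTestFunction ρ) {V : Space N → ℝ}
        (_ : MemLp V 2 volume) (j : Fin N),
        Integrable fun y => mollify ρ (fun x => Z x j) y * V y := by
      intro ρ hρ V hV j
      refine (integrable_inner_mollify hρ (memLp_apply hZ j) hV).congr (ae_of_all _ fun x => ?_)
      simp [mul_comm]
    have hQ : ∀ ε : ℝ, 0 < ε → MemLp (kernel m ε : Space N → ℝ) 2 volume := fun ε hε =>
      memLp_kernel (by omega) hε.ne'
    have hQ' : ∀ ε : ℝ, 0 < ε → MemLp (fun x : Space N => kernel (m + 1) ε x • x) 2 volume :=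
      fun ε hε => memLp_kernel_smul (by omega) hε.ne'
    have hfQ : ∀ ε : ℝ, 0 < ε → Integrable fun x => f x * kernel m ε x := by
      intro ε hε
      simp_rw [hf, Finset.sum_mul]
      exact integrable_finsetSum _ fun j _ => hprod (hρ.fderiv_apply _) (hQ ε hε) j
    have hfQ0 : ∀ ε : ℝ, 0 < ε → ∫ x, f x * kernel m ε x = 0 := by
      intro ε hε
      have h1 := integral_inner_mollify_eq_zero hρ hZ (hQ' ε hε) fun p => h p ε hε
      have hcomp : ∀ j, Integrable fun x : Space N =>
          mollify ρ (fun x => Z x j) x * (kernel (m + 1) ε x • x) j := fun j =>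
        hprod hρ (memLp_apply (hQ' ε hε) j) j
      simp_rw [inner_eq_sum_mul, mollify_apply hρ hZ] at h1
      rw [integral_finsetSum _ fun j _ => hcomp j] at h1
      have h2 : ∀ j, ∫ x, mollify (fun x => fderiv ℝ ρ x (stdVec j)) (fun x => Z x j) x
          * kernel m ε x = (2 * m) *
            ∫ x, mollify ρ (fun x => Z x j) x * (kernel (m + 1) ε x • x) j := by
        intro j
        have hd : ∀ x : Space N, fderiv ℝ (kernel m ε) x (stdVec j)
            = -(2 * m) * (kernel (m + 1) ε x • x) j := by
          intro x
          rw [fderiv_kernel m hε.ne', inner_stdVec]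
          simp
        have h3 := integral_mul_fderiv_eq_neg_fderiv_mul_of_integrable (μ := volume)
          (f := mollify ρ (fun x => Z x j)) (g := kernel m ε) (v := stdVec j)
          (by
            simp_rw [fderiv_mollify hρ (hzL j)]
            exact hprod (hρ.fderiv_apply _) (hQ ε hε) j)
          (by
            simp_rw [hd, mul_left_comm]
            exact (hcomp j).const_mul _)
          (hprod hρ (hQ ε hε) j)
          (fun x _ => (contDiff_mollify hρ (hzL j)).differentiable (by simp) x)
          (fun x _ => (contDiff_kernel m hε.ne').differentiable one_ne_zero x)
        simp_rw [fderiv_mollify hρ (hzL j), hd, mul_left_comm _ (-(2 * (m : ℝ)))] at h3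
        rw [integral_const_mul] at h3
        linarith
      simp_rw [hf, Finset.sum_mul]
      rw [integral_finsetSum _ fun j _ => hprod (hρ.fderiv_apply _) (hQ ε hε) j]
      simp_rw [h2]
      rw [← Finset.mul_sum, h1, mul_zero]
    have hfc : Continuous f := continuous_finsetSum _ fun j _ =>
      (contDiff_mollify (hρ.fderiv_apply _) (hzL j)).continuous
    choose C hC using fun j => exists_norm_mollify_le (hρ.fderiv_apply (stdVec j))
      (memLp_apply hZ j)
    -- `kernel m 1` itself is not integrable, so a difference of two scales is dilated instead.
    have hT := integrable_kernel_sub_kernel (N := N) hm (by omega)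
    refine eq_zero_of_integral_mul_comp_smul_eq_zero hT
      (integral_ne_zero_of_pos hT (kernel_sub_kernel_pos hm)) hfc (C := ∑ j, C j)
      (fun x => (norm_sum_le _ _).trans (Finset.sum_le_sum fun j _ => hC j x)) fun ε hε => ?_
    simp_rw [sub_mul]
    rw [integral_sub, integral_kernel_mul_comp_smul m hε 1, integral_kernel_mul_comp_smul m hε 2,
      sub_zero]
    · exact hfQ0 _ (by positivity)
    · exact hfQ0 _ (by positivity)
    · exact integrable_kernel_mul_comp_smul m hε 1 _ (hfQ _ (by positivity))
    · exact integrable_kernel_mul_comp_smul m hε 2 _ (hfQ _ (by positivity))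
  -- The value at `y` is the value at the origin for a translated kernel.
  have hρy : IsTestFunction (fun x => ρ (y + x)) :=
    ⟨hρ.smooth.comp (contDiff_const.add contDiff_id),
      hρ.hasCompactSupport.comp_homeomorph (Homeomorph.addLeft y)⟩
  have := key hρy
  simpa [mollify, fderiv_comp_add_left, ← sub_eq_add_neg] using this

end Orthogonality

/-! ### Gradients are orthogonal to divergence free fields -/

section DivergenceFree

variable {N : ℕ}

/-- The tails of a square integrable function tend to zero in `L²`. -/
theorem tendsto_eLpNorm_restrict_norm_ge {G : Type*} [NormedAddCommGroup G] {W : Space N → G}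
    (hW : MemLp W 2 volume) :
    Tendsto (fun n : ℕ => eLpNorm W 2 (volume.restrict {x : Space N | (n : ℝ) + 1 ≤ ‖x‖})) atTop
      (𝓝 0) := by
  have hS : ∀ n : ℕ, MeasurableSet {x : Space N | (n : ℝ) + 1 ≤ ‖x‖} := fun n =>
    measurableSet_le measurable_const measurable_norm
  have hfin : ∫⁻ x, ‖W x‖ₑ ^ (2 : ℝ) ≠ ⊤ := by
    have := hW.2
    rw [eLpNorm_lt_top_iff_lintegral_rpow_enorm_lt_top (by norm_num) (by norm_num)] at this
    simpa using this.ne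
  have h1 : Tendsto (fun n : ℕ => ∫⁻ x, {x : Space N | (n : ℝ) + 1 ≤ ‖x‖}.indicator
      (fun x => ‖W x‖ₑ ^ (2 : ℝ)) x) atTop (𝓝 (∫⁻ _ : Space N, 0)) := by
    refine tendsto_lintegral_of_dominated_convergence' (fun x => ‖W x‖ₑ ^ (2 : ℝ))
      (fun n => (hW.1.enorm.pow_const _).indicator (hS n))
      (fun n => ae_of_all _ fun x => Set.indicator_le_self _ _ x) hfin (ae_of_all _ fun x => ?_)
    refine tendsto_const_nhds.congr' ?_
    filter_upwards [tendsto_natCast_atTop_atTop.eventually (eventually_gt_atTop ‖x‖)] with n hn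
    rw [Set.indicator_of_notMem]
    simp only [Set.mem_ofPred_eq, not_le]
    linarith
  rw [lintegral_zero] at h1
  have h2 := h1.ennrpow_const (1 / 2)
  rw [ENNReal.zero_rpow_of_pos (by norm_num)] at h2
  refine h2.congr fun n => ?_
  rw [lintegral_indicator (hS n),
    eLpNorm_eq_lintegral_rpow_enorm_toReal (by norm_num) (by norm_num)]
  simp

/-- By Hölder's inequality, the `L²` norm of `f ∈ L^{2N/(N-2)}` on a ball grows at most linearly in
the radius. -/
theorem exists_eLpNorm_restrict_closedBall_le (hN : 3 ≤ N) {f : Space N → ℝ}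
    (hf : MemLp f (ENNReal.ofReal (2 * (N : ℝ) / ((N : ℝ) - 2))) volume) :
    ∃ K : ℝ≥0∞, K ≠ ⊤ ∧ ∀ r : ℝ, 0 ≤ r →
      eLpNorm f 2 (volume.restrict (Metric.closedBall 0 r)) ≤ K * ENNReal.ofReal r := by
  have hN3 : (3 : ℝ) ≤ N := by exact_mod_cast hN
  set p : ℝ := 2 * (N : ℝ) / ((N : ℝ) - 2) with hp
  have hp2 : 2 ≤ p := by rw [hp, le_div_iff₀ (by linarith)]; linarith
  set c := volume (Metric.ball (0 : Space N) 1)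
  refine ⟨eLpNorm f (ENNReal.ofReal p) volume * c ^ (1 / (N : ℝ)),
    ENNReal.mul_ne_top hf.2.ne (ENNReal.rpow_ne_top_of_nonneg (by positivity)
      measure_ball_lt_top.ne), fun r hr => ?_⟩
  have h1 := eLpNorm_le_eLpNorm_mul_rpow_measure_univ (p := 2) (q := ENNReal.ofReal p)
    (f := f) (μ := volume.restrict (Metric.closedBall 0 r))
    (by rw [show (2 : ℝ≥0∞) = ENNReal.ofReal 2 by norm_num]; exact ENNReal.ofReal_le_ofReal hp2)
    hf.1.restrict
  refine h1.trans ?_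
  have he : 1 / (2 : ℝ≥0∞).toReal - 1 / (ENNReal.ofReal p).toReal = 1 / (N : ℝ) := by
    rw [ENNReal.toReal_ofReal (by linarith), ENNReal.toReal_ofNat, hp]
    field_simp
    ring
  have hv : (volume (Metric.closedBall (0 : Space N) r)) ^ (1 / (N : ℝ))
      = ENNReal.ofReal r * c ^ (1 / (N : ℝ)) := by
    rw [Measure.addHaar_closedBall _ _ hr, ENNReal.mul_rpow_of_nonneg _ _ (by positivity),
      ENNReal.ofReal_rpow_of_nonneg (by positivity) (by positivity), finrank_euclideanSpace,
      Fintype.card_fin, one_div, Real.pow_rpow_inv_natCast hr (by omega)]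
  rw [he, Measure.restrict_apply_univ, hv, mul_comm (ENNReal.ofReal r), ← mul_assoc]
  gcongr
  exact Measure.restrict_le_self

/-- A weak gradient `F = ∇f` tested against a smooth field without divergence, after a cutoff. -/
theorem HasWeakGradient.integral_mul_fderiv_cutoff {f : Space N → ℝ} {F : Space N → Space N}
    (hfF : HasWeakGradient f F) {W : Space N → Space N} (hW : ContDiff ℝ ∞ W)
    (hdiv : ∀ y, ∑ j, fderiv ℝ (fun x => W x j) y (stdVec j) = 0) {χ : Space N → ℝ}
    (hχ : IsTestFunction χ) :
    ∫ x, f x * fderiv ℝ χ x (W x) = - ∫ x, χ x * inner ℝ (F x) (W x) := by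
  have hWj : ∀ j, ContDiff ℝ ∞ fun x => W x j := fun j => by
    simpa using hW.inner ℝ (contDiff_const (c := stdVec j))
  have htest : ∀ j, IsTestFunction fun x => χ x * W x j := fun j =>
    ⟨hχ.smooth.mul (hWj j), hχ.hasCompactSupport.mul_right⟩
  have hd : ∀ j x, fderiv ℝ (fun x => χ x * W x j) x (stdVec j)
      = χ x * fderiv ℝ (fun x => W x j) x (stdVec j) + fderiv ℝ χ x (stdVec j) * W x j := by
    intro j x
    rw [fderiv_fun_mul (hχ.differentiable x) ((hWj j).differentiable (by simp) x)]
    simp [mul_comm]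
  have h1 : ∀ j, Integrable fun x => f x * fderiv ℝ (fun x => χ x * W x j) x (stdVec j) := by
    intro j
    have := hfF.locallyIntegrable.integrable_smul_left_of_hasCompactSupport
      ((htest j).fderiv_apply (stdVec j)).continuous ((htest j).fderiv_apply _).hasCompactSupport
    simpa [mul_comm] using this
  have h2 : ∀ j, Integrable fun x => χ x * W x j * inner ℝ (F x) (stdVec j) := by
    intro j
    have h3 := (hfF.locallyIntegrable_gradient.integrable_smul_left_of_hasCompactSupport
      (htest j).continuous (htest j).hasCompactSupport).inner_const (𝕜 := ℝ) (stdVec j)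
    simpa [real_inner_smul_left] using h3
  have h3 : ∀ x, f x * fderiv ℝ χ x (W x)
      = ∑ j, f x * fderiv ℝ (fun x => χ x * W x j) x (stdVec j) := by
    intro x
    simp_rw [hd]
    rw [← Finset.mul_sum, Finset.sum_add_distrib, ← Finset.mul_sum, hdiv, mul_zero, zero_add,
      sum_apply_stdVec_mul]
  have h4 : ∀ x, χ x * inner ℝ (F x) (W x) = ∑ j, χ x * W x j * inner ℝ (F x) (stdVec j) := by
    intro x
    rw [inner_eq_sum_mul, Finset.mul_sum]
    refine Finset.sum_congr rfl fun j _ => ?_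
    rw [inner_stdVec]; ring
  simp_rw [h3, h4]
  rw [integral_finsetSum _ fun j _ => h1 j, integral_finsetSum _ fun j _ => h2 j,
    ← Finset.sum_neg_distrib]
  exact Finset.sum_congr rfl fun j _ => hfF.integral_eq _ (htest j) _

/-- The gradient of a function of `Ḣ¹` is orthogonal to smooth divergence free fields in `L²`: the
cutoffs `χ(x / (n + 1))` have gradients of size `1 / (n + 1)` on `n + 1 ≤ |x| ≤ 2 (n + 1)`, which
compensates the growth of the `L²` norm of `f` on balls, and the `L²` norm of the field on that
region tends to zero. -/
theorem MemHomogeneousSobolev.integral_inner_eq_zero_of_contDiff (hN : 3 ≤ N) {f : Space N → ℝ}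
    {F : Space N → Space N} (hf : MemHomogeneousSobolev f F) {W : Space N → Space N}
    (hW : ContDiff ℝ ∞ W) (hW2 : MemLp W 2 volume)
    (hdiv : ∀ y, ∑ j, fderiv ℝ (fun x => W x j) y (stdVec j) = 0) :
    ∫ x, (inner ℝ (F x) (W x) : ℝ) = 0 := by
  let b : ContDiffBump (0 : Space N) := ⟨1, 2, one_pos, one_lt_two⟩
  have hb : IsTestFunction (b : Space N → ℝ) := ⟨b.contDiff, b.hasCompactSupport⟩
  set χ : ℕ → Space N → ℝ := fun n x => b (((n : ℝ) + 1)⁻¹ • x) with hχdef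
  have hn0 : ∀ n : ℕ, (0 : ℝ) < (n : ℝ) + 1 := fun n => by positivity
  have hχ : ∀ n, IsTestFunction (χ n) := fun n =>
    ⟨hb.smooth.comp (contDiff_const_smul _),
      hb.hasCompactSupport.comp_homeomorph (Homeomorph.smulOfNeZero _ (inv_pos.2 (hn0 n)).ne')⟩
  obtain ⟨C, hC⟩ := (hb.smooth.continuous_fderiv (by simp)).bounded_above_of_compact_support
    (hb.hasCompactSupport.fderiv (𝕜 := ℝ))
  have hdχ : ∀ n x, fderiv ℝ (χ n) x = ((n : ℝ) + 1)⁻¹ • fderiv ℝ b (((n : ℝ) + 1)⁻¹ • x) :=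
    fun n x => fderiv_comp_smul _
  have hlim1 : Tendsto (fun n => ∫ x, χ n x * inner ℝ (F x) (W x)) atTop
      (𝓝 (∫ x, (inner ℝ (F x) (W x) : ℝ))) := by
    have hint := integrable_inner hf.memLp_gradient hW2
    refine tendsto_integral_of_dominated_convergence (fun x => ‖(inner ℝ (F x) (W x) : ℝ)‖)
      (fun n => (hχ n).continuous.aestronglyMeasurable.mul hint.1) hint.norm
      (fun n => ae_of_all _ fun x => ?_) (ae_of_all _ fun x => ?_)
    · rw [norm_mul, Real.norm_of_nonneg b.nonneg]
      exact mul_le_of_le_one_left (norm_nonneg _) b.le_one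
    · refine tendsto_const_nhds.congr' ?_
      filter_upwards [tendsto_natCast_atTop_atTop.eventually (eventually_gt_atTop ‖x‖)] with n hn
      have : χ n x = 1 := by
        refine b.one_of_mem_closedBall ?_
        rw [mem_closedBall_zero_iff, norm_smul, Real.norm_of_nonneg (inv_pos.2 (hn0 n)).le,
          inv_mul_le_iff₀ (hn0 n)]
        change ‖x‖ ≤ ((n : ℝ) + 1) * 1
        linarith
      rw [this, one_mul]
  obtain ⟨K, hK, hKle⟩ := exists_eLpNorm_restrict_closedBall_le hN hf.memLp
  have hbound : ∀ n : ℕ, ‖∫ x, f x * fderiv ℝ (χ n) x (W x)‖ₑ ≤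
      (ENNReal.ofReal C * (K * 2)) *
        eLpNorm W 2 (volume.restrict {x : Space N | (n : ℝ) + 1 ≤ ‖x‖}) := by
    intro n
    set S := {x : Space N | (n : ℝ) + 1 ≤ ‖x‖} with hS
    set B := Metric.closedBall (0 : Space N) (2 * ((n : ℝ) + 1)) with hB
    have hzero : ∀ x, x ∉ S ∩ B → f x * fderiv ℝ (χ n) x (W x) = 0 := by
      intro x hx
      have hd0 : fderiv ℝ b (((n : ℝ) + 1)⁻¹ • x) = 0 := by
        rw [Set.mem_inter_iff, not_and_or] at hx
        rcases hx with hx | hx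
        · have hx' : ‖((n : ℝ) + 1)⁻¹ • x‖ < 1 := by
            rw [norm_smul, Real.norm_of_nonneg (inv_pos.2 (hn0 n)).le, inv_mul_lt_iff₀ (hn0 n),
              mul_one]
            simpa [hS] using hx
          have : (b : Space N → ℝ) =ᶠ[𝓝 (((n : ℝ) + 1)⁻¹ • x)] fun _ => 1 := by
            filter_upwards [Metric.isOpen_ball.mem_nhds (mem_ball_zero_iff.2 hx')] with z hz
            exact b.one_of_mem_closedBall (Metric.ball_subset_closedBall hz)
          rw [this.fderiv_eq]
          simp
        · have hx' : 2 < ‖((n : ℝ) + 1)⁻¹ • x‖ := by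
            rw [norm_smul, Real.norm_of_nonneg (inv_pos.2 (hn0 n)).le, lt_inv_mul_iff₀ (hn0 n),
              mul_comm]
            simpa [hB] using hx
          have : (b : Space N → ℝ) =ᶠ[𝓝 (((n : ℝ) + 1)⁻¹ • x)] fun _ => 0 := by
            filter_upwards [(isOpen_lt continuous_const continuous_norm).mem_nhds hx'] with z hz
            exact b.zero_of_le_dist (by rw [dist_zero_right]; exact le_of_lt hz)
          rw [this.fderiv_eq]
          simp
      rw [hdχ, hd0]
      simp
    rw [← setIntegral_eq_integral_of_forall_compl_eq_zero hzero]
    refine (enorm_integral_le_lintegral_enorm _).trans ?_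
    rw [← eLpNorm_one_eq_lintegral_enorm]
    have hpt : ∀ x, ‖f x * fderiv ℝ (χ n) x (W x)‖ ≤ (C * ((n : ℝ) + 1)⁻¹) * ‖f x • W x‖ := by
      intro x
      have h1 : ‖fderiv ℝ (χ n) x (W x)‖ ≤ ((n : ℝ) + 1)⁻¹ * C * ‖W x‖ := by
        refine (ContinuousLinearMap.le_opNorm _ _).trans ?_
        rw [hdχ, norm_smul, Real.norm_of_nonneg (inv_pos.2 (hn0 n)).le]
        have := hC (((n : ℝ) + 1)⁻¹ • x)
        have := hn0 n
        gcongr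
      rw [norm_mul, norm_smul]
      refine (mul_le_mul_of_nonneg_left h1 (norm_nonneg _)).trans_eq (by ring)
    refine (eLpNorm_le_mul_eLpNorm_of_ae_le_mul (ae_of_all _ hpt) 1).trans ?_
    have h2 := eLpNorm_smul_le_mul_eLpNorm (p := 2) (q := 2) (r := 1)
      (μ := volume.restrict (S ∩ B)) hW2.1.restrict hf.memLp.1.restrict
    have h3 : eLpNorm f 2 (volume.restrict (S ∩ B)) ≤ K * ENNReal.ofReal (2 * ((n : ℝ) + 1)) :=
      (eLpNorm_mono_measure _ (Measure.restrict_mono Set.inter_subset_right le_rfl)).trans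
        (hKle _ (by positivity))
    have h4 : eLpNorm W 2 (volume.restrict (S ∩ B)) ≤ eLpNorm W 2 (volume.restrict S) :=
      eLpNorm_mono_measure _ (Measure.restrict_mono Set.inter_subset_left le_rfl)
    have hC0 : 0 ≤ C := (norm_nonneg _).trans (hC 0)
    calc _ ≤ ENNReal.ofReal (C * ((n : ℝ) + 1)⁻¹) * ((K * ENNReal.ofReal (2 * ((n : ℝ) + 1)))
          * eLpNorm W 2 (volume.restrict S)) := by
          refine mul_le_mul_right (h2.trans ?_) _
          exact mul_le_mul' h3 h4
      _ = ENNReal.ofReal C * (K * 2)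
          * (ENNReal.ofReal (((n : ℝ) + 1)⁻¹) * ENNReal.ofReal ((n : ℝ) + 1))
          * eLpNorm W 2 (volume.restrict S) := by
          rw [ENNReal.ofReal_mul hC0, ENNReal.ofReal_mul zero_le_two, ENNReal.ofReal_ofNat]
          ring
      _ = _ := by
          rw [← ENNReal.ofReal_mul (inv_pos.2 (hn0 n)).le, inv_mul_cancel₀ (hn0 n).ne']
          simp
  have hlim2 : Tendsto (fun n => ∫ x, f x * fderiv ℝ (χ n) x (W x)) atTop (𝓝 0) := by
    have h := ENNReal.Tendsto.const_mul (tendsto_eLpNorm_restrict_norm_ge hW2)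
      (a := ENNReal.ofReal C * (K * 2)) (Or.inr (ENNReal.mul_ne_top ENNReal.ofReal_ne_top
        (ENNReal.mul_ne_top hK ENNReal.ofNat_ne_top)))
    rw [mul_zero] at h
    rw [tendsto_zero_iff_enorm_tendsto_zero]
    exact tendsto_of_tendsto_of_tendsto_of_le_of_le tendsto_const_nhds h (fun _ => zero_le) hbound
  simp_rw [hf.hasWeakGradient.integral_mul_fderiv_cutoff hW hdiv (hχ _)] at hlim2
  have := tendsto_nhds_unique hlim1.neg hlim2
  simpa using this

end DivergenceFree

/-! ### Density of the data with a radiation field -/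

section Density

variable {N : ℕ} {m : ℕ}

theorem tendsto_integral_inner_of_eLpNorm_sub {H : Type*} [NormedAddCommGroup H]
    [InnerProductSpace ℝ H] {F Z : Space N → H} {W : ℕ → Space N → H} (hF : MemLp F 2 volume)
    (hZ : MemLp Z 2 volume) (hW : ∀ n, MemLp (W n) 2 volume)
    (h : Tendsto (fun n => eLpNorm (W n - Z) 2 volume) atTop (𝓝 0)) :
    Tendsto (fun n => ∫ x, (inner ℝ (F x) (W n x) : ℝ)) atTop
      (𝓝 (∫ x, (inner ℝ (F x) (Z x) : ℝ))) := by
  have key : ∀ {V : Space N → H} (hV : MemLp V 2 volume),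
      (inner ℝ (hF.toLp F) (hV.toLp V) : ℝ) = ∫ x, (inner ℝ (F x) (V x) : ℝ) := by
    intro V hV
    rw [L2.inner_def]
    refine integral_congr_ae ?_
    filter_upwards [hF.coeFn_toLp, hV.coeFn_toLp] with x h1 h2
    rw [h1, h2]
  have hlim : Tendsto (fun n => (hW n).toLp (W n)) atTop (𝓝 (hZ.toLp Z)) :=
    (Lp.tendsto_Lp_iff_tendsto_eLpNorm'' _ hW _ hZ).2 h
  have := (tendsto_const_nhds (x := hF.toLp F)).inner (𝕜 := ℝ) hlim
  simpa only [key] using this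

/-- The gradients of the functions of `Ḣ¹` lie in the closed span of the gradients of the kernels
`(|x - p|² + ε²)⁻ᵐ`. -/
theorem MemHomogeneousSobolev.integral_inner_eq_zero (hm : m ≠ 0) (hN : N = 2 * m + 1)
    {f : Space N → ℝ} {F : Space N → Space N} (hf : MemHomogeneousSobolev f F)
    {Z : Space N → Space N} (hZ : MemLp Z 2 volume)
    (h : ∀ (p : Space N) (ε : ℝ), 0 < ε →
      ∫ x, (inner ℝ (Z x) (kernel (m + 1) ε (x - p) • (x - p)) : ℝ) = 0) :
    ∫ x, (inner ℝ (F x) (Z x) : ℝ) = 0 := by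
  obtain ⟨ρ, hρ, hs⟩ := exists_mollifier_seq N
  have hlim := tendsto_integral_inner_of_eLpNorm_sub hf.memLp_gradient hZ
    (fun n => memLp_mollify (hρ n) hZ) (tendsto_eLpNorm_mollify_sub hρ hs hZ)
  have h0 : ∀ n, ∫ x, (inner ℝ (F x) (mollify (ρ n) Z x) : ℝ) = 0 := by
    intro n
    refine hf.integral_inner_eq_zero_of_contDiff (by omega)
      (contDiff_mollify (hρ n).toIsTestFunction (hZ.locallyIntegrable (by norm_num)))
      (memLp_mollify (hρ n) hZ) fun y => ?_
    simp_rw [mollify_apply (hρ n).toIsTestFunction hZ]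
    rw [← sum_mollify_fderiv_eq_zero hm hN hZ h (hρ n).toIsTestFunction y]
    refine Finset.sum_congr rfl fun j _ => ?_
    exact fderiv_mollify (hρ n).toIsTestFunction
      ((memLp_apply hZ j).locallyIntegrable (by norm_num)) y _
  simp_rw [h0] at hlim
  exact tendsto_nhds_unique hlim tendsto_const_nhds

/-- `(F, g)` are, almost everywhere, the values at time `0` of a solution `(D, v)` of the
first-order system that has a radiation field. -/
def IsRadiative (m : ℕ) (F : Space N → Space N) (g : Space N → ℝ) : Prop :=
  ∃ (D : ℝ → Space N → Space N) (v : ℝ → Space N → ℝ)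
    (r : Metric.sphere (0 : Space N) 1 → ℝ → ℝ),
    IsFirstOrderSolution D v ∧ HasRadiationField m D v r ∧ D 0 =ᵐ[volume] F ∧ v 0 =ᵐ[volume] g

theorem IsRadiative.congr {F F' : Space N → Space N} {g g' : Space N → ℝ} (h : IsRadiative m F g)
    (hF : F =ᵐ[volume] F') (hg : g =ᵐ[volume] g') : IsRadiative m F' g' := by
  obtain ⟨D, v, r, h1, h2, h3, h4⟩ := h
  exact ⟨D, v, r, h1, h2, h3.trans hF, h4.trans hg⟩

theorem IsRadiative.add {F F' : Space N → Space N} {g g' : Space N → ℝ} (h : IsRadiative m F g)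
    (h' : IsRadiative m F' g') : IsRadiative m (F + F') (g + g') := by
  obtain ⟨D, v, r, h1, h2, h3, h4⟩ := h
  obtain ⟨D', v', r', h1', h2', h3', h4'⟩ := h'
  exact ⟨_, _, _, h1.add h1', h2.add h2', h3.add h3', h4.add h4'⟩

theorem IsRadiative.const_smul {F : Space N → Space N} {g : Space N → ℝ} (h : IsRadiative m F g)
    (c : ℝ) : IsRadiative m (c • F) (c • g) := by
  obtain ⟨D, v, r, h1, h2, h3, h4⟩ := h
  exact ⟨_, _, _, h1.const_smul c, h2.const_smul c, h3.const_smul c, h4.const_smul c⟩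

theorem isRadiative_zero : IsRadiative m (0 : Space N → Space N) 0 :=
  ⟨_, _, _, IsFirstOrderSolution.zero, HasRadiationField.zero, ae_eq_rfl, ae_eq_rfl⟩

/-- At time `0` the Lorentz form is real and gives the kernels. -/
theorem inv_lorentz_zero_pow (k : ℕ) (p : Space N) (ε : ℝ) (x : Space N) :
    (lorentz p ε 0 x ^ k)⁻¹ = (kernel k ε (x - p) : ℂ) := by
  have h : lorentz p ε 0 x = ((‖x - p‖ ^ 2 + ε ^ 2 : ℝ) : ℂ) := by
    rw [lorentz]
    push_cast
    linear_combination (-(ε : ℂ) ^ 2) * Complex.I_sq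
  rw [h, kernel]
  push_cast
  rfl

theorem isRadiative_gradient (hN : N = 2 * m + 1) (p : Space N) {ε : ℝ} (hε : ε ≠ 0) :
    IsRadiative m (fun x => kernel (m + 1) ε (x - p) • (x - p)) 0 := by
  -- For real `c` the explicit solution is even in time, so its velocity vanishes at time `0`.
  refine ⟨_, _, _, isFirstOrderSolution_explicit (-1) hN p hε,
    hasRadiationField_explicit (-1) m p hε, ae_of_all _ fun x => ?_, ae_of_all _ fun x => ?_⟩
  · simp [explicitGradient, inv_lorentz_zero_pow]
  · simp [explicitVelocity, inv_lorentz_zero_pow]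

theorem isRadiative_velocity (hN : N = 2 * m + 1) (p : Space N) {ε : ℝ} (hε : ε ≠ 0) :
    IsRadiative m 0 (fun x => kernel (m + 1) ε (x - p)) := by
  -- For imaginary `c` the explicit solution is odd in time and vanishes at time `0`.
  refine ⟨_, _, _, isFirstOrderSolution_explicit (Complex.I / ε) hN p hε,
    hasRadiationField_explicit (Complex.I / ε) m p hε, ae_of_all _ fun x => ?_,
    ae_of_all _ fun x => ?_⟩
  · simp [explicitGradient, inv_lorentz_zero_pow]
  · have hε' : (ε : ℂ) ≠ 0 := by exact_mod_cast hε
    have h1 : Complex.I / ε * ((0 : ℝ) - ε * Complex.I) = 1 := by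
      rw [Complex.ofReal_zero]
      field_simp
      linear_combination (-(ε : ℂ)) * Complex.I_sq
    simp only [explicitVelocity, inv_lorentz_zero_pow, h1, one_mul, Complex.ofReal_re]

/-- The gradients in `L²` that are radiative data when the velocity vanishes. -/
def radiativeGradients (N m : ℕ) : Submodule ℝ (Lp (Space N) 2 (volume : Measure (Space N))) where
  carrier := {F | IsRadiative m F 0}
  add_mem' {F F'} h h' := (IsRadiative.add h h').congr (Lp.coeFn_add F F').symm (by simp)
  zero_mem' := isRadiative_zero.congr (Lp.coeFn_zero _ _ _).symm ae_eq_rfl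
  smul_mem' c F h := (IsRadiative.const_smul h c).congr (Lp.coeFn_smul c F).symm (by simp)

/-- The velocities in `L²` that are radiative data when the gradient vanishes. -/
def radiativeVelocities (N m : ℕ) : Submodule ℝ (Lp ℝ 2 (volume : Measure (Space N))) where
  carrier := {g | IsRadiative m 0 g}
  add_mem' {g g'} h h' := (IsRadiative.add h h').congr (by simp) (Lp.coeFn_add g g').symm
  zero_mem' := isRadiative_zero.congr ae_eq_rfl (Lp.coeFn_zero _ _ _).symm
  smul_mem' c g h := (IsRadiative.const_smul h c).congr (by simp) (Lp.coeFn_smul c g).symm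

theorem toLp_mem_closure_radiativeGradients (hm : m ≠ 0) (hN : N = 2 * m + 1)
    {f : Space N → ℝ} {F : Space N → Space N} (hf : MemHomogeneousSobolev f F) :
    hf.memLp_gradient.toLp F ∈ (radiativeGradients N m).topologicalClosure := by
  rw [← Submodule.orthogonal_orthogonal_eq_closure, Submodule.mem_orthogonal']
  intro Z hZ
  rw [Submodule.mem_orthogonal'] at hZ
  rw [L2.inner_def, ← hf.integral_inner_eq_zero hm hN (Lp.memLp Z) fun p ε hε => ?_]
  · refine integral_congr_ae ?_
    filter_upwards [hf.memLp_gradient.coeFn_toLp] with x h1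
    rw [h1]
  · have hr := isRadiative_gradient hN p hε.ne'
    have hV : MemLp (fun x : Space N => kernel (m + 1) ε (x - p) • (x - p)) 2 volume :=
      (memLp_kernel_smul (by omega) hε.ne').comp_measurePreserving
        (measurePreserving_sub_right volume p)
    have h1 := hZ (hV.toLp _) (hr.congr hV.coeFn_toLp.symm ae_eq_rfl)
    rw [L2.inner_def] at h1
    rw [← h1]
    refine integral_congr_ae ?_
    filter_upwards [hV.coeFn_toLp] with x h2
    rw [h2]

theorem mem_closure_radiativeVelocities (hN : N = 2 * m + 1)
    (g : Lp ℝ 2 (volume : Measure (Space N))) :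
    g ∈ (radiativeVelocities N m).topologicalClosure := by
  rw [← Submodule.orthogonal_orthogonal_eq_closure, Submodule.mem_orthogonal']
  intro Z hZ
  rw [Submodule.mem_orthogonal'] at hZ
  have hZ0 : Z =ᵐ[volume] 0 := by
    refine ae_eq_zero_of_integral_mul_kernel_eq_zero (k := m + 1) (by omega) (Lp.memLp Z)
      fun p ε hε => ?_
    have hr := isRadiative_velocity hN p hε.ne'
    have hV : MemLp (fun x : Space N => kernel (m + 1) ε (x - p)) 2 volume :=
      (memLp_kernel (by omega) hε.ne').comp_measurePreserving (measurePreserving_sub_right volume p)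
    have h1 := hZ (hV.toLp _) (hr.congr ae_eq_rfl hV.coeFn_toLp.symm)
    rw [L2.inner_def] at h1
    rw [← h1]
    refine integral_congr_ae ?_
    filter_upwards [hV.coeFn_toLp] with x h2
    rw [h2]
    simp [mul_comm]
  rw [Lp.ext (hZ0.trans (Lp.coeFn_zero _ _ _).symm), inner_zero_right]

/-- Every pair of data in `Ḣ¹ × L²` is a limit of data with a radiation field. -/
theorem exists_radiative_approx (hm : m ≠ 0) (hN : N = 2 * m + 1)
    {f : Space N → ℝ} {F : Space N → Space N} (hf : MemHomogeneousSobolev f F)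
    {g : Space N → ℝ} (hg : MemLp g 2 volume) {δ : ℝ≥0∞} (hδ : 0 < δ) :
    ∃ (D : ℝ → Space N → Space N) (v : ℝ → Space N → ℝ)
      (r : Metric.sphere (0 : Space N) 1 → ℝ → ℝ),
      IsFirstOrderSolution D v ∧ HasRadiationField m D v r ∧
      eLpNorm (fun x => F x - D 0 x) 2 volume < δ ∧
      eLpNorm (fun x => g x - v 0 x) 2 volume < δ := by
  obtain ⟨X, hX, hX'⟩ := EMetric.mem_closure_iff.1
    (toLp_mem_closure_radiativeGradients hm hN hf) δ hδ
  obtain ⟨Y, hY, hY'⟩ := EMetric.mem_closure_iff.1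
    (mem_closure_radiativeVelocities hN (hg.toLp g)) δ hδ
  obtain ⟨D, v, r, h1, h2, h3, h4⟩ := IsRadiative.add (m := m) hX hY
  refine ⟨D, v, r, h1, h2, ?_, ?_⟩
  · rw [Lp.edist_def] at hX'
    refine lt_of_eq_of_lt (eLpNorm_congr_ae ?_) hX'
    filter_upwards [hf.memLp_gradient.coeFn_toLp, h3] with x h5 h6
    simp [h5, h6]
  · rw [Lp.edist_def] at hY'
    refine lt_of_eq_of_lt (eLpNorm_congr_ae ?_) hY'
    filter_upwards [hg.coeFn_toLp, h4] with x h5 h6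
    simp [h5, h6]

end Density

/-! ### Passage to the limit -/

section Limit

variable {N : ℕ}

/-- Weak gradients are unique. -/
theorem HasWeakGradient.ae_eq {f f' : Space N → ℝ} {G G' : Space N → Space N}
    (h : HasWeakGradient f G) (h' : HasWeakGradient f' G') (hff' : f =ᵐ[volume] f') :
    G =ᵐ[volume] G' := by
  refine ae_eq_of_integral_contDiff_smul_eq h.locallyIntegrable_gradient
    h'.locallyIntegrable_gradient fun φ hφ hφs => ?_
  have hint : ∀ {G : Space N → Space N}, LocallyIntegrable G volume →
      Integrable fun x => φ x • G x := fun hG =>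
    hG.integrable_smul_left_of_hasCompactSupport hφ.continuous hφs
  refine ext_inner_left ℝ fun w => ?_
  rw [← integral_inner (hint h.locallyIntegrable_gradient),
    ← integral_inner (hint h'.locallyIntegrable_gradient)]
  have h1 := h.integral_eq φ ⟨hφ, hφs⟩ w
  have h2 := h'.integral_eq φ ⟨hφ, hφs⟩ w
  have h3 : ∫ x, f x * fderiv ℝ φ x w = ∫ x, f' x * fderiv ℝ φ x w := by
    refine integral_congr_ae ?_
    filter_upwards [hff'] with x hx
    rw [hx]
  simp only [real_inner_comm w] at h1 h2
  simp only [real_inner_smul_right]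
  linarith

theorem integrable_energy {D : Space N → Space N} {v : Space N → ℝ} (hD : MemLp D 2 volume)
    (hv : MemLp v 2 volume) : Integrable fun x => ‖D x‖ ^ 2 + v x ^ 2 :=
  (hD.integrable_norm_pow (by norm_num)).add hv.integrable_sq

/-- Quadratic substitute for the triangle inequality, with a factor as close to one as desired. -/
theorem norm_sq_le_one_add_mul {H : Type*} [NormedAddCommGroup H] {η : ℝ} (hη : 0 < η) (a b : H) :
    ‖a‖ ^ 2 ≤ (1 + η) * ‖b‖ ^ 2 + (1 + η⁻¹) * ‖a - b‖ ^ 2 := by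
  have h1 : ‖a‖ ≤ ‖b‖ + ‖a - b‖ := by
    simpa using norm_add_le b (a - b)
  have h2 : η⁻¹ * η = 1 := inv_mul_cancel₀ hη.ne'
  have h3 : 2 * ‖b‖ * ‖a - b‖ ≤ η * ‖b‖ ^ 2 + η⁻¹ * ‖a - b‖ ^ 2 := by
    have : 0 ≤ η⁻¹ * (η * ‖b‖ - ‖a - b‖) ^ 2 := by positivity
    have h4 : η⁻¹ * (η * ‖b‖ - ‖a - b‖) ^ 2
        = (η⁻¹ * η) * (η * ‖b‖ ^ 2 - 2 * ‖b‖ * ‖a - b‖) + η⁻¹ * ‖a - b‖ ^ 2 := by ring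
    rw [h4, h2] at this
    linarith
  nlinarith [pow_le_pow_left₀ (norm_nonneg a) h1 2]

theorem setIntegral_energy_le_one_add_mul {D D' : Space N → Space N} {v v' : Space N → ℝ}
    (hD : MemLp D 2 volume) (hv : MemLp v 2 volume) (hD' : MemLp D' 2 volume)
    (hv' : MemLp v' 2 volume) (S : Set (Space N)) {η : ℝ} (hη : 0 < η) :
    ∫ x in S, (‖D x‖ ^ 2 + v x ^ 2) ≤ (1 + η) * (∫ x in S, (‖D' x‖ ^ 2 + v' x ^ 2))
      + (1 + η⁻¹) * ∫ x in S, (‖D x - D' x‖ ^ 2 + (v x - v' x) ^ 2) := by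
  have h1 := (integrable_energy hD hv).restrict (s := S)
  have h2 := ((integrable_energy hD' hv').restrict (s := S)).const_mul (1 + η)
  have h3 := ((integrable_energy (hD.sub hD') (hv.sub hv')).restrict (s := S)).const_mul (1 + η⁻¹)
  simp only [Pi.sub_apply] at h3
  rw [← integral_const_mul, ← integral_const_mul, ← integral_add h2 h3]
  refine integral_mono h1 (h2.add h3) fun x => ?_
  have h4 := norm_sq_le_one_add_mul hη (D x) (D' x)
  have h5 := norm_sq_le_one_add_mul hη (v x) (v' x)
  simp only [Real.norm_eq_abs, sq_abs] at h5
  linarith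

theorem exteriorEnergy_le_one_add_mul {D D' : ℝ → Space N → Space N} {v v' : ℝ → Space N → ℝ}
    (h : IsFirstOrderSolution D v) (h' : IsFirstOrderSolution D' v') (t : ℝ) {η : ℝ}
    (hη : 0 < η) : exteriorEnergy D v t ≤ (1 + η) * exteriorEnergy D' v' t
      + (1 + η⁻¹) * exteriorEnergy (fun t x => D t x - D' t x) (fun t x => v t x - v' t x) t := by
  have := setIntegral_energy_le_one_add_mul (h.memLp_fst t) (h.memLp_snd t) (h'.memLp_fst t)
    (h'.memLp_snd t) {x : Space N | |t| ≤ ‖x‖} hη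
  simp only [exteriorEnergy]
  linarith

theorem exteriorEnergy_nonneg (D : ℝ → Space N → Space N) (v : ℝ → Space N → ℝ) (t : ℝ) :
    0 ≤ exteriorEnergy D v t :=
  mul_nonneg (by norm_num) (integral_nonneg fun x => by positivity)

theorem exteriorEnergy_zero (D : ℝ → Space N → Space N) (v : ℝ → Space N → ℝ) :
    exteriorEnergy D v 0 = (1 / 2) * ∫ x, (‖D 0 x‖ ^ 2 + v 0 x ^ 2) := by
  simp [exteriorEnergy]

theorem exteriorEnergy_timeReversal (D : ℝ → Space N → Space N) (v : ℝ → Space N → ℝ) (t : ℝ) :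
    exteriorEnergy (fun t x => D (-t) x) (fun t x => - v (-t) x) t = exteriorEnergy D v (-t) := by
  simp [exteriorEnergy]

variable [Nontrivial (Space N)]

theorem IsFirstOrderSolution.exteriorEnergy_le {D : ℝ → Space N → Space N} {v : ℝ → Space N → ℝ}
    (h : IsFirstOrderSolution D v) {s t : ℝ} (hs : 0 ≤ s) (hst : s ≤ t) :
    exteriorEnergy D v t ≤ exteriorEnergy D v s := by
  have := h.setIntegral_energy_le 0 hst
  simp only [add_zero] at this
  rw [exteriorEnergy, exteriorEnergy, abs_of_nonneg hs, abs_of_nonneg (hs.trans hst)]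
  linarith

/-- The exterior energy never exceeds the energy at time `0`. -/
theorem IsFirstOrderSolution.exteriorEnergy_le_zero {D : ℝ → Space N → Space N}
    {v : ℝ → Space N → ℝ} (h : IsFirstOrderSolution D v) (t : ℝ) :
    exteriorEnergy D v t ≤ exteriorEnergy D v 0 := by
  rcases le_total 0 t with ht | ht
  · exact h.exteriorEnergy_le le_rfl ht
  · have := h.timeReversal.exteriorEnergy_le le_rfl (neg_nonneg.2 ht)
    rwa [exteriorEnergy_timeReversal, exteriorEnergy_timeReversal, neg_neg, neg_zero] at this

theorem IsFirstOrderSolution.exists_tendsto_exteriorEnergy {D : ℝ → Space N → Space N}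
    {v : ℝ → Space N → ℝ} (h : IsFirstOrderSolution D v) :
    ∃ L, Tendsto (exteriorEnergy D v) atTop (𝓝 L) ∧ ∀ t, 0 ≤ t → L ≤ exteriorEnergy D v t := by
  have hanti : Antitone fun t => exteriorEnergy D v (max t 0) := fun s t hst =>
    h.exteriorEnergy_le (le_max_right _ _) (max_le_max_right 0 hst)
  have hbdd : BddBelow (Set.range fun t => exteriorEnergy D v (max t 0)) :=
    ⟨0, by rintro _ ⟨t, rfl⟩; exact exteriorEnergy_nonneg D v _⟩
  refine ⟨_, (tendsto_atTop_ciInf hanti hbdd).congr' ?_, fun t ht => ?_⟩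
  · filter_upwards [eventually_ge_atTop 0] with t ht
    rw [max_eq_left ht]
  · have := ciInf_le hbdd t
    rwa [max_eq_left ht] at this

theorem IsFirstOrderSolution.exists_tendsto_exteriorEnergy_atBot {D : ℝ → Space N → Space N}
    {v : ℝ → Space N → ℝ} (h : IsFirstOrderSolution D v) :
    ∃ L, Tendsto (exteriorEnergy D v) atBot (𝓝 L) ∧ ∀ t, t ≤ 0 → L ≤ exteriorEnergy D v t := by
  obtain ⟨L, hL, hle⟩ := h.timeReversal.exists_tendsto_exteriorEnergy
  refine ⟨L, ?_, fun t ht => ?_⟩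
  · refine (hL.comp tendsto_neg_atBot_atTop).congr fun t => ?_
    rw [Function.comp_apply, exteriorEnergy_timeReversal, neg_neg]
  · simpa only [exteriorEnergy_timeReversal, neg_neg] using hle (-t) (neg_nonneg.2 ht)

/-- The form in which the errors of an approximation of order `η` are removed. -/
theorem le_of_forall_le_one_add_mul {P Q : ℝ}
    (h : ∀ η : ℝ, 0 < η → P ≤ (1 + η) * ((1 + η) * Q + 2 * (η + η ^ 2)) + 2 * (η + η ^ 2)) :
    P ≤ Q := by
  have hc : Continuous fun η : ℝ =>
      (1 + η) * ((1 + η) * Q + 2 * (η + η ^ 2)) + 2 * (η + η ^ 2) := by fun_prop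
  have hlim := (hc.tendsto 0).mono_left (nhdsWithin_le_nhds (s := Set.Ioi 0))
  refine ge_of_tendsto (by simpa using hlim) ?_
  filter_upwards [self_mem_nhdsWithin] with η hη using h η hη

/-- The limits of the exterior energy at `±∞` add up to the total energy whenever the data can be
approximated by data with a radiation field. -/
theorem IsFirstOrderSolution.add_eq_of_approx {m : ℕ} (hN : N = 2 * m + 1)
    {D : ℝ → Space N → Space N} {v : ℝ → Space N → ℝ} (h : IsFirstOrderSolution D v)
    (happ : ∀ δ : ℝ≥0∞, 0 < δ → ∃ (D' : ℝ → Space N → Space N) (v' : ℝ → Space N → ℝ)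
      (r : Metric.sphere (0 : Space N) 1 → ℝ → ℝ), IsFirstOrderSolution D' v' ∧
      HasRadiationField m D' v' r ∧ eLpNorm (fun x => D 0 x - D' 0 x) 2 volume < δ ∧
      eLpNorm (fun x => v 0 x - v' 0 x) 2 volume < δ)
    {L M : ℝ} (hL : Tendsto (exteriorEnergy D v) atTop (𝓝 L))
    (hM : Tendsto (exteriorEnergy D v) atBot (𝓝 M)) : L + M = exteriorEnergy D v 0 := by
  have happ' : ∀ η : ℝ, 0 < η → ∃ (D' : ℝ → Space N → Space N) (v' : ℝ → Space N → ℝ) (A B : ℝ),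
      IsFirstOrderSolution D' v' ∧ Tendsto (exteriorEnergy D' v') atTop (𝓝 A) ∧
      Tendsto (exteriorEnergy D' v') atBot (𝓝 B) ∧ A + B = exteriorEnergy D' v' 0 ∧
      exteriorEnergy (fun t x => D t x - D' t x) (fun t x => v t x - v' t x) 0 ≤ η ^ 2 := by
    intro η hη
    obtain ⟨D', v', r, h1, h2, h3, h4⟩ := happ (ENNReal.ofReal η) (ENNReal.ofReal_pos.2 hη)
    obtain ⟨A, B, hA, hB, hAB⟩ := h2.tendsto_exterior hN h1
    refine ⟨D', v', 1 / 2 * A, 1 / 2 * B, h1, hA.const_mul _, hB.const_mul _, ?_, ?_⟩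
    · rw [exteriorEnergy_zero, ← hAB, mul_add]
    · have hD := (h.sub h1).memLp_fst 0
      have hv := (h.sub h1).memLp_snd 0
      have hsq : ∀ {H : Type} [NormedAddCommGroup H] {f : Space N → H}, MemLp f 2 volume →
          eLpNorm f 2 volume < ENNReal.ofReal η → ∫ x, ‖f x‖ ^ 2 ≤ η ^ 2 := by
        intro H _ f hf hlt
        have h5 := hf.eLpNorm_eq_integral_rpow_norm (by norm_num) (by norm_num)
        rw [h5, ENNReal.ofReal_lt_ofReal_iff hη] at hlt
        simp only [ENNReal.toReal_ofNat, Real.rpow_ofNat] at hlt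
        rw [← one_div, ← Real.sqrt_eq_rpow] at hlt
        exact (Real.sqrt_lt' hη).1 hlt |>.le
      have h5 := hsq hD h3
      have h6 := hsq hv h4
      simp only [Real.norm_eq_abs, sq_abs] at h6
      rw [exteriorEnergy_zero, integral_add (hD.integrable_norm_pow (by norm_num)) hv.integrable_sq]
      linarith
  -- The error term `(1 + η⁻¹) η²` is `η + η²`, which tends to zero with `η`.
  have herr : ∀ η : ℝ, 0 < η → ∀ e : ℝ, e ≤ η ^ 2 → (1 + η⁻¹) * e ≤ η + η ^ 2 := by
    intro η hη e he
    calc (1 + η⁻¹) * e ≤ (1 + η⁻¹) * η ^ 2 := mul_le_mul_of_nonneg_left he (by positivity)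
      _ = η + η ^ 2 := by field_simp; ring
  refine le_antisymm (le_of_forall_le_one_add_mul fun η hη => ?_)
    (le_of_forall_le_one_add_mul fun η hη => ?_)
  all_goals
    obtain ⟨D', v', A, B, h1, hA, hB, hAB, hd⟩ := happ' η hη
    have hle := fun t => herr η hη _ (((h.sub h1).exteriorEnergy_le_zero t).trans hd)
    have hle' : ∀ t, (1 + η⁻¹) * exteriorEnergy (fun t x => D' t x - D t x)
        (fun t x => v' t x - v t x) t ≤ η + η ^ 2 := by
      intro t
      refine le_of_eq_of_le ?_ (hle t)
      simp only [exteriorEnergy, norm_sub_rev (D' _ _), sub_sq_comm (v' _ _)]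
    have hη2 : 0 ≤ η + η ^ 2 := by positivity
  · have hLA : L ≤ (1 + η) * A + (η + η ^ 2) :=
      le_of_tendsto_of_tendsto' hL ((hA.const_mul _).add_const _) fun t =>
        (exteriorEnergy_le_one_add_mul h h1 t hη).trans (by linarith [hle t])
    have hMB : M ≤ (1 + η) * B + (η + η ^ 2) :=
      le_of_tendsto_of_tendsto' hM ((hB.const_mul _).add_const _) fun t =>
        (exteriorEnergy_le_one_add_mul h h1 t hη).trans (by linarith [hle t])
    have h0 : A + B ≤ (1 + η) * exteriorEnergy D v 0 + 2 * (η + η ^ 2) := by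
      rw [hAB]
      exact (exteriorEnergy_le_one_add_mul h1 h 0 hη).trans (by linarith [hle' 0])
    have := mul_le_mul_of_nonneg_left h0 (by positivity : 0 ≤ 1 + η)
    linarith
  · have hLA : A ≤ (1 + η) * L + (η + η ^ 2) :=
      le_of_tendsto_of_tendsto' hA ((hL.const_mul _).add_const _) fun t =>
        (exteriorEnergy_le_one_add_mul h1 h t hη).trans (by linarith [hle' t])
    have hMB : B ≤ (1 + η) * M + (η + η ^ 2) :=
      le_of_tendsto_of_tendsto' hB ((hM.const_mul _).add_const _) fun t =>
        (exteriorEnergy_le_one_add_mul h1 h t hη).trans (by linarith [hle' t])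
    have h0 : exteriorEnergy D v 0 ≤ (1 + η) * (A + B) + 2 * (η + η ^ 2) := by
      rw [hAB]
      exact (exteriorEnergy_le_one_add_mul h h1 0 hη).trans (by linarith [hle 0])
    have := mul_le_mul_of_nonneg_left (add_le_add hLA hMB) (by positivity : 0 ≤ 1 + η)
    linarith

end Limit

end LinearWave

theorem propositionP (N : ℕ) (hN : 3 ≤ N) (hodd : Odd N)
    (u₀ u₁ : LinearWave.Space N → ℝ) (Du₀ : LinearWave.Space N → LinearWave.Space N)
    (hu₀ : LinearWave.MemHomogeneousSobolev u₀ Du₀) (hu₁ : MemLp u₁ 2 volume)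
    (u : ℝ → LinearWave.Space N → ℝ) (Du : ℝ → LinearWave.Space N → LinearWave.Space N)
    (v : ℝ → LinearWave.Space N → ℝ) (hu : LinearWave.IsSolution u₀ u₁ u Du v) :
    (∃ Eplus Eminus : ℝ,
      Tendsto (LinearWave.exteriorEnergy Du v) atTop (𝓝 Eplus) ∧
      Tendsto (LinearWave.exteriorEnergy Du v) atBot (𝓝 Eminus) ∧
      Eplus + Eminus = (1 / 2) * (∫ x, ‖Du₀ x‖ ^ 2) + (1 / 2) * ∫ x, u₁ x ^ 2) ∧
    ((∀ t : ℝ, 0 ≤ t →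
        (1 / 2) * ∫ x, (‖Du₀ x‖ ^ 2 + u₁ x ^ 2) ≤
          ∫ x in {x : LinearWave.Space N | t ≤ ‖x‖}, (‖Du t x‖ ^ 2 + v t x ^ 2)) ∨
      (∀ t : ℝ, t ≤ 0 →
        (1 / 2) * ∫ x, (‖Du₀ x‖ ^ 2 + u₁ x ^ 2) ≤
          ∫ x in {x : LinearWave.Space N | -t ≤ ‖x‖}, (‖Du t x‖ ^ 2 + v t x ^ 2))) := by
  have : Nonempty (Fin N) := ⟨⟨0, by omega⟩⟩
  have : Nontrivial (LinearWave.Space N) := inferInstance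
  obtain ⟨m, hm⟩ := hodd
  have h := hu.isFirstOrderSolution
  have hD0 : Du 0 =ᵐ[volume] Du₀ :=
    (hu.memHomogeneousSobolev 0).hasWeakGradient.ae_eq hu₀.hasWeakGradient hu.initial_position
  have hE0 : LinearWave.exteriorEnergy Du v 0 = (1 / 2) * ∫ x, (‖Du₀ x‖ ^ 2 + u₁ x ^ 2) := by
    rw [LinearWave.exteriorEnergy_zero]
    congr 1
    refine integral_congr_ae ?_
    filter_upwards [hD0, hu.initial_velocity] with x h1 h2
    rw [h1, h2]
  obtain ⟨L, hL, hLle⟩ := h.exists_tendsto_exteriorEnergy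
  obtain ⟨M, hM, hMle⟩ := h.exists_tendsto_exteriorEnergy_atBot
  have hLM := h.add_eq_of_approx hm (fun δ hδ => LinearWave.exists_radiative_approx (by omega) hm
    (hu.memHomogeneousSobolev 0) (hu.memLp 0) hδ) hL hM
  rw [hE0] at hLM
  refine ⟨⟨L, M, hL, hM, ?_⟩, ?_⟩
  · rw [hLM, integral_add (hu₀.memLp_gradient.integrable_norm_pow (by norm_num))
      hu₁.integrable_sq, mul_add]
  · -- The larger of the two limits is at least half of their sum, and it bounds the exterior energy
    -- from below at all times on its side.
    rcases le_total M L with hle | hle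
    · refine Or.inl fun t ht => ?_
      have := hLle t ht
      rw [LinearWave.exteriorEnergy, abs_of_nonneg ht] at this
      linarith
    · refine Or.inr fun t ht => ?_
      have := hMle t ht
      rw [LinearWave.exteriorEnergy, abs_of_nonpos ht] at this
      linarith
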